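/- Let $p,q>0$ and let $x:\mathbb Z^2\to\mathbb R$, $(m,n)\mapsto x_{m,n}$, be a real solution of the lattice potential KdV equation $$(x_{m+1,n+1}-x_{m,n})(x_{m+1,n}-x_{m,n+1})=p^2-q^2\qquad(m,n\in\mathbb Z)$$ such that, for constants $C_-,C_+\in\mathbb R$ independent of $n$, one has for every $n$ that $x_{m,n}-pm-qn\to C_\pm$ as $m\to\pm\infty$. Put $u_{m,n}=x_{m+1,n}-x_{m-1,n}-2p$ and $u_m=u_{m,0}$, and assume $\sum_m(1+|m|)|u_m|<\infty$ and $2p+u_m>0$ for all $m$. For $\operatorname{Im}z\ge0$ let $\varphi(m;z)=(p-iz)^m\chi(m;z)$ and $\psi(m;z)=(p+iz)^m\Upsilon(m;z)$ be the Jost solutions of $$g(m+2)-(2p+u_{m+1})g(m+1)+(p^2+z^2)g(m)=0,$$ where $\chi\to1$ as $m\to-\infty$ and $\Upsilon\to1$ as $m\to+\infty$ (at $z=ip$, $\Upsilon$ is required to solve the equation obtained by the substitution $g=(p+iz)^m\Upsilon$ and division by $(p+iz)^{m+1}$, i.e. $(p+iz)\Upsilon(m+2)-(2p+u_{m+1})\Upsilon(m+1)+(p-iz)\Upsilon(m)=0$).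 For real $z\ne0$ write $\psi(m;z)=a(z)\varphi(m;-z)+b(z)\varphi(m;z)$; for $\operatorname{Im}z>0$ let $a(z)=\frac{1}{2iz}\bigl[\varphi(0;z)\psi(1;z)-\varphi(1;z)\psi(0;z)\bigr]$. The zeros of $a$ in $\operatorname{Im}z>0$ are the discrete eigenvalues. Assume that $u$ is reflectionless, i.e. $b(z)=0$ for all real $z\ne0$, and that every discrete eigenvalue of the form $ik$, $k>0$, satisfies $k<q$. Then there are $N\ge0$, distinct numbers $k_1,\dots,k_N\in(0,p)\cap(0,q)$, constants $c_j>0$, $\rho^o_j>0$ $(1\le j\le N)$ and $C\in\mathbb R$ with the following properties. The discrete eigenvalues are exactly $ik_1,\dots,ik_N$. For each $j$ there is $b_j$ with $\psi(m;ik_j)=b_j\varphi(m;ik_j)$ for all $m$, $a'(ik_j)\neq0$, and $\epsilon_j:=b_j/a'(ik_j)$ satisfies $-i\epsilon_j=c_j\rho^o_j$. Moreover, with $$\rho_{p_j}=\frac{p+k_j}{p-k_j},\quad \rho_{q_j}=\frac{q+k_j}{q-k_j},\quad r_j=\rho_j^o\rho_{p_j}^m\rho_{q_j}^n,\quad M_{\nu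 j}=\frac{\rho_\nu^o\rho_{p_\nu}^m\rho_{q_\nu}^n\,c_j}{k_\nu+k_j},$$ for all $m,n\in\mathbb Z$ one has $\det M>0$, $\det(I+M)>0$ (so $I+M$ is invertible), and $$x_{m,n}=pm+qn+C-\mathbf c^{T}(I+M)^{-1}\mathbf r .$$ Finally, for each fixed $n$, let $\mathbf Q(m)^T=\mathbf c^T(I+M)^{-1}$, where $M$ is taken at $(m,n)$, and put $$K(m,L)=-\sum_\nu Q_\nu(m)\frac{\rho^o_\nu\rho_{p_\nu}^L\rho_{q_\nu}^n}{p+k_\nu},\qquad B(T)=\sum_j\frac{c_j\rho_j^o\rho_{q_j}^n}{p+k_j}\rho_{p_j}^T .$$ Then $K$ solves the discrete Gel'fand–Levitan equation $$K(m,L)+B(L)+\sum_{r=-\infty}^mK(m,r)\bigl(B(r-m+L)+B(r-m+L-1)\bigr)=0\qquad(L\le m)$$ with convergent sum, and for all $m$ one has $1+K(m,m)\ne0$ and $$u_{m,n}=2p\left[\frac{1+K(m+1,m+1)}{1+K(m,m)}-1\right].$$ -/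

import Mathlib

open Filter
open scoped Topology Matrix

noncomputable section

namespace LatticeKdV

/-- The lattice potential KdV equation with real parameters `p`, `q`, for a field `x m n`. -/
def IsSolution (p q : ℝ) (x : ℤ → ℤ → ℝ) : Prop :=
  ∀ m n : ℤ,
    (x (m + 1) (n + 1) - x m n) * (x (m + 1) n - x m (n + 1)) - p ^ 2 + q ^ 2 = 0

/-- `x` behaves like `p m + q n + const` as `m → -∞` and as `m → +∞`, for every `n`; the two
constants do not depend on `n` but may differ from each other. -/
def HasLinearAsymptotics (p q : ℝ) (x : ℤ → ℤ → ℝ) : Prop :=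
  ∃ Cminus Cplus : ℝ, ∀ n : ℤ,
    Tendsto (fun m : ℤ => x m n - p * m - q * n) atBot (𝓝 Cminus) ∧
    Tendsto (fun m : ℤ => x m n - p * m - q * n) atTop (𝓝 Cplus)

/-- The potential: `x_{m+1,n} - x_{m-1,n} = 2p + u_{m,n}`. -/
def potential (p : ℝ) (x : ℤ → ℤ → ℝ) (m n : ℤ) : ℝ :=
  x (m + 1) n - x (m - 1) n - 2 * p

/-! ### Direct scattering for `g(m+2) - (2p + u(m+1)) g(m+1) + (p² + z²) g(m) = 0` -/

/-- The discrete Schrödinger equation at the spectral parameter `z`. -/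
def SpectralEq (p : ℝ) (u : ℤ → ℝ) (z : ℂ) (g : ℤ → ℂ) : Prop :=
  ∀ m : ℤ, g (m + 2) - (2 * p + u (m + 1)) * g (m + 1) + (p ^ 2 + z ^ 2) * g m = 0

/-- `χ` is the left Jost solution with its boundary behaviour divided out: `(p - iz)^m χ(m)`
solves the spectral equation (see `spectralEq_left`) and `χ → 1` as `m → -∞`. -/
def IsLeftJost (p : ℝ) (u : ℤ → ℝ) (z : ℂ) (χ : ℤ → ℂ) : Prop :=
  (∀ m : ℤ, (p - Complex.I * z) * χ (m + 2) - (2 * p + u (m + 1)) * χ (m + 1)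
      + (p + Complex.I * z) * χ m = 0) ∧
    Tendsto χ atBot (𝓝 1)

/-- `Υ` is the right Jost solution with its boundary behaviour divided out: `(p + iz)^m Υ(m)`
solves the spectral equation (see `spectralEq_right`) and `Υ → 1` as `m → +∞`.
This normalised form also makes sense at `z = ip`, where `p + iz = 0`. -/
def IsRightJost (p : ℝ) (u : ℤ → ℝ) (z : ℂ) (Υ : ℤ → ℂ) : Prop :=
  (∀ m : ℤ, (p + Complex.I * z) * Υ (m + 2) - (2 * p + u (m + 1)) * Υ (m + 1)
      + (p - Complex.I * z) * Υ m = 0) ∧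
    Tendsto Υ atTop (𝓝 1)

theorem spectralEq_left {p : ℝ} {u : ℤ → ℝ} {z : ℂ} {χ : ℤ → ℂ}
    (hz : (p : ℂ) - Complex.I * z ≠ 0) (h : IsLeftJost p u z χ) :
    SpectralEq p u z (fun m => (p - Complex.I * z) ^ m * χ m) := by
  intro m
  have e2 : ((p : ℂ) - Complex.I * z) ^ (m + 2)
      = (p - Complex.I * z) ^ m * (p - Complex.I * z) ^ 2 := by
    rw [zpow_add₀ hz]; norm_cast
  have e1 := zpow_add_one₀ hz m
  have hI := Complex.I_sq
  simp only [e1, e2]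
  linear_combination ((p : ℂ) - Complex.I * z) ^ m * (p - Complex.I * z) * h.1 m
    + ((p : ℂ) - Complex.I * z) ^ m * χ m * z ^ 2 * hI

theorem spectralEq_right {p : ℝ} {u : ℤ → ℝ} {z : ℂ} {Υ : ℤ → ℂ}
    (hz : (p : ℂ) + Complex.I * z ≠ 0) (h : IsRightJost p u z Υ) :
    SpectralEq p u z (fun m => (p + Complex.I * z) ^ m * Υ m) := by
  intro m
  have e2 : ((p : ℂ) + Complex.I * z) ^ (m + 2)
      = (p + Complex.I * z) ^ m * (p + Complex.I * z) ^ 2 := by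
    rw [zpow_add₀ hz]; norm_cast
  have e1 := zpow_add_one₀ hz m
  have hI := Complex.I_sq
  simp only [e1, e2]
  linear_combination ((p : ℂ) + Complex.I * z) ^ m * (p + Complex.I * z) * h.1 m
    + ((p : ℂ) + Complex.I * z) ^ m * Υ m * z ^ 2 * hI

/-- The left Jost solution `φ(m; z) ∼ (p - iz)^m` as `m → -∞`. For a potential with finite first
moment and `Im z ≥ 0` it exists and is unique; these are the only `z` at which it is used. -/
def jostLeft (p : ℝ) (u : ℤ → ℝ) (z : ℂ) (m : ℤ) : ℂ :=
  (p - Complex.I * z) ^ m * Classical.epsilon (IsLeftJost p u z) m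

/-- The right Jost solution `ψ(m; z) ∼ (p + iz)^m` as `m → +∞`. For a potential with finite first
moment and `Im z ≥ 0` its normalised form exists and is unique; these are the only `z` at which
it is used. -/
def jostRight (p : ℝ) (u : ℤ → ℝ) (z : ℂ) (m : ℤ) : ℂ :=
  (p + Complex.I * z) ^ m * Classical.epsilon (IsRightJost p u z) m

/-- `a` and `b` are the scattering coefficients at `z`: `ψ(m;z) = a φ(m;-z) + b φ(m;z)`. -/
def IsScatteringPair (p : ℝ) (u : ℤ → ℝ) (z a b : ℂ) : Prop :=
  ∀ m : ℤ, jostRight p u z m = a * jostLeft p u (-z) m + b * jostLeft p u z m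

/-- The potential is reflectionless: `b(z) = 0` on the real axis. At `z = 0` the solutions
`φ(·;z)` and `φ(·;-z)` coincide and `b` is not defined. -/
def IsReflectionless (p : ℝ) (u : ℤ → ℝ) : Prop :=
  ∀ z : ℝ, z ≠ 0 → ∃ a : ℂ, IsScatteringPair p u z a 0

/-- The discrete Wronskian of two functions. -/
def wronskian (p : ℝ) (z : ℂ) (g₁ g₂ : ℤ → ℂ) (m : ℤ) : ℂ :=
  (g₁ m * g₂ (m + 1) - g₁ (m + 1) * g₂ m) / (p ^ 2 + z ^ 2) ^ m

/-- The coefficient `a(z) = W(φ, ψ; z) / (2iz)`, `Im z ≥ 0`, `z ≠ 0`. The Wronskian of two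
solutions does not depend on `m`, and is evaluated at `m = 0`. For real `z ≠ 0` this is the `a`
of `IsScatteringPair`, and for `Im z > 0` it is its analytic continuation. -/
def coeffA (p : ℝ) (u : ℤ → ℝ) (z : ℂ) : ℂ :=
  wronskian p z (jostLeft p u z) (jostRight p u z) 0 / (2 * Complex.I * z)

/-- The discrete eigenvalues: the zeros of `a` in the open upper half-plane. -/
def IsDiscreteEigenvalue (p : ℝ) (u : ℤ → ℝ) (z : ℂ) : Prop :=
  0 < z.im ∧ coeffA p u z = 0

/-- `ε` is the norming constant `b_k / a'(z_k)` at the discrete eigenvalue `z = z_k`, where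
`ψ(m; z_k) = b_k φ(m; z_k)` for all `m`. -/
def IsNormingConstant (p : ℝ) (u : ℤ → ℝ) (z ε : ℂ) : Prop :=
  ∃ b : ℂ, (∀ m : ℤ, jostRight p u z m = b * jostLeft p u z m) ∧
    deriv (coeffA p u) z ≠ 0 ∧ ε = b / deriv (coeffA p u) z

/-! ### The Cauchy matrix -/

/-- `ρ = (s + k) / (s - k)`, for `s = p` or `s = q`. -/
def rho (s k : ℝ) : ℝ := (s + k) / (s - k)

/-- The vector `r` with `r_j = ρ⁰_j ρ_{p_j}^m ρ_{q_j}^n`. -/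
def rVec {N : ℕ} (p q : ℝ) (k ρ₀ : Fin N → ℝ) (m n : ℤ) (j : Fin N) : ℝ :=
  ρ₀ j * rho p (k j) ^ m * rho q (k j) ^ n

/-- The matrix `M` with entries `ρ⁰_ν ρ_{p_ν}^m ρ_{q_ν}^n c_j / (k_ν + k_j)`. -/
def cauchyM {N : ℕ} (p q : ℝ) (k c ρ₀ : Fin N → ℝ) (m n : ℤ) : Matrix (Fin N) (Fin N) ℝ :=
  Matrix.of fun ν j => rVec p q k ρ₀ m n ν * c j / (k ν + k j)

/-- The kernel `K(m, L) = - ∑_ν Q_ν(m) ρ⁰_ν ρ_{p_ν}^L ρ_{q_ν}^n / (p + k_ν)`, with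
`Q(m)ᵀ = cᵀ (I + M)⁻¹`. -/
def kernelK {N : ℕ} (p q : ℝ) (k c ρ₀ : Fin N → ℝ) (n m L : ℤ) : ℝ :=
  - ∑ ν, (c ᵥ* (1 + cauchyM p q k c ρ₀ m n)⁻¹) ν * (rVec p q k ρ₀ L n ν / (p + k ν))

/-- The function `B(T) = ∑_j (-i ε_j(n)) / (p + k_j) ρ_{p_j}^T`, with
`-i ε_j(n) = c_j ρ⁰_j ρ_{q_j}^n`. -/
def kernelB {N : ℕ} (p q : ℝ) (k c ρ₀ : Fin N → ℝ) (n T : ℤ) : ℝ :=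
  ∑ j, c j * rVec p q k ρ₀ T n j / (p + k j)

/-- The discrete Gel'fand-Levitan equation
`K(m,L) + B(L) + ∑_{r ≤ m} K(m,r) (B(r-m+L) + B(r-m+L-1)) = 0` for `L ≤ m`; the sum is written
over `s = m - r` and its convergence is part of the statement. -/
def GelfandLevitan (K : ℤ → ℤ → ℝ) (B : ℤ → ℝ) : Prop :=
  ∀ m L : ℤ, L ≤ m →
    HasSum (fun s : ℕ => K m (m - s) * (B (L - s) + B (L - s - 1))) (-(K m L + B L))

end LatticeKdV

end

/-! The proof is inverse scattering on the row `n = 0`, followed by uniqueness of the evolution in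
`n`.

In the parameter ζ = (p + iz)/(p - iz) the upper half-plane becomes the unit disc. Once the plane
waves are divided out, the Jost solutions `X m`, `Y m` belong to the disc algebra: they come from a
Volterra equation solved by contraction in that Banach algebra (`exists_right_solution`), and the
first moment is what bounds its kernel. Absence of reflection says that Y_m(ζ) = a(ζ) X_m(conj ζ) on
the circle, with `a` continuous up to ζ = 1 (`exists_div_one_sub`). A Wronskian argument shows that
the zeros of `a` are positive reals (`zero_real`), and a monotone bilinear quantity shows that they
are simple and fixes a sign (`deriv_jostW_sign`). Removing the poles of Y_m/a leaves an analytic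
function whose boundary values are conjugate to those of another analytic function, so both are
constant and X_m is rational (`Scattering.left_formula`). Its values at the zeros solve a linear
system whose matrix is a Cauchy matrix plus a positive diagonal; this is the soliton formula on row
0 (`BoundStates.row_eq`).

The soliton formula itself satisfies the lattice equation and has limits independent of `n`. Given
one row, the next is a solution of a Riccati recursion tending to its repelling fixed point, and
such a solution is unique (`riccati_unique`). Hence the formula holds on every row
(`eq_soliton_of_row`).

Everything else is algebra of the vector `y` with `(C + D⁻¹) y = 1`, where `C` is the Cauchy matrix
and `D = diag (c_j r_j)`. Multiplying `D` by (s + k)/(s - k) is a Bäcklund shift, and its identities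
give the lattice equation and the formula for the potential. The Gel'fand-Levitan equation is
verified afterwards by summing geometric series; it is not used to find the solution. -/

noncomputable section

namespace LatticeKdV

/-! ### Cauchy matrices -/

/-- The symmetric Cauchy matrix with entries `1 / (k_i + k_j)`. -/
def cauchyMatrix {N : ℕ} (k : Fin N → ℝ) : Matrix (Fin N) (Fin N) ℝ :=
  Matrix.of fun i j => (k i + k j)⁻¹

/-- The Cauchy matrix perturbed by the inverse of a diagonal matrix `D`. -/
def gram {N : ℕ} (k D : Fin N → ℝ) : Matrix (Fin N) (Fin N) ℝ :=
  cauchyMatrix k + Matrix.diagonal fun i => (D i)⁻¹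

/-- One minus the ratio of this geometric series has numerator 2p(a + b), which produces the Cauchy
kernel 1/(a + b). It is used with `p = 1` for positivity and with the lattice parameter for the
Gel'fand-Levitan sum. -/
theorem hasSum_cayley_mul {p a b : ℝ} (hp : 0 < p) (ha : 0 < a) (hb : 0 < b) :
    HasSum (fun t : ℕ => ((p - a) / (p + a) * ((p - b) / (p + b))) ^ t)
      ((p + a) * (p + b) / (2 * p * (a + b))) := by
  have h : ∀ c : ℝ, 0 < c → |(p - c) / (p + c)| < 1 := by
    intro c hc
    rw [abs_lt, lt_div_iff₀ (by positivity), div_lt_one (by positivity)]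
    constructor <;> linarith
  have h1 : |(p - a) / (p + a) * ((p - b) / (p + b))| < 1 := by
    rw [abs_mul]
    exact mul_lt_one_of_nonneg_of_lt_one_left (abs_nonneg _) (h a ha) (h b hb).le
  convert hasSum_geometric_of_abs_lt_one h1 using 1
  rw [eq_comm, inv_eq_iff_eq_inv, inv_div]
  field_simp
  ring

theorem cauchyMatrix_quadForm_hasSum {N : ℕ} {k : Fin N → ℝ} (hk : ∀ i, 0 < k i)
    (x : Fin N → ℝ) :
    HasSum (fun t : ℕ => 2 * (∑ i, ((1 - k i) / (1 + k i)) ^ t * (x i / (1 + k i))) ^ 2)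
      (x ⬝ᵥ (cauchyMatrix k *ᵥ x)) := by
  have h1 : ∀ i j, HasSum (fun t : ℕ => 2 * (x i / (1 + k i)) * (x j / (1 + k j)) *
      ((1 - k i) / (1 + k i) * ((1 - k j) / (1 + k j))) ^ t) (x i * ((k i + k j)⁻¹ * x j)) := by
    intro i j
    have hi : 1 + k i ≠ 0 := by linarith [hk i]
    have hj : 1 + k j ≠ 0 := by linarith [hk j]
    have hij : k i + k j ≠ 0 := (add_pos (hk i) (hk j)).ne'
    have e : x i * ((k i + k j)⁻¹ * x j) = 2 * (x i / (1 + k i)) * (x j / (1 + k j)) *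
        ((1 + k i) * (1 + k j) / (2 * 1 * (k i + k j))) := by
      field_simp
    rw [e]
    exact (hasSum_cayley_mul one_pos (hk i) (hk j)).mul_left _
  have h2 := hasSum_sum (s := Finset.univ) fun i _ =>
    hasSum_sum (s := Finset.univ) fun j _ => h1 i j
  convert h2 using 1
  · ext t
    rw [sq, Finset.sum_mul_sum, Finset.mul_sum]
    refine Finset.sum_congr rfl fun i _ => ?_
    rw [Finset.mul_sum]
    refine Finset.sum_congr rfl fun j _ => ?_
    rw [mul_pow]
    ring
  · simp only [dotProduct, Matrix.mulVec, cauchyMatrix, Matrix.of_apply, Finset.mul_sum]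

/-- The quadratic form is a sum of squares. If it vanishes, all power sums with the distinct nodes
(1 - k)/(1 + k) vanish, and a Vandermonde argument gives `x = 0`. -/
theorem cauchyMatrix_posDef {N : ℕ} {k : Fin N → ℝ} (hk : ∀ i, 0 < k i)
    (hinj : Function.Injective k) : (cauchyMatrix k).PosDef := by
  refine Matrix.PosDef.of_dotProduct_mulVec_pos ?_ fun x hx => ?_
  · ext i j
    simp [cauchyMatrix, add_comm]
  have hs := cauchyMatrix_quadForm_hasSum hk x
  rw [star_trivial]
  by_contra hneg
  have h0 : x ⬝ᵥ (cauchyMatrix k *ᵥ x) = 0 :=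
    le_antisymm (not_lt.1 hneg) (hs.nonneg fun t => by positivity)
  rw [h0, hasSum_zero_iff_of_nonneg (fun t => by positivity)] at hs
  have hinj' : Function.Injective fun i => (1 - k i) / (1 + k i) := by
    intro i j hij
    apply hinj
    have hi := hk i
    have hj := hk j
    simp only at hij
    rw [div_eq_div_iff (by positivity) (by positivity)] at hij
    linarith
  have hz := Matrix.eq_zero_of_forall_pow_sum_mul_pow_eq_zero (f := fun i => (1 - k i) / (1 + k i))
    (v := fun i => x i / (1 + k i)) hinj' (fun t => by
      have := congrFun hs t
      simp only [Pi.zero_apply, mul_eq_zero, OfNat.ofNat_ne_zero, false_or] at this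
      have := pow_eq_zero_iff (two_ne_zero) |>.1 this
      simpa [mul_comm] using this)
  apply hx
  ext i
  have := congrFun hz i
  have hi := hk i
  simpa [hi.ne', (by positivity : (1 + k i) ≠ 0)] using this

theorem gram_posDef {N : ℕ} {k D : Fin N → ℝ} (hk : ∀ i, 0 < k i)
    (hinj : Function.Injective k) (hD : ∀ i, 0 < D i) : (gram k D).PosDef :=
  (cauchyMatrix_posDef hk hinj).add (Matrix.PosDef.diagonal fun i => inv_pos.2 (hD i))

/-- The solution of `(C + D⁻¹) y = 1`. -/
def gramSol {N : ℕ} (k D : Fin N → ℝ) : Fin N → ℝ := (gram k D)⁻¹ *ᵥ 1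

theorem gram_mulVec_gramSol {N : ℕ} {k D : Fin N → ℝ} (hk : ∀ i, 0 < k i)
    (hinj : Function.Injective k) (hD : ∀ i, 0 < D i) : gram k D *ᵥ gramSol k D = 1 := by
  rw [gramSol, Matrix.mulVec_mulVec, Matrix.mul_nonsing_inv _
    ((Matrix.isUnit_iff_isUnit_det _).1 (gram_posDef hk hinj hD).isUnit), Matrix.one_mulVec]

theorem eq_gramSol {N : ℕ} {k D : Fin N → ℝ} (hk : ∀ i, 0 < k i)
    (hinj : Function.Injective k) (hD : ∀ i, 0 < D i) {y : Fin N → ℝ}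
    (hy : gram k D *ᵥ y = 1) : y = gramSol k D := by
  rw [gramSol, ← hy, Matrix.mulVec_mulVec, Matrix.nonsing_inv_mul _
    ((Matrix.isUnit_iff_isUnit_det _).1 (gram_posDef hk hinj hD).isUnit), Matrix.one_mulVec]

theorem gram_mulVec {N : ℕ} (k D y : Fin N → ℝ) (i : Fin N) :
    (gram k D *ᵥ y) i = ∑ j, y j / (k i + k j) + y i / D i := by
  rw [gram, Matrix.add_mulVec, Pi.add_apply, Matrix.mulVec_diagonal]
  simp only [Matrix.mulVec, dotProduct, cauchyMatrix, Matrix.of_apply, div_eq_mul_inv]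
  simp only [mul_comm]

theorem gramSol_eq {N : ℕ} {k D : Fin N → ℝ} (hk : ∀ i, 0 < k i)
    (hinj : Function.Injective k) (hD : ∀ i, 0 < D i) (i : Fin N) :
    ∑ j, gramSol k D j / (k i + k j) + gramSol k D i / D i = 1 := by
  rw [← gram_mulVec, gram_mulVec_gramSol hk hinj hD, Pi.one_apply]

/-! ### Bäcklund shifts of the linear system. -/

/-- The shifted weights `D (s + k) / (s - k)`. -/
def shiftWeight {N : ℕ} (s : ℝ) (k D : Fin N → ℝ) (i : Fin N) : ℝ := D i * rho s (k i)

theorem rho_pos {s k : ℝ} (hk : 0 < k) (hs : k < s) : 0 < rho s k :=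
  div_pos (by linarith) (by linarith)

theorem shiftWeight_pos {N : ℕ} {s : ℝ} {k D : Fin N → ℝ} (hk : ∀ i, 0 < k i)
    (hs : ∀ i, k i < s) (hD : ∀ i, 0 < D i) (i : Fin N) : 0 < shiftWeight s k D i :=
  mul_pos (hD i) (rho_pos (hk i) (hs i))

/-- The action of a Bäcklund shift on `∑ y` and `∑ k y`. -/
theorem sum_gramSol_shift {N : ℕ} {s : ℝ} {k D : Fin N → ℝ} (hk : ∀ i, 0 < k i)
    (hinj : Function.Injective k) (hs : ∀ i, k i < s) (hD : ∀ i, 0 < D i) :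
    s * ∑ i, gramSol k (shiftWeight s k D) i - ∑ i, k i * gramSol k (shiftWeight s k D) i
      = s * ∑ i, gramSol k D i + ∑ i, k i * gramSol k D i
        - (∑ i, gramSol k (shiftWeight s k D) i) * ∑ i, gramSol k D i := by
  set y := gramSol k D with hy
  set z := gramSol k (shiftWeight s k D) with hz
  have e1 := fun i => gramSol_eq hk hinj hD i
  have e2 := fun i => gramSol_eq hk hinj (shiftWeight_pos hk hs hD) i
  rw [← hy] at e1
  rw [← hz] at e2
  -- Each system is paired with the solution of the other. The factors s - k and s + k make the two
  -- diagonal terms equal, and the Cauchy terms combine to ((s - k_i) - (s + k_j))/(k_i + k_j) = -1.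
  have h1 : ∑ i, z i * (s - k i) * (∑ j, y j / (k i + k j) + y i / D i)
      = ∑ i, z i * (s - k i) := by simp [e1]
  have h2 : ∑ i, y i * (s + k i) * (∑ j, z j / (k i + k j) + z i / shiftWeight s k D i)
      = ∑ i, y i * (s + k i) := by simp [e2]
  have h3 : ∑ i, z i * (s - k i) * (∑ j, y j / (k i + k j) + y i / D i)
      - ∑ i, y i * (s + k i) * (∑ j, z j / (k i + k j) + z i / shiftWeight s k D i)
      = - ((∑ i, z i) * ∑ i, y i) := by
    rw [Finset.sum_congr rfl fun i _ => mul_add (z i * (s - k i)) _ _,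
      Finset.sum_congr rfl fun i _ => mul_add (y i * (s + k i)) _ _]
    simp only [Finset.sum_add_distrib, Finset.mul_sum, Finset.sum_mul]
    rw [Finset.sum_comm (f := fun i j => y i * (s + k i) * (z j / (k i + k j)))]
    have h4 : ∑ i, y i * (s + k i) * (z i / shiftWeight s k D i)
        = ∑ i, z i * (s - k i) * (y i / D i) := by
      refine Finset.sum_congr rfl fun i _ => ?_
      have h5 := hk i
      have h6 := hD i
      have h7 : s - k i ≠ 0 := by linarith [hs i]
      have h8 : s + k i ≠ 0 := by linarith [hs i]
      rw [shiftWeight, rho]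
      field_simp
    rw [Finset.sum_comm (f := fun i j => z j * y i), h4, add_sub_add_right_eq_sub, ← Finset.sum_sub_distrib, ← Finset.sum_neg_distrib]
    refine Finset.sum_congr rfl fun i _ => ?_
    rw [← Finset.sum_sub_distrib, ← Finset.sum_neg_distrib]
    refine Finset.sum_congr rfl fun j _ => ?_
    have h5 : k i + k j ≠ 0 := (add_pos (hk i) (hk j)).ne'
    rw [add_comm (k j)]
    field_simp
    ring
  rw [h1, h2] at h3
  have h9 : ∑ i, z i * (s - k i) = s * ∑ i, z i - ∑ i, k i * z i := by
    rw [Finset.mul_sum, ← Finset.sum_sub_distrib]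
    exact Finset.sum_congr rfl fun i _ => by ring
  have h10 : ∑ i, y i * (s + k i) = s * ∑ i, y i + ∑ i, k i * y i := by
    rw [Finset.mul_sum, ← Finset.sum_add_distrib]
    exact Finset.sum_congr rfl fun i _ => by ring
  rw [h9, h10] at h3
  linarith

/-- The three-term recurrence of the solution `y` under a Bäcklund shift. -/
theorem gramSol_threeTerm {N : ℕ} {s : ℝ} {k D : Fin N → ℝ} (hk : ∀ i, 0 < k i)
    (hinj : Function.Injective k) (hs : ∀ i, k i < s) (hD : ∀ i, 0 < D i) (i : Fin N) :
    (s - k i) * gramSol k (shiftWeight s k (shiftWeight s k D)) i + (s + k i) * gramSol k D i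
      = (2 * s - ∑ j, gramSol k (shiftWeight s k (shiftWeight s k D)) j + ∑ j, gramSol k D j)
        * gramSol k (shiftWeight s k D) i := by
  set y := gramSol k D with hy
  have hE := shiftWeight_pos hk hs hD
  set E := shiftWeight s k D with hE'
  set z := gramSol k (shiftWeight s k E) with hz
  have e1 := fun i => gramSol_eq hk hinj hD i
  have e2 := fun i => gramSol_eq hk hinj (shiftWeight_pos hk hs hE) i
  rw [← hy] at e1
  rw [← hz] at e2
  set h := 2 * s - ∑ j, z j + ∑ j, y j with hh
  have hu : IsUnit (gram k E).det :=
    (Matrix.isUnit_iff_isUnit_det _).1 (gram_posDef hk hinj hE).isUnit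
  -- By invertibility it is enough that the combination solves the system at the middle weight `E`
  -- with a constant right-hand side.
  have key : gram k E *ᵥ (fun i => (s - k i) * z i + (s + k i) * y i) = h • 1 := by
    ext i
    rw [gram_mulVec, Pi.smul_apply, Pi.one_apply, smul_eq_mul, mul_one]
    have h5 := hk i
    have h6 := hD i
    have h7 : s - k i ≠ 0 := by linarith [hs i]
    have h8 : s + k i ≠ 0 := by linarith [hs i]
    have f1 : ((s - k i) * z i + (s + k i) * y i) / E i
        = (s + k i) * (z i / shiftWeight s k E i) + (s - k i) * (y i / D i) := by
      have h9 := hE i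
      simp only [shiftWeight, rho]
      rw [hE', shiftWeight, rho]
      field_simp
    have f2 : ∑ j, ((s - k j) * z j + (s + k j) * y j) / (k i + k j)
        = (s + k i) * ∑ j, z j / (k i + k j) + (s - k i) * ∑ j, y j / (k i + k j)
          - ∑ j, z j + ∑ j, y j := by
      simp only [Finset.mul_sum]
      rw [← Finset.sum_add_distrib, ← Finset.sum_sub_distrib, ← Finset.sum_add_distrib]
      refine Finset.sum_congr rfl fun j _ => ?_
      have h9 : k i + k j ≠ 0 := (add_pos (hk i) (hk j)).ne'
      field_simp
      ring
    rw [f1, f2, hh]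
    linear_combination (s + k i) * e2 i + (s - k i) * e1 i
  have h2 := congrArg (fun v => (gram k E)⁻¹ *ᵥ v) key
  simp only [Matrix.mulVec_mulVec, Matrix.nonsing_inv_mul _ hu, Matrix.one_mulVec,
    Matrix.mulVec_smul] at h2
  exact congrFun h2 i

/-- The quotient of tau functions `1 - ∑ y / (s + k)`. -/
def gramKappa {N : ℕ} (s : ℝ) (k D : Fin N → ℝ) : ℝ := 1 - ∑ i, gramSol k D i / (s + k i)

/-- The three-term recurrence is divided by s + k_i and summed, using (s - k)/(s + k) = 2s/(s + k) -
1. This is the source of the formula for the potential as a ratio of diagonal kernel values. -/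
theorem gramKappa_shift {N : ℕ} {s : ℝ} {k D : Fin N → ℝ} (hk : ∀ i, 0 < k i)
    (hinj : Function.Injective k) (hs : ∀ i, k i < s) (hD : ∀ i, 0 < D i) :
    2 * s * gramKappa s k (shiftWeight s k (shiftWeight s k D))
      = (2 * s - ∑ j, gramSol k (shiftWeight s k (shiftWeight s k D)) j + ∑ j, gramSol k D j)
        * gramKappa s k (shiftWeight s k D) := by
  have h := fun i => gramSol_threeTerm hk hinj hs hD i
  set z := gramSol k (shiftWeight s k (shiftWeight s k D)) with hz
  set y := gramSol k D with hy
  set h' := 2 * s - ∑ j, z j + ∑ j, y j with hh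
  have h1 : ∑ i, ((s - k i) * z i + (s + k i) * y i) / (s + k i)
      = h' * ∑ i, gramSol k (shiftWeight s k D) i / (s + k i) := by
    rw [Finset.mul_sum]
    exact Finset.sum_congr rfl fun i _ => by rw [h i, mul_div_assoc]
  have h2 : ∑ i, ((s - k i) * z i + (s + k i) * y i) / (s + k i)
      = 2 * s * ∑ i, z i / (s + k i) - ∑ i, z i + ∑ i, y i := by
    rw [Finset.mul_sum, ← Finset.sum_sub_distrib, ← Finset.sum_add_distrib]
    refine Finset.sum_congr rfl fun i _ => ?_
    have h5 := hk i
    have h8 : s + k i ≠ 0 := by linarith [hs i]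
    field_simp
    ring
  rw [gramKappa, gramKappa]
  rw [h2] at h1
  linear_combination hh - h1

/-- By the matrix determinant lemma `gramKappa` is a ratio of determinants. Since 1/(k_i + k_j) -
1/(s + k_i) = (s - k_j)/((s + k_i)(k_i + k_j)), the rank-one perturbation is, up to positive
diagonal factors on both sides, the same kind of matrix with backward-shifted weights. -/
theorem gramKappa_pos {N : ℕ} {s : ℝ} {k D : Fin N → ℝ} (hk : ∀ i, 0 < k i)
    (hinj : Function.Injective k) (hs : ∀ i, k i < s) (hD : ∀ i, 0 < D i) :
    0 < gramKappa s k D := by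
  have hG := gram_posDef hk hinj hD
  have hu : IsUnit (gram k D).det := (Matrix.isUnit_iff_isUnit_det _).1 hG.isUnit
  have hE : ∀ i, 0 < D i * ((s - k i) / (s + k i)) := fun i =>
    mul_pos (hD i) (div_pos (by linarith [hs i]) (by linarith [hs i, hk i]))
  have hd : (gram k D + Matrix.replicateCol Unit (fun i => -(s + k i)⁻¹) *
      Matrix.replicateRow Unit (1 : Fin N → ℝ)).det = (gram k D).det * gramKappa s k D := by
    rw [Matrix.det_add_replicateCol_mul_replicateRow hu]
    congr 1
    rw [Matrix.det_unique]
    simp only [Matrix.add_apply, Matrix.one_apply_eq, gramKappa, sub_eq_add_neg]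
    congr 1
    rw [Matrix.mul_assoc, Matrix.mul_apply, ← Finset.sum_neg_distrib]
    have hsym : ∀ i j, (gram k D)⁻¹ i j = (gram k D)⁻¹ j i := by
      intro i j
      have := hG.inv.isHermitian.apply i j
      simpa using this.symm
    simp only [Matrix.replicateRow_apply, Pi.one_apply, one_mul, Matrix.mul_apply,
      Matrix.replicateCol_apply, gramSol, Matrix.mulVec, dotProduct, mul_one, Finset.sum_div]
    rw [Finset.sum_comm]
    simp only [← Finset.sum_neg_distrib]
    refine Finset.sum_congr rfl fun i _ => Finset.sum_congr rfl fun j _ => ?_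
    rw [hsym j i]
    ring
  have hm : gram k D + Matrix.replicateCol Unit (fun i => -(s + k i)⁻¹) *
      Matrix.replicateRow Unit (1 : Fin N → ℝ)
      = Matrix.diagonal (fun i => (s + k i)⁻¹) *
        gram k (fun i => D i * ((s - k i) / (s + k i))) * Matrix.diagonal fun i => s - k i := by
    ext i j
    have h5 := hk i
    have h6 := hD i
    have h7 : s - k i ≠ 0 := by linarith [hs i]
    have h8 : s + k i ≠ 0 := by linarith [hs i]
    have h9 : k i + k j ≠ 0 := (add_pos (hk i) (hk j)).ne'
    rw [Matrix.mul_diagonal, Matrix.diagonal_mul]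
    by_cases hij : i = j
    · subst hij
      simp only [gram, cauchyMatrix, Matrix.add_apply, Matrix.of_apply, Matrix.diagonal_apply_eq,
        Matrix.mul_apply, Matrix.replicateCol_apply, Matrix.replicateRow_apply, Finset.univ_unique,
        Finset.sum_singleton, Pi.one_apply]
      field_simp
      ring
    · simp only [gram, cauchyMatrix, Matrix.add_apply, Matrix.of_apply,
        Matrix.diagonal_apply_ne _ hij, Matrix.mul_apply, Matrix.replicateCol_apply,
        Matrix.replicateRow_apply, Finset.univ_unique,
        Finset.sum_singleton, Pi.one_apply]
      field_simp
      ring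
  rw [hm, Matrix.det_mul, Matrix.det_mul, Matrix.det_diagonal, Matrix.det_diagonal] at hd
  have h1 : 0 < (gram k D).det * gramKappa s k D := by
    rw [← hd]
    refine mul_pos (mul_pos (Finset.prod_pos fun i _ => inv_pos.2 ?_)
      (gram_posDef hk hinj hE).det_pos) (Finset.prod_pos fun i _ => ?_) <;>
    linarith [hs i, hk i]
  exact pos_of_mul_pos_right h1 hG.det_pos.le

/-! ### The soliton matrix in terms of the perturbed Cauchy matrix -/

section Soliton

variable {N : ℕ} {p q : ℝ} {k c ρ₀ : Fin N → ℝ}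

/-- The weights `c_j r_j` at the lattice point `(m, n)`. -/
def weight (p q : ℝ) (k c ρ₀ : Fin N → ℝ) (m n : ℤ) (j : Fin N) : ℝ :=
  c j * rVec p q k ρ₀ m n j

theorem rVec_pos (hk : ∀ i, 0 < k i) (hp : ∀ i, k i < p) (hq : ∀ i, k i < q)
    (hρ : ∀ i, 0 < ρ₀ i) (m n : ℤ) (i : Fin N) : 0 < rVec p q k ρ₀ m n i :=
  mul_pos (mul_pos (hρ i) (zpow_pos (rho_pos (hk i) (hp i)) m))
    (zpow_pos (rho_pos (hk i) (hq i)) n)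

theorem weight_pos (hk : ∀ i, 0 < k i) (hp : ∀ i, k i < p) (hq : ∀ i, k i < q)
    (hc : ∀ i, 0 < c i) (hρ : ∀ i, 0 < ρ₀ i) (m n : ℤ) (i : Fin N) :
    0 < weight p q k c ρ₀ m n i :=
  mul_pos (hc i) (rVec_pos hk hp hq hρ m n i)

theorem rVec_add_left (hk : ∀ i, 0 < k i) (hp : ∀ i, k i < p) (m l n : ℤ) (i : Fin N) :
    rVec p q k ρ₀ (m + l) n i = rVec p q k ρ₀ m n i * rho p (k i) ^ l := by
  rw [rVec, rVec, zpow_add₀ (rho_pos (hk i) (hp i)).ne']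
  ring

theorem weight_succ_left (hk : ∀ i, 0 < k i) (hp : ∀ i, k i < p) (m n : ℤ) :
    weight p q k c ρ₀ (m + 1) n = shiftWeight p k (weight p q k c ρ₀ m n) := by
  ext i
  rw [weight, rVec_add_left hk hp, shiftWeight, weight, zpow_one, mul_assoc]

theorem weight_succ_right (hk : ∀ i, 0 < k i) (hq : ∀ i, k i < q) (m n : ℤ) :
    weight p q k c ρ₀ m (n + 1) = shiftWeight q k (weight p q k c ρ₀ m n) := by
  ext i
  rw [weight, rVec, zpow_add_one₀ (rho_pos (hk i) (hq i)).ne', shiftWeight, weight, rVec]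
  ring

/-- This replaces the non-symmetric `I + M` by the positive definite `gram`, so that determinants
and inverses can be read off from the symmetric system. -/
theorem one_add_cauchyM_eq (hk : ∀ i, 0 < k i) (hp : ∀ i, k i < p) (hq : ∀ i, k i < q)
    (hc : ∀ i, 0 < c i) (hρ : ∀ i, 0 < ρ₀ i) (m n : ℤ) :
    1 + cauchyM p q k c ρ₀ m n = Matrix.diagonal (rVec p q k ρ₀ m n) *
      gram k (weight p q k c ρ₀ m n) * Matrix.diagonal c := by
  ext i j
  have h1 := hc i
  have h2 := rVec_pos hk hp hq hρ m n i
  have h3 : k i + k j ≠ 0 := (add_pos (hk i) (hk j)).ne'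
  rw [Matrix.mul_diagonal, Matrix.diagonal_mul]
  by_cases hij : i = j
  · subst hij
    simp only [gram, cauchyMatrix, weight, cauchyM, Matrix.add_apply, Matrix.of_apply,
      Matrix.diagonal_apply_eq, Matrix.one_apply_eq]
    field_simp
    ring
  · simp only [gram, cauchyMatrix, cauchyM, Matrix.add_apply, Matrix.of_apply,
      Matrix.diagonal_apply_ne _ hij, Matrix.one_apply_ne hij]
    field_simp
    ring

theorem det_one_add_cauchyM_pos (hk : ∀ i, 0 < k i) (hinj : Function.Injective k)
    (hp : ∀ i, k i < p) (hq : ∀ i, k i < q)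
    (hc : ∀ i, 0 < c i) (hρ : ∀ i, 0 < ρ₀ i) (m n : ℤ) :
    0 < (1 + cauchyM p q k c ρ₀ m n).det := by
  rw [one_add_cauchyM_eq hk hp hq hc hρ, Matrix.det_mul, Matrix.det_mul, Matrix.det_diagonal,
    Matrix.det_diagonal]
  exact mul_pos (mul_pos (Finset.prod_pos fun i _ => rVec_pos hk hp hq hρ m n i)
    (gram_posDef hk hinj (weight_pos hk hp hq hc hρ m n)).det_pos)
    (Finset.prod_pos fun i _ => hc i)

theorem det_cauchyM_pos (hk : ∀ i, 0 < k i) (hinj : Function.Injective k)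
    (hp : ∀ i, k i < p) (hq : ∀ i, k i < q)
    (hc : ∀ i, 0 < c i) (hρ : ∀ i, 0 < ρ₀ i) (m n : ℤ) :
    0 < (cauchyM p q k c ρ₀ m n).det := by
  have h : cauchyM p q k c ρ₀ m n = Matrix.diagonal (rVec p q k ρ₀ m n) *
      cauchyMatrix k * Matrix.diagonal c := by
    ext i j
    rw [Matrix.mul_diagonal, Matrix.diagonal_mul]
    simp only [cauchyMatrix, cauchyM, Matrix.of_apply]
    ring
  rw [h, Matrix.det_mul, Matrix.det_mul, Matrix.det_diagonal, Matrix.det_diagonal]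
  exact mul_pos (mul_pos (Finset.prod_pos fun i _ => rVec_pos hk hp hq hρ m n i)
    (cauchyMatrix_posDef hk hinj).det_pos) (Finset.prod_pos fun i _ => hc i)

/-- The function `cᵀ (I + M)⁻¹ r`. -/
def solitonSum (p q : ℝ) (k c ρ₀ : Fin N → ℝ) (m n : ℤ) : ℝ :=
  c ⬝ᵥ ((1 + cauchyM p q k c ρ₀ m n)⁻¹ *ᵥ rVec p q k ρ₀ m n)

theorem solitonSum_eq (hk : ∀ i, 0 < k i) (hinj : Function.Injective k)
    (hp : ∀ i, k i < p) (hq : ∀ i, k i < q)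
    (hc : ∀ i, 0 < c i) (hρ : ∀ i, 0 < ρ₀ i) (m n : ℤ) :
    solitonSum p q k c ρ₀ m n = ∑ i, gramSol k (weight p q k c ρ₀ m n) i := by
  have hW := weight_pos hk hp hq hc hρ m n
  have hu : IsUnit (1 + cauchyM p q k c ρ₀ m n).det :=
    (det_one_add_cauchyM_pos hk hinj hp hq hc hρ m n).ne'.isUnit
  have h1 : (1 + cauchyM p q k c ρ₀ m n) *ᵥ
      (fun i => gramSol k (weight p q k c ρ₀ m n) i / c i) = rVec p q k ρ₀ m n := by
    rw [one_add_cauchyM_eq hk hp hq hc hρ, ← Matrix.mulVec_mulVec, ← Matrix.mulVec_mulVec]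
    have : Matrix.diagonal c *ᵥ (fun i => gramSol k (weight p q k c ρ₀ m n) i / c i)
        = gramSol k (weight p q k c ρ₀ m n) := by
      ext i
      rw [Matrix.mulVec_diagonal, mul_div_cancel₀ _ (hc i).ne']
    rw [this, gram_mulVec_gramSol hk hinj hW]
    ext i
    rw [Matrix.mulVec_diagonal, Pi.one_apply, mul_one]
  have h2 := congrArg (fun v => (1 + cauchyM p q k c ρ₀ m n)⁻¹ *ᵥ v) h1
  simp only [Matrix.mulVec_mulVec, Matrix.nonsing_inv_mul _ hu, Matrix.one_mulVec] at h2
  rw [solitonSum, ← h2, dotProduct]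
  exact Finset.sum_congr rfl fun i _ => mul_div_cancel₀ _ (hc i).ne'

theorem vecMul_one_add_cauchyM_inv (hk : ∀ i, 0 < k i) (hinj : Function.Injective k)
    (hp : ∀ i, k i < p) (hq : ∀ i, k i < q)
    (hc : ∀ i, 0 < c i) (hρ : ∀ i, 0 < ρ₀ i) (m n : ℤ) (i : Fin N) :
    (c ᵥ* (1 + cauchyM p q k c ρ₀ m n)⁻¹) i
      = gramSol k (weight p q k c ρ₀ m n) i / rVec p q k ρ₀ m n i := by
  have hW := weight_pos hk hp hq hc hρ m n
  have hr := rVec_pos hk hp hq hρ m n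
  have hG := gram_posDef hk hinj hW
  have hu : IsUnit (1 + cauchyM p q k c ρ₀ m n).det :=
    (det_one_add_cauchyM_pos hk hinj hp hq hc hρ m n).ne'.isUnit
  have h1 : (fun i => gramSol k (weight p q k c ρ₀ m n) i / rVec p q k ρ₀ m n i) ᵥ*
      (1 + cauchyM p q k c ρ₀ m n) = c := by
    rw [one_add_cauchyM_eq hk hp hq hc hρ, ← Matrix.vecMul_vecMul, ← Matrix.vecMul_vecMul]
    have : (fun i => gramSol k (weight p q k c ρ₀ m n) i / rVec p q k ρ₀ m n i) ᵥ*
        Matrix.diagonal (rVec p q k ρ₀ m n) = gramSol k (weight p q k c ρ₀ m n) := by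
      ext i
      rw [Matrix.vecMul_diagonal, div_mul_cancel₀ _ (hr i).ne']
    -- Row vectors act on the right system as column vectors do, because `gram` is symmetric.
    have hs : (gram k (weight p q k c ρ₀ m n))ᵀ = gram k (weight p q k c ρ₀ m n) := by
      have := hG.isHermitian.eq
      rwa [Matrix.conjTranspose_eq_transpose_of_trivial] at this
    rw [this, ← hs, Matrix.vecMul_transpose, gram_mulVec_gramSol hk hinj hW]
    ext i
    rw [Matrix.vecMul_diagonal, Pi.one_apply, one_mul]
  have h2 := congrArg (fun v => v ᵥ* (1 + cauchyM p q k c ρ₀ m n)⁻¹) h1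
  simp only [Matrix.vecMul_vecMul, Matrix.mul_nonsing_inv _ hu, Matrix.vecMul_one] at h2
  exact (congrFun h2 i).symm

end Soliton

/-! ### The lattice equation and the limits of the soliton sum. -/

section Soliton

variable {N : ℕ} {p q : ℝ} {k c ρ₀ : Fin N → ℝ}

/-- The shift identity is used on the four edges of an elementary square. With the right signs the
auxiliary sums ∑ k y cancel at all four corners, and only the sums ∑ y remain. -/
theorem solitonSum_lattice (hk : ∀ i, 0 < k i) (hinj : Function.Injective k)
    (hp : ∀ i, k i < p) (hq : ∀ i, k i < q)
    (hc : ∀ i, 0 < c i) (hρ : ∀ i, 0 < ρ₀ i) (m n : ℤ) :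
    (p + q + solitonSum p q k c ρ₀ m n - solitonSum p q k c ρ₀ (m + 1) (n + 1)) *
      (p - q + solitonSum p q k c ρ₀ m (n + 1) - solitonSum p q k c ρ₀ (m + 1) n)
      = p ^ 2 - q ^ 2 := by
  have hW := weight_pos hk hp hq hc hρ
  simp only [solitonSum_eq hk hinj hp hq hc hρ]
  have e1 := fun a b => sum_gramSol_shift hk hinj hp (hW a b)
  have e2 := fun a b => sum_gramSol_shift hk hinj hq (hW a b)
  simp only [← weight_succ_left hk hp] at e1
  simp only [← weight_succ_right hk hq] at e2
  linear_combination -e1 m (n + 1) + e2 (m + 1) n - e1 m n + e2 m n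

theorem tendsto_matrix_inv {ι : Type*} {l : Filter ι} {A : ι → Matrix (Fin N) (Fin N) ℝ}
    {B : Matrix (Fin N) (Fin N) ℝ} (hA : Tendsto A l (𝓝 B)) (hB : B.det ≠ 0) :
    Tendsto (fun i => (A i)⁻¹) l (𝓝 B⁻¹) := by
  simp only [Matrix.inv_def, Ring.inverse_eq_inv']
  have h1 : Tendsto (fun i => (A i).det) l (𝓝 B.det) :=
    ((continuous_id.matrix_det).tendsto B).comp hA
  have h2 : Tendsto (fun i => (A i).adjugate) l (𝓝 B.adjugate) :=
    ((continuous_id.matrix_adjugate).tendsto B).comp hA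
  exact (h1.inv₀ hB).smul h2

theorem one_lt_rho {s a : ℝ} (ha : 0 < a) (hs : a < s) : 1 < rho s a := by
  rw [rho, one_lt_div (by linarith)]
  linarith

theorem tendsto_zpow_atBot_zero {r : ℝ} (hr : 1 < r) :
    Tendsto (fun m : ℤ => r ^ m) atBot (𝓝 0) := by
  have h : Tendsto (fun m : ℤ => (r⁻¹) ^ m.toNat) atTop (𝓝 0) :=
    (tendsto_pow_atTop_nhds_zero_of_lt_one (by positivity) (inv_lt_one_of_one_lt₀ hr)).comp
      (tendsto_atTop_atTop.2 fun b => ⟨b, fun a ha => by omega⟩)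
  have h2 := h.comp tendsto_neg_atBot_atTop
  refine h2.congr' ?_
  filter_upwards [eventually_le_atBot 0] with m hm
  simp only [Function.comp_apply]
  rw [← zpow_natCast, Int.toNat_of_nonneg (by omega), inv_zpow, zpow_neg, inv_inv]

theorem tendsto_rVec_atBot (hk : ∀ i, 0 < k i) (hp : ∀ i, k i < p) (n : ℤ) (i : Fin N) :
    Tendsto (fun m => rVec p q k ρ₀ m n i) atBot (𝓝 0) := by
  have := ((tendsto_zpow_atBot_zero (one_lt_rho (hk i) (hp i))).const_mul (ρ₀ i)).mul_const
    (rho q (k i) ^ n)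
  simpa [rVec] using this

theorem tendsto_solitonSum_atBot (hk : ∀ i, 0 < k i) (hp : ∀ i, k i < p) (n : ℤ) :
    Tendsto (fun m => solitonSum p q k c ρ₀ m n) atBot (𝓝 0) := by
  have hr := fun i => tendsto_rVec_atBot (q := q) (ρ₀ := ρ₀) hk hp n i
  have h1 : Tendsto (fun m => 1 + cauchyM p q k c ρ₀ m n) atBot (𝓝 1) := by
    have : Tendsto (fun m => cauchyM p q k c ρ₀ m n) atBot (𝓝 0) := by
      refine tendsto_pi_nhds.2 fun i => tendsto_pi_nhds.2 fun j => ?_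
      have := ((hr i).mul_const (c j)).div_const (k i + k j)
      simpa [cauchyM] using this
    simpa using this.const_add 1
  have h2 := tendsto_matrix_inv h1 (by simp)
  have h3 : ∀ i j, Tendsto (fun m => (1 + cauchyM p q k c ρ₀ m n)⁻¹ i j) atBot
      (𝓝 ((1 : Matrix (Fin N) (Fin N) ℝ)⁻¹ i j)) := fun i j =>
    tendsto_pi_nhds.1 (tendsto_pi_nhds.1 h2 i) j
  have h4 : Tendsto (fun m => solitonSum p q k c ρ₀ m n) atBot
      (𝓝 (∑ i, c i * ∑ j, (1 : Matrix (Fin N) (Fin N) ℝ)⁻¹ i j * 0)) :=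
    tendsto_finsetSum _ fun i _ => (tendsto_finsetSum _ fun j _ =>
      (h3 i j).mul (hr j)).const_mul (c i)
  simpa using h4

/-- The inverse weights tend to zero, so `gram` tends to the bare Cauchy matrix. The limit therefore
does not depend on `n`, as the comparison with `x` on all rows requires. -/
theorem exists_tendsto_solitonSum_atTop (hk : ∀ i, 0 < k i) (hinj : Function.Injective k)
    (hp : ∀ i, k i < p) (hq : ∀ i, k i < q)
    (hc : ∀ i, 0 < c i) (hρ : ∀ i, 0 < ρ₀ i) :
    ∃ S : ℝ, ∀ n, Tendsto (fun m => solitonSum p q k c ρ₀ m n) atTop (𝓝 S) := by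
  refine ⟨∑ i, ∑ j, (cauchyMatrix k)⁻¹ i j * 1, fun n => ?_⟩
  have h1 : Tendsto (fun m => gram k (weight p q k c ρ₀ m n)) atTop (𝓝 (cauchyMatrix k)) := by
    refine tendsto_pi_nhds.2 fun i => tendsto_pi_nhds.2 fun j => ?_
    by_cases hij : i = j
    · subst hij
      have h2 := (tendsto_zpow_atBot_zero (one_lt_rho (hk i) (hp i))).comp tendsto_neg_atTop_atBot
      have h3 := (h2.const_mul (c i * ρ₀ i * rho q (k i) ^ n)⁻¹).const_add (cauchyMatrix k i i)
      simp only [mul_zero, add_zero] at h3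
      refine h3.congr fun m => ?_
      simp only [gram, Matrix.add_apply, Matrix.diagonal_apply_eq, Function.comp_apply, zpow_neg,
        weight, rVec, mul_inv]
      ring
    · simp only [gram, Matrix.add_apply, Matrix.diagonal_apply_ne _ hij, add_zero]
      exact tendsto_const_nhds
  have h2 := tendsto_matrix_inv h1 (cauchyMatrix_posDef hk hinj).det_pos.ne'
  have h3 : ∀ i j, Tendsto (fun m => (gram k (weight p q k c ρ₀ m n))⁻¹ i j) atTop
      (𝓝 ((cauchyMatrix k)⁻¹ i j)) := fun i j =>
    tendsto_pi_nhds.1 (tendsto_pi_nhds.1 h2 i) j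
  simp only [solitonSum_eq hk hinj hp hq hc hρ]
  exact tendsto_finsetSum _ fun i _ => tendsto_finsetSum _ fun j _ => (h3 i j).mul_const _

/-! ### The Gel'fand-Levitan equation -/

theorem kernelK_eq (hk : ∀ i, 0 < k i) (hinj : Function.Injective k)
    (hp : ∀ i, k i < p) (hq : ∀ i, k i < q)
    (hc : ∀ i, 0 < c i) (hρ : ∀ i, 0 < ρ₀ i) (n m l : ℤ) :
    kernelK p q k c ρ₀ n m (m + l)
      = - ∑ i, gramSol k (weight p q k c ρ₀ m n) i * rho p (k i) ^ l / (p + k i) := by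
  rw [kernelK]
  congr 1
  refine Finset.sum_congr rfl fun i _ => ?_
  rw [vecMul_one_add_cauchyM_inv hk hinj hp hq hc hρ, rVec_add_left hk hp]
  have := rVec_pos hk hp hq hρ m n i
  field_simp

/-- The diagonal kernel values are the quotients `gramKappa`, hence positive and linked by its shift
recurrence. -/
theorem one_add_kernelK_diag (hk : ∀ i, 0 < k i) (hinj : Function.Injective k)
    (hp : ∀ i, k i < p) (hq : ∀ i, k i < q)
    (hc : ∀ i, 0 < c i) (hρ : ∀ i, 0 < ρ₀ i) (n m : ℤ) :
    1 + kernelK p q k c ρ₀ n m m = gramKappa p k (weight p q k c ρ₀ m n) := by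
  have := kernelK_eq hk hinj hp hq hc hρ n m 0
  simp only [add_zero, zpow_zero, mul_one] at this
  rw [this, gramKappa, sub_eq_add_neg]

/-- Both factors are finite sums of exponentials in `s`. The products sum to Cauchy kernels 1/(k_i +
k_j), and the system defining `y` collapses the sum over `i` to 1 - y_j/W_j. -/
theorem gelfandLevitan (h0 : 0 < p) (hk : ∀ i, 0 < k i) (hinj : Function.Injective k)
    (hp : ∀ i, k i < p) (hq : ∀ i, k i < q)
    (hc : ∀ i, 0 < c i) (hρ : ∀ i, 0 < ρ₀ i) (n : ℤ) :
    GelfandLevitan (kernelK p q k c ρ₀ n) (kernelB p q k c ρ₀ n) := by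
  intro m L _
  set W := weight p q k c ρ₀ m n with hW
  have hWp : ∀ i, 0 < W i := weight_pos hk hp hq hc hρ m n
  set y := gramSol k W with hy
  have hpk : ∀ i, p + k i ≠ 0 := fun i => by linarith [hk i]
  have hpk' : ∀ i, p - k i ≠ 0 := fun i => by linarith [hp i]
  have hkk : ∀ i j, k i + k j ≠ 0 := fun i j => (add_pos (hk i) (hk j)).ne'
  have hrho : ∀ i, rho p (k i) ≠ 0 := fun i => (rho_pos (hk i) (hp i)).ne'
  have hB : ∀ l : ℤ, kernelB p q k c ρ₀ n (m + l)
      = ∑ j, W j * rho p (k j) ^ l / (p + k j) := by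
    intro l
    refine Finset.sum_congr rfl fun j _ => ?_
    rw [rVec_add_left hk hp, hW, weight, mul_assoc]
  -- Two neighbouring values of `B` combine through 1 + (p - k)/(p + k) = 2p/(p + k), which supplies
  -- the 2p that the geometric sum divides by.
  have hBB : ∀ s : ℕ, kernelB p q k c ρ₀ n (L - s) + kernelB p q k c ρ₀ n (L - s - 1)
      = ∑ j, W j * rho p (k j) ^ (L - m) * (2 * p) / (p + k j) ^ 2
          * ((p - k j) / (p + k j)) ^ s := by
    intro s
    have e1 : (L - s : ℤ) = m + (L - m - s) := by ring
    have e2 : (L - s - 1 : ℤ) = m + (L - m - s - 1) := by ring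
    rw [e2, hB, e1, hB, ← Finset.sum_add_distrib]
    refine Finset.sum_congr rfl fun j _ => ?_
    have e3 : (rho p (k j))⁻¹ = (p - k j) / (p + k j) := by rw [rho, inv_div]
    rw [zpow_sub_one₀ (hrho j), zpow_sub₀ (hrho j) _ (s : ℤ), zpow_natCast, ← e3, inv_pow, e3]
    have := hpk j
    have h9 := pow_ne_zero s (hrho j)
    field_simp
    ring
  have hK : ∀ s : ℕ, kernelK p q k c ρ₀ n m (m - s)
      = - ∑ i, y i / (p + k i) * ((p - k i) / (p + k i)) ^ s := by
    intro s
    rw [sub_eq_add_neg, kernelK_eq hk hinj hp hq hc hρ]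
    congr 1
    refine Finset.sum_congr rfl fun i _ => ?_
    have e3 : (rho p (k i))⁻¹ = (p - k i) / (p + k i) := by rw [rho, inv_div]
    rw [zpow_neg, zpow_natCast, ← e3, inv_pow]
    ring
  have hterm : ∀ i j, HasSum (fun s : ℕ => -(y i / (p + k i) *
      (W j * rho p (k j) ^ (L - m) * (2 * p) / (p + k j) ^ 2)) *
      ((p - k i) / (p + k i) * ((p - k j) / (p + k j))) ^ s)
      (-(W j * rho p (k j) ^ (L - m) / (p + k j) * (y i / (k i + k j)))) := by
    intro i j
    have e : -(W j * rho p (k j) ^ (L - m) / (p + k j) * (y i / (k i + k j)))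
        = -(y i / (p + k i) * (W j * rho p (k j) ^ (L - m) * (2 * p) / (p + k j) ^ 2)) *
          ((p + k i) * (p + k j) / (2 * p * (k i + k j))) := by
      have h1 := hpk i
      have h2 := hpk j
      have h3 := hkk i j
      field_simp
    rw [e]
    exact (hasSum_cayley_mul h0 (hk i) (hk j)).mul_left _
  have hall := hasSum_sum (s := Finset.univ) fun j _ =>
    hasSum_sum (s := Finset.univ) fun i _ => hterm i j
  have e1 : ∑ j, ∑ i, -(W j * rho p (k j) ^ (L - m) / (p + k j) * (y i / (k i + k j)))
      = -(kernelK p q k c ρ₀ n m L + kernelB p q k c ρ₀ n L) := by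
    have e2 : L = m + (L - m) := by ring
    rw [e2, hB, kernelK_eq hk hinj hp hq hc hρ, ← e2, ← hW, ← hy, neg_add, neg_neg,
      ← Finset.sum_neg_distrib, ← Finset.sum_add_distrib]
    refine Finset.sum_congr rfl fun j _ => ?_
    rw [Finset.sum_neg_distrib, ← Finset.mul_sum]
    have h1 := gramSol_eq hk hinj hWp j
    have h2 : ∑ i, y i / (k i + k j) = 1 - y j / W j := by
      rw [← h1, ← hy, add_sub_cancel_right]
      exact Finset.sum_congr rfl fun i _ => by rw [add_comm]
    rw [h2]
    have h3 := hWp j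
    have h4 := hpk j
    field_simp
    ring
  rw [← e1]
  refine hall.congr_fun fun s => ?_
  rw [hK, hBB, neg_mul, Finset.sum_mul_sum, Finset.sum_comm, ← Finset.sum_neg_distrib]
  refine Finset.sum_congr rfl fun j _ => ?_
  rw [← Finset.sum_neg_distrib]
  refine Finset.sum_congr rfl fun i _ => ?_
  rw [mul_pow]
  ring

theorem potential_soliton (hk : ∀ i, 0 < k i) (hinj : Function.Injective k)
    (hp : ∀ i, k i < p) (hq : ∀ i, k i < q)
    (hc : ∀ i, 0 < c i) (hρ : ∀ i, 0 < ρ₀ i) {x : ℤ → ℤ → ℝ} {C : ℝ} {n : ℤ}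
    (hx : ∀ m, x m n = p * m + q * n + C - solitonSum p q k c ρ₀ m n) (m : ℤ) :
    (2 * p + potential p x m n) * (1 + kernelK p q k c ρ₀ n m m)
      = 2 * p * (1 + kernelK p q k c ρ₀ n (m + 1) (m + 1)) := by
  have hW := weight_pos hk hp hq hc hρ
  -- The recurrence is started at `m - 1`, so that it spans the sites `m - 1`, `m`, `m + 1`
  -- occurring in the potential at `m`.
  have h := gramKappa_shift hk hinj hp (hW (m - 1) n)
  simp only [← weight_succ_left hk hp, sub_add_cancel] at h
  rw [one_add_kernelK_diag hk hinj hp hq hc hρ, one_add_kernelK_diag hk hinj hp hq hc hρ, h,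
    ← solitonSum_eq hk hinj hp hq hc hρ, ← solitonSum_eq hk hinj hp hq hc hρ, potential, hx, hx]
  push_cast
  ring

theorem one_add_kernelK_diag_pos (hk : ∀ i, 0 < k i) (hinj : Function.Injective k)
    (hp : ∀ i, k i < p) (hq : ∀ i, k i < q)
    (hc : ∀ i, 0 < c i) (hρ : ∀ i, 0 < ρ₀ i) (n m : ℤ) :
    0 < 1 + kernelK p q k c ρ₀ n m m := by
  rw [one_add_kernelK_diag hk hinj hp hq hc hρ]
  exact gramKappa_pos hk hinj hp (weight_pos hk hp hq hc hρ m n)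

theorem two_mul_add_potential_pos (h0 : 0 < p) (hk : ∀ i, 0 < k i) (hinj : Function.Injective k)
    (hp : ∀ i, k i < p) (hq : ∀ i, k i < q)
    (hc : ∀ i, 0 < c i) (hρ : ∀ i, 0 < ρ₀ i) {x : ℤ → ℤ → ℝ} {C : ℝ} {n : ℤ}
    (hx : ∀ m, x m n = p * m + q * n + C - solitonSum p q k c ρ₀ m n) (m : ℤ) :
    0 < 2 * p + potential p x m n := by
  have h1 := one_add_kernelK_diag_pos hk hinj hp hq hc hρ n m
  have h2 := one_add_kernelK_diag_pos hk hinj hp hq hc hρ n (m + 1)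
  refine pos_of_mul_pos_left (b := 1 + kernelK p q k c ρ₀ n m m) ?_ h1.le
  rw [potential_soliton hk hinj hp hq hc hρ hx m]
  positivity

end Soliton

/-! ### Uniqueness of the evolution in `n` -/

/-- The limiting map w ↦ α + β - P/w has fixed points α and β, and for α ≠ 0 its multiplier at α is
β/α, of modulus greater than one. Two solutions tending to this repelling point cannot approach each
other unless they coincide. When α = 0 the map degenerates: a nonzero value forces the next values
to be `h`, which tends to β ≠ 0. -/
theorem riccati_unique {P α β : ℝ} (hP : P = α * β) (hαβ : |α| < β) {h w w' : ℤ → ℝ}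
    (hh : ∀ m, h m ≠ 0) (hlim : Tendsto h atTop (𝓝 (α + β)))
    (hw : ∀ m, (h m - w (m + 1)) * w m = P) (hw' : ∀ m, (h m - w' (m + 1)) * w' m = P)
    (hwα : Tendsto w atTop (𝓝 α)) (hwα' : Tendsto w' atTop (𝓝 α)) : w = w' := by
  have hβ : 0 < β := lt_of_le_of_lt (abs_nonneg _) hαβ
  by_cases hα : α = 0
  · have key : ∀ v : ℤ → ℝ, (∀ m, (h m - v (m + 1)) * v m = P) → Tendsto v atTop (𝓝 α) →
        v = 0 := by
      intro v hv hvα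
      by_contra hne
      obtain ⟨m, hm⟩ := Function.ne_iff.1 hne
      have h1 : ∀ j : ℕ, v (m + j) ≠ 0 ∧ v (m + j + 1) = h (m + j) := by
        intro j
        have step : ∀ i : ℤ, v i ≠ 0 → v (i + 1) = h i := by
          intro i hi
          have := hv i
          rw [hP, hα, zero_mul] at this
          have := (mul_eq_zero.1 this).resolve_right hi
          linarith
        induction j with
        | zero => simpa using ⟨hm, step m hm⟩
        | succ j ih =>
          have h2 : v (m + j + 1) ≠ 0 := by rw [ih.2]; exact hh _
          push_cast
          rw [← add_assoc]
          exact ⟨h2, step _ h2⟩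
      have t : Tendsto (fun j : ℕ => m + (j : ℤ)) atTop atTop :=
        tendsto_atTop_add_const_left _ _ tendsto_natCast_atTop_atTop
      have t1 := hlim.comp t
      have t2 := hvα.comp (tendsto_atTop_add_const_right _ 1 t)
      have t3 := tendsto_nhds_unique t1 (t2.congr fun j => (h1 j).2)
      linarith
    rw [key w hw hwα, key w' hw' hwα']
  · have hP0 : P ≠ 0 := by rw [hP]; exact mul_ne_zero hα hβ.ne'
    -- The difference is multiplied by P/(w w') at each step; eventually |w w'| ≤ |P|, so its
    -- modulus no longer decreases, although it must tend to zero.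
    have hd : ∀ m, (w (m + 1) - w' (m + 1)) * (w m * w' m) = P * (w m - w' m) := by
      intro m
      linear_combination w m * hw' m - w' m * hw m
    have hlt : α * α < |P| := by
      rw [hP, abs_mul, abs_of_pos hβ, ← abs_mul_abs_self]
      exact mul_lt_mul_of_pos_left hαβ (abs_pos.2 hα)
    have hev : ∀ᶠ m in atTop, |w m * w' m| ≤ |P| := by
      have t := (hwα.mul hwα').abs
      rw [abs_mul_self] at t
      exact (t.eventually_lt_const hlt).mono fun _ h => h.le
    obtain ⟨m₀, hm₀⟩ := eventually_atTop.1 hev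
    by_contra hne
    obtain ⟨m, hm⟩ := Function.ne_iff.1 hne
    have hstep : ∀ i, w i ≠ w' i → w (i + 1) ≠ w' (i + 1) := by
      intro i hi he
      have := hd i
      rw [he, sub_self, zero_mul, eq_comm, mul_eq_zero] at this
      exact this.elim hP0 (sub_ne_zero.2 hi)
    have hne' : ∀ j : ℕ, w (m + j) ≠ w' (m + j) := by
      intro j
      induction j with
      | zero => simpa using hm
      | succ j ih =>
        push_cast
        rw [← add_assoc]
        exact hstep _ ih
    have hm1 : w (max m m₀) ≠ w' (max m m₀) := by
      have := hne' (max m m₀ - m).toNat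
      rwa [Int.toNat_of_nonneg (by simp), add_sub_cancel] at this
    have hmono : ∀ j : ℕ, |w (max m m₀) - w' (max m m₀)| ≤
        |w (max m m₀ + j) - w' (max m m₀ + j)| := by
      intro j
      induction j with
      | zero => simp
      | succ j ih =>
        refine ih.trans ?_
        push_cast
        rw [← add_assoc]
        set i : ℤ := max m m₀ + j
        have hi : m₀ ≤ i := by omega
        have h1 := congrArg abs (hd i)
        rw [abs_mul, abs_mul P] at h1
        have h2 := mul_le_mul_of_nonneg_left (hm₀ i hi) (abs_nonneg (w (i + 1) - w' (i + 1)))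
        rw [h1, mul_comm] at h2
        exact le_of_mul_le_mul_right h2 (abs_pos.2 hP0)
    have t : Tendsto (fun j : ℕ => max m m₀ + (j : ℤ)) atTop atTop :=
      tendsto_atTop_add_const_left _ _ tendsto_natCast_atTop_atTop
    have t1 := ((hwα.sub hwα').comp t).abs
    rw [sub_self, abs_zero] at t1
    have := ge_of_tendsto' t1 hmono
    exact hm1 (sub_eq_zero.1 (abs_eq_zero.1 (le_antisymm this (abs_nonneg _))))

theorem tendsto_row_diff {p q : ℝ} {x : ℤ → ℤ → ℝ} {C : ℝ} {l : Filter ℤ}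
    (hx : ∀ n, Tendsto (fun m : ℤ => x m n - p * m - q * n) l (𝓝 C)) {f g : ℤ → ℤ} {a : ℤ}
    {l' : Filter ℤ} (hf : Tendsto f l' l) (hg : Tendsto g l' l) (hfg : ∀ m, f m = g m + a)
    (n n' : ℤ) :
    Tendsto (fun m => x (f m) n - x (g m) n') l' (𝓝 (p * a + q * (n - n'))) := by
  have h := (((hx n).comp hf).sub ((hx n').comp hg)).add_const (p * a + q * (n - n'))
  rw [sub_self, zero_add] at h
  refine h.congr fun m => ?_
  simp only [Function.comp_apply, hfg]
  push_cast
  ring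

/-- For a known row `n`, the lattice equation is a Riccati recursion for w_m = x_{m+1,n} -
x_{m,n+1}. Equality of the constants on the two rows makes `w` tend to p - q, the repelling fixed
point towards m → +∞. -/
theorem row_succ_unique {p q : ℝ} (hp : 0 < p) (hq : 0 < q) {x y : ℤ → ℤ → ℝ} {C : ℝ}
    (hx : IsSolution p q x) (hy : IsSolution p q y)
    (hxC : ∀ n, Tendsto (fun m : ℤ => x m n - p * m - q * n) atTop (𝓝 C))
    (hyC : ∀ n, Tendsto (fun m : ℤ => y m n - p * m - q * n) atTop (𝓝 C)) {n : ℤ}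
    (hpos : ∀ m, 0 < 2 * p + potential p x m n) (hn : ∀ m, x m n = y m n) (m : ℤ) :
    x m (n + 1) = y m (n + 1) := by
  have t : ∀ a : ℤ, Tendsto (fun m : ℤ => m + a) atTop atTop := fun a =>
    tendsto_atTop_add_const_right _ _ tendsto_id
  have hw := riccati_unique (P := p ^ 2 - q ^ 2) (α := p - q) (β := p + q)
    (h := fun m => x (m + 2) n - x m n) (w := fun m => x (m + 1) n - x m (n + 1))
    (w' := fun m => y (m + 1) n - y m (n + 1)) (by ring)
    (by rw [abs_lt]; constructor <;> linarith)
    (fun m => by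
      have := hpos (m + 1)
      rw [potential, show m + 1 + 1 = m + 2 by ring, add_sub_cancel_right] at this
      exact ne_of_gt (by linarith))
    (by
      convert tendsto_row_diff hxC (t 2) (t 0) (a := 2) (fun m => by ring) n n using 2
      · simp
      · push_cast; ring)
    (fun m => by
      simp only [show m + 1 + 1 = m + 2 by ring]
      linear_combination hx m n)
    (fun m => by
      simp only [show m + 1 + 1 = m + 2 by ring, hn]
      linear_combination hy m n)
    (by
      convert tendsto_row_diff hxC (t 1) (t 0) (a := 1) (fun m => by ring) n (n + 1) using 2
      · simp
      · push_cast; ring)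
    (by
      convert tendsto_row_diff hyC (t 1) (t 0) (a := 1) (fun m => by ring) n (n + 1) using 2
      · simp
      · push_cast; ring)
  have := congrFun hw m
  simp only [hn] at this
  linarith

/-- Going down in `n` reverses the direction of instability, so the same recursion is run in the
variable -m and the limit at -∞ selects the solution. -/
theorem row_pred_unique {p q : ℝ} (hp : 0 < p) (hq : 0 < q) {x y : ℤ → ℤ → ℝ} {C : ℝ}
    (hx : IsSolution p q x) (hy : IsSolution p q y)
    (hxC : ∀ n, Tendsto (fun m : ℤ => x m n - p * m - q * n) atBot (𝓝 C))
    (hyC : ∀ n, Tendsto (fun m : ℤ => y m n - p * m - q * n) atBot (𝓝 C)) {n : ℤ}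
    (hpos : ∀ m, 0 < 2 * p + potential p x m (n + 1))
    (hn : ∀ m, x m (n + 1) = y m (n + 1)) (m : ℤ) :
    x m n = y m n := by
  have t : ∀ a : ℤ, Tendsto (fun m : ℤ => -m + a) atTop atBot := fun a =>
    tendsto_atBot_add_const_right _ _ tendsto_neg_atTop_atBot
  have hw := riccati_unique (P := p ^ 2 - q ^ 2) (α := p - q) (β := p + q)
    (h := fun m => x (-m + 1) (n + 1) - x (-m + -1) (n + 1))
    (w := fun m => x (-m + 1) n - x (-m) (n + 1))
    (w' := fun m => y (-m + 1) n - y (-m) (n + 1)) (by ring)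
    (by rw [abs_lt]; constructor <;> linarith)
    (fun m => by
      have := hpos (-m)
      rw [potential, sub_eq_add_neg (-m)] at this
      exact ne_of_gt (by linarith))
    (by
      convert tendsto_row_diff hxC (t 1) (t (-1)) (a := 2) (fun m => by ring) (n + 1) (n + 1)
        using 2
      push_cast; ring)
    (fun m => by
      simp only [show -(m + 1) = -m + -1 by ring, show -m + -1 + 1 = -m by ring]
      linear_combination hx (-m) n)
    (fun m => by
      simp only [show -(m + 1) = -m + -1 by ring, show -m + -1 + 1 = -m by ring, hn]
      linear_combination hy (-m) n)
    (by
      convert tendsto_row_diff hxC (t 1) (t 0) (a := 1) (fun m => by ring) n (n + 1) using 2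
      · simp
      · push_cast; ring)
    (by
      convert tendsto_row_diff hyC (t 1) (t 0) (a := 1) (fun m => by ring) n (n + 1) using 2
      · simp
      · push_cast; ring)
  have := congrFun hw (-m + 1)
  simp only [hn, show -(-m + 1) + 1 = m by ring] at this
  linarith

/-- A solution with a soliton row is the soliton solution. -/
theorem eq_soliton_of_row {N : ℕ} {p q : ℝ} {k c ρ₀ : Fin N → ℝ} (hp0 : 0 < p) (hq0 : 0 < q)
    (hk : ∀ i, 0 < k i) (hinj : Function.Injective k)
    (hp : ∀ i, k i < p) (hq : ∀ i, k i < q)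
    (hc : ∀ i, 0 < c i) (hρ : ∀ i, 0 < ρ₀ i) {x : ℤ → ℤ → ℝ} {C : ℝ}
    (hx : IsSolution p q x) (hasymp : HasLinearAsymptotics p q x)
    (hrow : ∀ m, x m 0 = p * m + C - solitonSum p q k c ρ₀ m 0) (m n : ℤ) :
    x m n = p * m + q * n + C - solitonSum p q k c ρ₀ m n := by
  obtain ⟨Cm, Cp, hC⟩ := hasymp
  obtain ⟨S, hS⟩ := exists_tendsto_solitonSum_atTop hk hinj hp hq hc hρ
  have hS' := fun n => tendsto_solitonSum_atBot (q := q) (c := c) (ρ₀ := ρ₀) hk hp n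
  set y : ℤ → ℤ → ℝ := fun m n => p * m + q * n + C - solitonSum p q k c ρ₀ m n with hy
  have hysol : IsSolution p q y := by
    intro m n
    have := solitonSum_lattice hk hinj hp hq hc hρ m n
    simp only [hy]
    push_cast
    linear_combination this
  have hyp : ∀ n, Tendsto (fun m : ℤ => y m n - p * m - q * n) atTop (𝓝 (C - S)) := by
    intro n
    refine ((hS n).const_sub C).congr fun m => ?_
    simp only [hy]; ring
  have hym : ∀ n, Tendsto (fun m : ℤ => y m n - p * m - q * n) atBot (𝓝 (C - 0)) := by
    intro n
    refine ((hS' n).const_sub C).congr fun m => ?_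
    simp only [hy]; ring
  have h0 : ∀ m, x m 0 = y m 0 := by
    intro m
    rw [hrow]
    simp [hy]
  -- Row 0 identifies the two constants of the soliton solution with those of `x`; since neither
  -- depends on `n`, the asymptotics then agree on every row.
  have e1 : C - S = Cp := tendsto_nhds_unique (hyp 0) ((hC 0).2.congr fun m => by rw [h0])
  have e2 : C - 0 = Cm := tendsto_nhds_unique (hym 0) ((hC 0).1.congr fun m => by rw [h0])
  rw [e1] at hyp
  rw [e2] at hym
  -- The uniqueness lemmas need a positive 2p + u on the known row. There `x` already equals the
  -- soliton by induction, and the soliton is positive.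
  have key : ∀ n : ℤ, ∀ m, x m n = y m n := by
    intro n
    induction n using Int.induction_on with
    | zero => exact h0
    | succ i ih =>
      exact row_succ_unique hp0 hq0 hx hysol (fun n => (hC n).2) hyp
        (two_mul_add_potential_pos hp0 hk hinj hp hq hc hρ ih) ih
    | pred i ih =>
      have e : (-(i : ℤ)) = -i - 1 + 1 := by ring
      rw [e] at ih
      exact row_pred_unique hp0 hq0 hx hysol (fun n => (hC n).1) hym
        (two_mul_add_potential_pos hp0 hk hinj hp hq hc hρ ih) ih
  exact key n m

/-! ### Jost solutions in a commutative Banach algebra -/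

section Volterra

variable {E : Type*} [NormedCommRing E] [NormOneClass E]

/-- The Volterra kernel `(1 + S)(1 + S + ⋯ + S^j)`. -/
def volterraKernel (S : E) (j : ℕ) : E := (1 + S) * ∑ i ∈ Finset.range (j + 1), S ^ i

theorem norm_pow_le_one {S : E} (hS : ‖S‖ ≤ 1) (i : ℕ) : ‖S ^ i‖ ≤ 1 :=
  (norm_pow_le _ _).trans (pow_le_one₀ (norm_nonneg _) hS)

theorem norm_one_add_le_two {S : E} (hS : ‖S‖ ≤ 1) : ‖1 + S‖ ≤ 2 :=
  (norm_add_le _ _).trans (by rw [norm_one]; linarith)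

theorem norm_volterraKernel_le {S : E} (hS : ‖S‖ ≤ 1) (j : ℕ) :
    ‖volterraKernel S j‖ ≤ 2 * (j + 1) := by
  refine (norm_mul_le _ _).trans (mul_le_mul (norm_one_add_le_two hS) ?_ (norm_nonneg _) two_pos.le)
  refine (norm_sum_le _ _).trans ((Finset.sum_le_sum fun i _ => norm_pow_le_one hS i).trans ?_)
  simp

/-- The weights `2 (i + 1) |V i|` which bound the Volterra operator. -/
def volterraWeight (V : ℕ → ℝ) (i : ℕ) : ℝ := 2 * ((i : ℝ) + 1) * |V i|

theorem volterraWeight_nonneg (V : ℕ → ℝ) (i : ℕ) : 0 ≤ volterraWeight V i := by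
  rw [volterraWeight]; positivity

variable [NormedAlgebra ℝ E]

theorem norm_volterraTerm_le {S : E} (hS : ‖S‖ ≤ 1) (V : ℕ → ℝ) (y : E) (n j : ℕ) :
    ‖V (n + j) • (volterraKernel S j * y)‖ ≤ volterraWeight V (n + j) * ‖y‖ := by
  rw [norm_smul, Real.norm_eq_abs, volterraWeight, mul_comm _ |V (n + j)|, mul_assoc |V (n + j)|]
  refine mul_le_mul_of_nonneg_left ((norm_mul_le _ _).trans
    (mul_le_mul_of_nonneg_right ((norm_volterraKernel_le hS j).trans ?_) (norm_nonneg _)))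
    (abs_nonneg _)
  push_cast
  linarith [(Nat.cast_nonneg n : (0 : ℝ) ≤ n)]

theorem norm_volterraDiff_le {S : E} (hS : ‖S‖ ≤ 1) (V : ℕ → ℝ) (y : E) (n j : ℕ) :
    ‖V (n + j) • ((1 + S) * S ^ j * y)‖ ≤ volterraWeight V (n + j) * ‖y‖ := by
  rw [norm_smul, Real.norm_eq_abs, volterraWeight, mul_comm _ |V (n + j)|, mul_assoc |V (n + j)|]
  have h1 : ‖(1 + S) * S ^ j‖ ≤ 2 * 1 := (norm_mul_le _ _).trans
    (mul_le_mul (norm_one_add_le_two hS) (norm_pow_le_one hS j) (norm_nonneg _) two_pos.le)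
  have h2 : ‖(1 + S) * S ^ j‖ ≤ 2 * (((n + j : ℕ) : ℝ) + 1) :=
    h1.trans (by linarith [(Nat.cast_nonneg (n + j) : (0 : ℝ) ≤ ((n + j : ℕ) : ℝ))])
  exact mul_le_mul_of_nonneg_left ((norm_mul_le _ _).trans
    (mul_le_mul_of_nonneg_right h2 (norm_nonneg _))) (abs_nonneg _)

variable [CompleteSpace E]

/-- A fixed point in the bounded sequences: the smallness of the total weight makes the Volterra
operator a contraction with constant 1/2. -/
theorem exists_volterra_solution {S : E} (hS : ‖S‖ ≤ 1) {V : ℕ → ℝ}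
    (hV : Summable (volterraWeight V)) (hV1 : ∑' i, volterraWeight V i ≤ 1 / 2) :
    ∃ (Y : ℕ → E) (B : ℝ), (∀ n, ‖Y n‖ ≤ B) ∧
      ∀ n, Y n = 1 + ∑' j, V (n + j) • (volterraKernel S j * Y (n + j + 1)) := by
  have hsum : ∀ n, Summable fun j => volterraWeight V (n + j) := fun n => by
    simpa only [add_comm n] using (summable_nat_add_iff n).2 hV
  have htail : ∀ n, ∑' j, volterraWeight V (n + j) ≤ 1 / 2 := fun n =>
    ((hsum n).tsum_le_tsum_of_inj (fun j => n + j) (add_right_injective n)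
      (fun c _ => volterraWeight_nonneg V c) (fun _ => le_rfl) hV).trans hV1
  have hsY : ∀ (f : BoundedContinuousFunction ℕ E) (n : ℕ),
      Summable fun j => V (n + j) • (volterraKernel S j * f (n + j + 1)) := fun f n =>
    Summable.of_norm_bounded ((hsum n).mul_right ‖f‖) fun j =>
      (norm_volterraTerm_le hS V _ n j).trans (mul_le_mul_of_nonneg_left (f.norm_coe_le_norm _)
        (volterraWeight_nonneg V _))
  have hbound : ∀ (f : BoundedContinuousFunction ℕ E) (n : ℕ),
      ‖∑' j, V (n + j) • (volterraKernel S j * f (n + j + 1))‖ ≤ 1 / 2 * ‖f‖ := fun f n =>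
    (tsum_of_norm_bounded ((hsum n).hasSum.mul_right ‖f‖) fun j =>
      (norm_volterraTerm_le hS V _ n j).trans (mul_le_mul_of_nonneg_left (f.norm_coe_le_norm _)
        (volterraWeight_nonneg V _))).trans
      (mul_le_mul_of_nonneg_right (htail n) (norm_nonneg _))
  let T : BoundedContinuousFunction ℕ E → BoundedContinuousFunction ℕ E := fun f =>
    BoundedContinuousFunction.ofNormedAddCommGroupDiscrete
      (fun n => 1 + ∑' j, V (n + j) • (volterraKernel S j * f (n + j + 1))) (1 + 1 / 2 * ‖f‖)
      fun n => (norm_add_le _ _).trans (by rw [norm_one]; gcongr; exact hbound f n)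
  have hT : ContractingWith (1 / 2) T := by
    refine ⟨by rw [← NNReal.coe_lt_coe]; push_cast; norm_num, LipschitzWith.of_dist_le_mul
      fun f g => ?_⟩
    push_cast
    rw [BoundedContinuousFunction.dist_le (by positivity)]
    intro n
    have e : T f n - T g n
        = ∑' j, V (n + j) • (volterraKernel S j * (f - g) (n + j + 1)) := by
      simp only [T, BoundedContinuousFunction.coe_ofNormedAddCommGroupDiscrete,
        BoundedContinuousFunction.sub_apply, mul_sub, smul_sub]
      rw [(hsY f n).tsum_sub (hsY g n), add_sub_add_left_eq_sub]
    rw [dist_eq_norm, e, dist_eq_norm]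
    exact hbound (f - g) n
  have hfix := hT.fixedPoint_isFixedPt
  set Y := ContractingWith.fixedPoint T hT
  refine ⟨Y, ‖Y‖, Y.norm_coe_le_norm, fun n => ?_⟩
  exact (congrArg (fun f : BoundedContinuousFunction ℕ E => f n) hfix).symm

/-- The differences D_n = Y_n - Y_{n+1} satisfy D_n = V_n (1 + S) Y_{n+1} + S D_{n+1}. Iterating
this and summing gives the Volterra kernel, so a solution of the summed equation solves the
recurrence. -/
theorem exists_right_solution_nat {S : E} (hS : ‖S‖ ≤ 1) {V : ℕ → ℝ}
    (hV : Summable (volterraWeight V)) (hV1 : ∑' i, volterraWeight V i ≤ 1 / 2) :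
    ∃ Y : ℕ → E, (∀ n, Y n - (1 + S) * ((1 + V n) • Y (n + 1)) + S * Y (n + 2) = 0) ∧
      Tendsto Y atTop (𝓝 1) := by
  obtain ⟨Y, B, hB, hY⟩ := exists_volterra_solution hS hV hV1
  have hsum : ∀ n, Summable fun j => volterraWeight V (n + j) := fun n => by
    simpa only [add_comm n] using (summable_nat_add_iff n).2 hV
  have hle : ∀ a n, volterraWeight V a * ‖Y n‖ ≤ volterraWeight V a * B := fun a n =>
    mul_le_mul_of_nonneg_left (hB n) (volterraWeight_nonneg V a)
  have hs1 : ∀ n, Summable fun j => V (n + j) • (volterraKernel S j * Y (n + j + 1)) := fun n =>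
    Summable.of_norm_bounded ((hsum n).mul_right B) fun j =>
      (norm_volterraTerm_le hS V _ n j).trans (hle _ _)
  have hs2 : ∀ n, Summable fun j => V (n + j) • ((1 + S) * S ^ j * Y (n + j + 1)) := fun n =>
    Summable.of_norm_bounded ((hsum n).mul_right B) fun j =>
      (norm_volterraDiff_le hS V _ n j).trans (hle _ _)
  set D : ℕ → E := fun n => ∑' j, V (n + j) • ((1 + S) * S ^ j * Y (n + j + 1)) with hD
  have hD1 : ∀ n, D n = V n • ((1 + S) * Y (n + 1)) + S * D (n + 1) := by
    intro n
    simp only [hD]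
    rw [(hs2 n).tsum_eq_zero_add, ← (hs2 (n + 1)).tsum_mul_left S]
    congr 1
    · simp
    · refine tsum_congr fun j => ?_
      rw [show n + (j + 1) = n + 1 + j by ring, mul_smul_comm, pow_succ]
      congr 1
      ring
  have hYD : ∀ n, Y n - Y (n + 1) = D n := by
    intro n
    rw [hY n, hY (n + 1), hD1, (hs1 n).tsum_eq_zero_add, add_sub_add_left_eq_sub, add_sub_assoc]
    congr 1
    · simp [volterraKernel]
    · have hs3 : Summable fun j => V (n + (j + 1)) • (volterraKernel S (j + 1)
          * Y (n + (j + 1) + 1)) := (summable_nat_add_iff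
            (f := fun j => V (n + j) • (volterraKernel S j * Y (n + j + 1))) 1).2 (hs1 n)
      simp only [hD]
      rw [← hs3.tsum_sub (hs1 (n + 1)), ← (hs2 (n + 1)).tsum_mul_left S]
      refine tsum_congr fun j => ?_
      rw [show n + (j + 1) = n + 1 + j by ring, mul_smul_comm, ← smul_sub, ← sub_mul,
        volterraKernel, volterraKernel, Finset.sum_range_succ _ (j + 1), ← mul_sub,
        add_sub_cancel_left, pow_succ]
      congr 1
      ring
  refine ⟨Y, fun n => ?_, ?_⟩
  · have h1 := hYD n
    have h2 := hYD (n + 1)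
    have h3 := hD1 n
    rw [← h1, ← h2] at h3
    rw [add_smul, one_smul, mul_add, mul_smul_comm]
    linear_combination h3
  · rw [tendsto_iff_norm_sub_tendsto_zero]
    have h1 : Tendsto (fun n => (∑' j, volterraWeight V (n + j)) * B) atTop (𝓝 (0 * B)) := by
      have := tendsto_sum_nat_add (volterraWeight V)
      simp only [add_comm] at this
      exact this.mul_const B
    rw [zero_mul] at h1
    refine squeeze_zero (fun _ => norm_nonneg _) (fun n => ?_) h1
    have : Y n - 1 = ∑' j, V (n + j) • (volterraKernel S j * Y (n + j + 1)) := by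
      rw [hY n, add_sub_cancel_left]
    rw [this]
    exact tsum_of_norm_bounded ((hsum n).hasSum.mul_right B) fun j =>
      (norm_volterraTerm_le hS V _ n j).trans (hle _ _)

end Volterra

/-- A second order backward recurrence extends from a half-line to all integers. -/
theorem exists_backward_extension {E : Type*} (F : ℤ → E → E → E) (m₀ : ℤ) (y : ℕ → E)
    (hy : ∀ n : ℕ, y n = F (m₀ + n) (y (n + 1)) (y (n + 2))) :
    ∃ Y : ℤ → E, (∀ m, Y m = F m (Y (m + 1)) (Y (m + 2))) ∧ ∀ n : ℕ, Y (m₀ + n) = y n := by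
  let z : ℕ → E × E := fun i => Nat.rec (y 0, y 1) (fun i w => (F (m₀ - i - 1) w.1 w.2, w.1)) i
  have hz : ∀ i, z (i + 1) = (F (m₀ - i - 1) (z i).1 (z i).2, (z i).1) := fun i => rfl
  let Y : ℤ → E := fun m => if m₀ ≤ m then y (m - m₀).toNat else (z (m₀ - m).toNat).1
  have h1 : ∀ n : ℕ, Y (m₀ + n) = y n := fun n => by simp [Y]
  have h2 : ∀ i : ℕ, Y (m₀ - i) = (z i).1 := by
    intro i
    rcases Nat.eq_zero_or_pos i with rfl | hi
    · simp [Y, z]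
    · simp only [Y]
      rw [if_neg (by omega)]
      simp
  have h3 : ∀ i : ℕ, Y (m₀ - i + 1) = (z i).2 := by
    intro i
    cases i with
    | zero =>
      have := h1 1
      simpa [z] using this
    | succ i =>
      rw [hz, ← h2]
      push_cast
      ring_nf
  refine ⟨Y, fun m => ?_, h1⟩
  rcases le_or_gt m₀ m with hm | hm
  · obtain ⟨n, rfl⟩ : ∃ n : ℕ, m = m₀ + n := ⟨(m - m₀).toNat, by omega⟩
    have e1 := h1 (n + 1)
    have e2 := h1 (n + 2)
    push_cast at e1 e2
    rw [← add_assoc] at e1 e2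
    rw [e1, e2, h1, hy n]
  · obtain ⟨i, rfl⟩ : ∃ i : ℕ, m = m₀ - (i + 1 : ℕ) := ⟨(m₀ - m).toNat - 1, by omega⟩
    rw [h2, hz]
    simp only
    rw [← h2, ← h3]
    push_cast
    ring_nf

/-- Finite first moment. -/
def FirstMoment (v : ℤ → ℝ) : Prop := Summable fun m : ℤ => (1 + |(m : ℝ)|) * |v m|

theorem FirstMoment.neg {v : ℤ → ℝ} (hv : FirstMoment v) : FirstMoment fun m => v (-m) := by
  have := (Equiv.neg ℤ).summable_iff.2 hv
  simpa [FirstMoment, Function.comp_def] using this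

theorem exists_right_solution {E : Type*} [NormedCommRing E] [NormedAlgebra ℝ E] [NormOneClass E]
    [CompleteSpace E] {S : E} (hS : ‖S‖ ≤ 1) {v : ℤ → ℝ} (hv : FirstMoment v) :
    ∃ Y : ℤ → E, (∀ m, Y m - (1 + S) * ((1 + v (m + 1)) • Y (m + 1)) + S * Y (m + 2) = 0) ∧
      Tendsto Y atTop (𝓝 1) := by
  have h1 : Summable fun i : ℕ => 2 * ((1 + (i : ℝ)) * |v i|) := by
    have := (hv.comp_injective (Nat.cast_injective (R := ℤ))).mul_left 2
    simpa [Function.comp_def] using this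
  have h2 := tendsto_sum_nat_add fun i : ℕ => 2 * ((1 + (i : ℝ)) * |v i|)
  -- The weights are only small far to the right. The solution is built from `m₀ - 1` onwards and
  -- continued to the left by the recurrence, where Y_m has coefficient one, so `S` need not be
  -- invertible.
  obtain ⟨m₀, hm₀⟩ := ((h2.eventually_lt_const one_half_pos).and
    (eventually_ge_atTop 1)).exists
  have hle : ∀ i, volterraWeight (fun i => v ((m₀ - 1 : ℤ) + i + 1)) i
      ≤ 2 * ((1 + ((i + m₀ : ℕ) : ℝ)) * |v (i + m₀ : ℕ)|) := by
    intro i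
    have e : (m₀ - 1 : ℤ) + i + 1 = ((i + m₀ : ℕ) : ℤ) := by push_cast; ring
    rw [volterraWeight, e, mul_assoc]
    refine mul_le_mul_of_nonneg_left (mul_le_mul_of_nonneg_right ?_ (abs_nonneg _)) two_pos.le
    push_cast
    linarith [(Nat.cast_nonneg m₀ : (0 : ℝ) ≤ m₀)]
  have h3 : Summable fun i : ℕ => 2 * ((1 + ((i + m₀ : ℕ) : ℝ)) * |v (i + m₀ : ℕ)|) :=
    (summable_nat_add_iff m₀).2 h1
  have h4 : Summable (volterraWeight fun i => v ((m₀ - 1 : ℤ) + i + 1)) :=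
    Summable.of_nonneg_of_le (volterraWeight_nonneg _) hle h3
  obtain ⟨y, hy, hy1⟩ := exists_right_solution_nat hS h4
    ((h4.tsum_le_tsum hle h3).trans hm₀.1.le)
  obtain ⟨Y, hY, hYy⟩ := exists_backward_extension
    (fun m a b => (1 + S) * ((1 + v (m + 1)) • a) - S * b) (m₀ - 1 : ℤ) y
    (fun n => by linear_combination hy n)
  refine ⟨Y, fun m => by linear_combination hY m, ?_⟩
  refine (hy1.comp (g := y) (f := fun m : ℤ => (m - (m₀ - 1)).toNat)
    (tendsto_atTop_atTop.2 fun b => ⟨b + m₀, fun a ha => by omega⟩)).congr' ?_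
  filter_upwards [eventually_ge_atTop (m₀ - 1 : ℤ)] with m hm
  rw [Function.comp_apply, ← hYy]
  congr 1
  omega

/-! ### The disc algebra -/

/-- The closed unit disc. -/
abbrev cDisk : Set ℂ := Metric.closedBall (0 : ℂ) 1

/-- The open unit disc. -/
abbrev oDisk : Set ℂ := Metric.ball (0 : ℂ) 1

theorem closure_oDisk : closure oDisk = cDisk := closure_ball _ one_ne_zero

theorem frontier_oDisk : frontier oDisk = Metric.sphere (0 : ℂ) 1 := frontier_ball _ one_ne_zero

theorem mem_cDisk {z : ℂ} : z ∈ cDisk ↔ ‖z‖ ≤ 1 := by simp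

theorem mem_oDisk {z : ℂ} : z ∈ oDisk ↔ ‖z‖ < 1 := by simp

/-- The disc algebra: uniform limits of polynomials on the closed unit disc. -/
abbrev diskAlg : Subalgebra ℂ C(cDisk, ℂ) := (polynomialFunctions cDisk).topologicalClosure

instance : CompleteSpace diskAlg :=
  (Subalgebra.isClosed_topologicalClosure _).completeSpace_coe

instance : Nonempty cDisk := ⟨⟨0, by simp⟩⟩

instance : NormOneClass diskAlg := ⟨by
  change ‖(1 : C(cDisk, ℂ))‖ = 1
  exact norm_one⟩

open Classical in
/-- A function on the closed unit disc, extended by zero. -/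
def diskEval (F : C(cDisk, ℂ)) (z : ℂ) : ℂ := if h : z ∈ cDisk then F ⟨z, h⟩ else 0

theorem diskEval_of_mem (F : C(cDisk, ℂ)) {z : ℂ} (h : z ∈ cDisk) : diskEval F z = F ⟨z, h⟩ :=
  dif_pos h

theorem continuousOn_diskEval (F : C(cDisk, ℂ)) : ContinuousOn (diskEval F) cDisk := by
  rw [continuousOn_iff_continuous_domRestrict]
  convert F.continuous using 1
  ext z
  simp only [Set.domRestrict_apply]
  exact diskEval_of_mem F z.2

theorem norm_diskEval_sub_le (F G : C(cDisk, ℂ)) {z : ℂ} (h : z ∈ cDisk) :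
    ‖diskEval F z - diskEval G z‖ ≤ ‖F - G‖ := by
  rw [diskEval_of_mem F h, diskEval_of_mem G h, ← ContinuousMap.sub_apply]
  exact (F - G).norm_coe_le_norm _

theorem diskEval_polynomial (P : Polynomial ℂ) {z : ℂ} (h : z ∈ cDisk) :
    diskEval (P.toContinuousMapOn cDisk) z = P.eval z := by
  rw [diskEval_of_mem _ h]
  simp

theorem exists_polynomial_near (F : diskAlg) {ε : ℝ} (hε : 0 < ε) :
    ∃ P : Polynomial ℂ, ∀ z ∈ cDisk, ‖P.eval z - diskEval F z‖ < ε := by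
  obtain ⟨G, hG, hd⟩ := Metric.mem_closure_iff.1 F.2 ε hε
  obtain ⟨P, -, rfl⟩ : ∃ P ∈ (⊤ : Subalgebra ℂ (Polynomial ℂ)),
      Polynomial.toContinuousMapOnAlgHom cDisk P = G := hG
  refine ⟨P, fun z hz => ?_⟩
  rw [← diskEval_polynomial P hz]
  refine (norm_diskEval_sub_le _ _ hz).trans_lt ?_
  rw [← dist_eq_norm, dist_comm]
  exact hd

theorem diffContOnCl_diskEval (F : diskAlg) : DiffContOnCl ℂ (diskEval F) oDisk := by
  refine ⟨?_, by rw [closure_oDisk]; exact continuousOn_diskEval F⟩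
  choose P hP using fun n : ℕ =>
    exists_polynomial_near F (Nat.one_div_pos_of_nat (α := ℝ) (n := n))
  have h : TendstoUniformlyOn (fun n z => (P n).eval z) (diskEval F) atTop oDisk := by
    rw [Metric.tendstoUniformlyOn_iff]
    intro ε hε
    filter_upwards [tendsto_one_div_add_atTop_nhds_zero_nat.eventually_lt_const hε] with n hn z hz
    rw [dist_comm, dist_eq_norm]
    exact (hP n z (Metric.ball_subset_closedBall hz)).trans hn
  exact h.tendstoLocallyUniformlyOn.differentiableOn
    (Eventually.of_forall fun n => (P n).differentiable.differentiableOn) Metric.isOpen_ball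

/-- The coordinate function as an element of the disc algebra. -/
def diskZ : diskAlg := ⟨(Polynomial.X : Polynomial ℂ).toContinuousMapOn cDisk,
  Subalgebra.le_topologicalClosure _ (Subalgebra.mem_map.2 ⟨Polynomial.X, trivial, rfl⟩)⟩

theorem norm_diskZ_le : ‖diskZ‖ ≤ 1 := by
  change ‖(Polynomial.X : Polynomial ℂ).toContinuousMapOn cDisk‖ ≤ 1
  rw [ContinuousMap.norm_le _ zero_le_one]
  rintro ⟨z, hz⟩
  simpa using hz

/-- The right Jost solutions, as functions of the uniformising parameter in the unit disc. -/
theorem exists_right_jost {v : ℤ → ℝ} (hv : FirstMoment v) :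
    ∃ Y : ℤ → ℂ → ℂ,
      (∀ m, ∀ z ∈ cDisk, Y m z - (1 + z) * ((1 + v (m + 1)) * Y (m + 1) z) + z * Y (m + 2) z = 0) ∧
      (∀ m, DiffContOnCl ℂ (Y m) oDisk) ∧
      TendstoUniformlyOn Y 1 atTop cDisk ∧
      ∀ᶠ m in atTop, ∀ ε > 0, ∃ P : Polynomial ℂ, ∀ z ∈ cDisk, ‖P.eval z * Y m z - 1‖ ≤ ε := by
  obtain ⟨y, hy, hy1⟩ := exists_right_solution norm_diskZ_le hv
  refine ⟨fun m => diskEval (y m), fun m z hz => ?_, fun m => diffContOnCl_diskEval _, ?_, ?_⟩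
  · have h := congrArg (fun F : diskAlg => (F : C(cDisk, ℂ)) ⟨z, hz⟩) (hy m)
    simp only [diskEval_of_mem _ hz]
    have hZ : (diskZ : C(cDisk, ℂ)) ⟨z, hz⟩ = z := by simp [diskZ]
    have hs : ∀ (r : ℝ) (F : diskAlg), ((r • F : diskAlg) : C(cDisk, ℂ)) ⟨z, hz⟩
        = r * (F : C(cDisk, ℂ)) ⟨z, hz⟩ := fun r F => by
      change r • ((F : C(cDisk, ℂ)) ⟨z, hz⟩) = _
      rw [Complex.real_smul]
    replace h : (y m : C(cDisk, ℂ)) ⟨z, hz⟩ - (1 + (diskZ : C(cDisk, ℂ)) ⟨z, hz⟩) *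
        (((1 + v (m + 1)) • y (m + 1) : diskAlg) : C(cDisk, ℂ)) ⟨z, hz⟩ +
        (diskZ : C(cDisk, ℂ)) ⟨z, hz⟩ * (y (m + 2) : C(cDisk, ℂ)) ⟨z, hz⟩ = 0 := h
    rw [hZ, hs] at h
    push_cast at h
    exact h
  · rw [Metric.tendstoUniformlyOn_iff]
    intro ε hε
    filter_upwards [Metric.tendsto_nhds.1 hy1 ε hε] with m hm z hz
    rw [dist_comm, dist_eq_norm]
    have := norm_diskEval_sub_le (y m) (1 : diskAlg) hz
    rw [diskEval_of_mem _ hz, diskEval_of_mem _ hz] at this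
    rw [diskEval_of_mem _ hz]
    refine lt_of_le_of_lt this ?_
    rw [dist_eq_norm] at hm
    exact hm
  · filter_upwards [Metric.tendsto_nhds.1 hy1 1 one_pos] with m hm ε hε
    -- Close to its limit 1 the solution is a unit of the disc algebra, and its inverse is again a
    -- uniform limit of polynomials.
    have hu : IsUnit (y m) := by
      have : y m = 1 - (1 - y m) := by ring
      rw [this]
      refine isUnit_one_sub_of_norm_lt_one ?_
      rwa [dist_comm, dist_eq_norm] at hm
    obtain ⟨κ, hκ⟩ := hu.exists_left_inv
    obtain ⟨P, hP⟩ := exists_polynomial_near κ (ε := ε / (‖(y m : C(cDisk, ℂ))‖ + 1))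
      (by positivity)
    refine ⟨P, fun z hz => ?_⟩
    have h1 : diskEval κ z * diskEval (y m) z = 1 := by
      have h := congrArg (fun F : diskAlg => (F : C(cDisk, ℂ)) ⟨z, hz⟩) hκ
      rw [diskEval_of_mem _ hz, diskEval_of_mem _ hz]
      exact h
    have h2 : ‖diskEval (y m) z‖ ≤ ‖(y m : C(cDisk, ℂ))‖ + 1 := by
      rw [diskEval_of_mem _ hz]
      linarith [(y m : C(cDisk, ℂ)).norm_coe_le_norm ⟨z, hz⟩]
    rw [← h1, ← sub_mul, norm_mul]
    calc _ ≤ ε / (‖(y m : C(cDisk, ℂ))‖ + 1) * (‖(y m : C(cDisk, ℂ))‖ + 1) :=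
          mul_le_mul (hP z hz).le h2 (norm_nonneg _) (by positivity)
      _ = ε := div_mul_cancel₀ _ (by positivity)

/-! ### Uniqueness of Jost solutions -/

theorem eq_zero_of_backward_rec {c : ℤ → ℂ} {z : ℂ} {y : ℤ → ℂ} {m₀ : ℤ}
    (hy : ∀ m, y m - c m * y (m + 1) + z * y (m + 2) = 0) (h0 : ∀ m, m₀ ≤ m → y m = 0) (m : ℤ) :
    y m = 0 := by
  have key : ∀ j : ℕ, ∀ m, m₀ - j ≤ m → y m = 0 := by
    intro j
    induction j with
    | zero => intro m hm; exact h0 m (by simpa using hm)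
    | succ j ih =>
      intro m hm
      push_cast at hm
      have := hy m
      rw [ih (m + 1) (by omega), ih (m + 2) (by omega)] at this
      simpa using this
  exact key (m₀ - m).toNat m (by omega)

/-- The Wronskian of the difference δ with `y` satisfies W_m = z W_{m+1}; as |z| ≤ 1 it is bounded
by its limit, which is zero. Then δ/y is constant far to the right and tends to zero. The circle |z|
= 1 is included. -/
theorem right_jost_unique {c : ℤ → ℂ} {z : ℂ} (hz : ‖z‖ ≤ 1) {y y' : ℤ → ℂ}
    (hy : ∀ m, y m - c m * y (m + 1) + z * y (m + 2) = 0) (hy1 : Tendsto y atTop (𝓝 1))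
    (hy' : ∀ m, y' m - c m * y' (m + 1) + z * y' (m + 2) = 0) (hy1' : Tendsto y' atTop (𝓝 1)) :
    y' = y := by
  set δ : ℤ → ℂ := fun m => y' m - y m with hδ
  have hd : ∀ m, δ m - c m * δ (m + 1) + z * δ (m + 2) = 0 := fun m => by
    simp only [hδ]; linear_combination hy' m - hy m
  have hd0 : Tendsto δ atTop (𝓝 0) := by simpa using hy1'.sub hy1
  have t : ∀ a : ℤ, Tendsto (fun m : ℤ => m + a) atTop atTop := fun a =>
    tendsto_atTop_add_const_right _ _ tendsto_id
  have hW : ∀ m, δ m * y (m + 1) - δ (m + 1) * y m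
      = z * (δ (m + 1) * y (m + 2) - δ (m + 2) * y (m + 1)) := fun m => by
    linear_combination y (m + 1) * hd m - δ (m + 1) * hy m
  have hWle : ∀ (m : ℤ) (j : ℕ), ‖δ m * y (m + 1) - δ (m + 1) * y m‖
      ≤ ‖δ (m + j) * y (m + j + 1) - δ (m + j + 1) * y (m + j)‖ := by
    intro m j
    induction j with
    | zero => simp
    | succ j ih =>
      refine ih.trans ?_
      rw [hW, norm_mul]
      push_cast
      rw [show m + j + 2 = m + (j + 1) + 1 by ring, show m + j + 1 = m + (j + 1 : ℤ) by ring]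
      exact mul_le_of_le_one_left (norm_nonneg _) hz
  have hW0 : ∀ m, δ m * y (m + 1) - δ (m + 1) * y m = 0 := by
    intro m
    have h1 : Tendsto (fun m => ‖δ m * y (m + 1) - δ (m + 1) * y m‖) atTop (𝓝 0) := by
      have := ((hd0.mul (hy1.comp (t 1))).sub ((hd0.comp (t 1)).mul hy1)).norm
      simpa using this
    have h2 := h1.comp (tendsto_atTop_add_const_left atTop m tendsto_natCast_atTop_atTop)
    exact norm_eq_zero.1 (le_antisymm (ge_of_tendsto' h2 (hWle m)) (norm_nonneg _))
  obtain ⟨m₀, hm₀⟩ := eventually_atTop.1 (hy1.eventually_ne one_ne_zero)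
  have hconst : ∀ m, m₀ ≤ m → ∀ j : ℕ, δ (m + j) / y (m + j) = δ m / y m := by
    intro m hm j
    induction j with
    | zero => simp
    | succ j ih =>
      rw [← ih]
      push_cast
      rw [← add_assoc, div_eq_div_iff (hm₀ _ (by omega)) (hm₀ _ (by omega))]
      linear_combination -hW0 (m + j)
  have hzero : ∀ m, m₀ ≤ m → δ m = 0 := by
    intro m hm
    have h1 := (hd0.div hy1 one_ne_zero).comp
      (tendsto_atTop_add_const_left atTop m tendsto_natCast_atTop_atTop)
    have h2 : Tendsto (fun _ : ℕ => δ m / y m) atTop (𝓝 (0 / 1)) := h1.congr (hconst m hm)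
    have h3 := tendsto_nhds_unique tendsto_const_nhds h2
    rw [zero_div, div_eq_zero_iff] at h3
    exact h3.resolve_right (hm₀ m hm)
  ext m
  exact sub_eq_zero.1 (eq_zero_of_backward_rec hd hzero m)

/-! ### Families of Jost solutions and their Wronskian. -/

/-- `Y` is the family of right Jost solutions, in the uniformising parameter. -/
structure RightJost (v : ℤ → ℝ) (Y : ℤ → ℂ → ℂ) : Prop where
  eqn : ∀ m, ∀ z ∈ cDisk, Y m z - (1 + z) * (1 + v (m + 1)) * Y (m + 1) z + z * Y (m + 2) z = 0
  diff : ∀ m, DiffContOnCl ℂ (Y m) oDisk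
  lim : TendstoUniformlyOn Y 1 atTop cDisk
  approx : ∀ᶠ m in atTop, ∀ ε > 0, ∃ P : Polynomial ℂ, ∀ z ∈ cDisk, ‖P.eval z * Y m z - 1‖ ≤ ε

/-- `X` is the family of left Jost solutions, in the uniformising parameter. -/
structure LeftJost (v : ℤ → ℝ) (X : ℤ → ℂ → ℂ) : Prop where
  eqn : ∀ m, ∀ z ∈ cDisk, X (m + 2) z - (1 + z) * (1 + v (m + 1)) * X (m + 1) z + z * X m z = 0
  diff : ∀ m, DiffContOnCl ℂ (X m) oDisk
  lim : TendstoUniformlyOn X 1 atBot cDisk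
  approx : ∀ᶠ m in atBot, ∀ ε > 0, ∃ P : Polynomial ℂ, ∀ z ∈ cDisk, ‖P.eval z * X m z - 1‖ ≤ ε

theorem exists_rightJost {v : ℤ → ℝ} (hv : FirstMoment v) : ∃ Y, RightJost v Y := by
  obtain ⟨Y, h1, h2, h3, h4⟩ := exists_right_jost hv
  exact ⟨Y, fun m z hz => by linear_combination h1 m z hz, h2, h3, h4⟩

theorem exists_leftJost {v : ℤ → ℝ} (hv : FirstMoment v) : ∃ X, LeftJost v X := by
  obtain ⟨Y, hY⟩ := exists_rightJost hv.neg
  refine ⟨fun m => Y (-m), fun m z hz => ?_, fun m => hY.diff _, ?_,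
    tendsto_neg_atBot_atTop.eventually hY.approx⟩
  · have := hY.eqn (-m - 2) z hz
    rw [show -(-m - 2 + 1) = m + 1 by ring, show -m - 2 + 1 = -(m + 1) by ring,
      show -m - 2 + 2 = -m by ring, show -m - 2 = -(m + 2) by ring] at this
    exact this
  · intro s hs
    exact tendsto_neg_atBot_atTop.eventually (hY.lim s hs)

section

variable {v : ℤ → ℝ} {X Y : ℤ → ℂ → ℂ}

theorem RightJost.tendsto (hY : RightJost v Y) {z : ℂ} (hz : z ∈ cDisk) :
    Tendsto (fun m => Y m z) atTop (𝓝 1) := hY.lim.tendsto_at hz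

theorem LeftJost.tendsto (hX : LeftJost v X) {z : ℂ} (hz : z ∈ cDisk) :
    Tendsto (fun m => X m z) atBot (𝓝 1) := hX.lim.tendsto_at hz

theorem RightJost.continuousOn (hY : RightJost v Y) (m : ℤ) : ContinuousOn (Y m) cDisk := by
  have := (hY.diff m).continuousOn
  rwa [closure_oDisk] at this

theorem LeftJost.continuousOn (hX : LeftJost v X) (m : ℤ) : ContinuousOn (X m) cDisk := by
  have := (hX.diff m).continuousOn
  rwa [closure_oDisk] at this

theorem RightJost.unique (hY : RightJost v Y) {z : ℂ} (hz : z ∈ cDisk) {y : ℤ → ℂ}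
    (hy : ∀ m, y m - (1 + z) * (1 + v (m + 1)) * y (m + 1) + z * y (m + 2) = 0)
    (hy1 : Tendsto y atTop (𝓝 1)) (m : ℤ) : y m = Y m z :=
  congrFun (right_jost_unique (c := fun m => (1 + z) * (1 + v (m + 1))) (mem_cDisk.1 hz)
    (fun m => hY.eqn m z hz) (hY.tendsto hz) hy hy1) m

theorem LeftJost.unique (hX : LeftJost v X) {z : ℂ} (hz : z ∈ cDisk) {y : ℤ → ℂ}
    (hy : ∀ m, y (m + 2) - (1 + z) * (1 + v (m + 1)) * y (m + 1) + z * y m = 0)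
    (hy1 : Tendsto y atBot (𝓝 1)) (m : ℤ) : y m = X m z := by
  have refl : ∀ g : ℤ → ℂ,
      (∀ m, g (m + 2) - (1 + z) * (1 + v (m + 1)) * g (m + 1) + z * g m = 0) →
      ∀ m, g (-m) - (1 + z) * (1 + v (-(m + 1))) * g (-(m + 1)) + z * g (-(m + 2)) = 0 := by
    intro g hg m
    have := hg (-(m + 2))
    rwa [show -(m + 2) + 2 = -m by ring, show -(m + 2) + 1 = -(m + 1) by ring] at this
  have := congrFun (right_jost_unique (c := fun m => (1 + z) * (1 + v (-(m + 1))))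
    (mem_cDisk.1 hz) (y := fun m => X (-m) z) (y' := fun m => y (-m))
    (refl (fun m => X m z) fun m => hX.eqn m z hz) ((hX.tendsto hz).comp tendsto_neg_atTop_atBot) (refl y hy)
    (hy1.comp tendsto_neg_atTop_atBot)) (-m)
  simpa using this

/-- The potential is real, so conjugation gives the normalised solution at the conjugate parameter,
and uniqueness applies. -/
theorem LeftJost.conj (hX : LeftJost v X) {z : ℂ} (hz : z ∈ cDisk) (m : ℤ) :
    X m (star z) = star (X m z) := by
  have hz' : star z ∈ cDisk := by rw [mem_cDisk, norm_star]; exact mem_cDisk.1 hz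
  refine (hX.unique hz' (y := fun m => star (X m z)) (fun m => ?_) ?_ m).symm
  · have := congrArg star (hX.eqn m z hz)
    simpa using this
  · have := (continuous_star.tendsto _).comp (hX.tendsto hz)
    simpa [Function.comp_def] using this

/-- The normalised Wronskian of the two Jost solutions. -/
def jostW (X Y : ℤ → ℂ → ℂ) (z : ℂ) : ℂ := X 1 z * Y 0 z - z * X 0 z * Y 1 z

theorem jostW_eq (hX : LeftJost v X) (hY : RightJost v Y) {z : ℂ} (hz : z ∈ cDisk) (m : ℤ) :
    X (m + 1) z * Y m z - z * X m z * Y (m + 1) z = jostW X Y z := by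
  have step : ∀ m, X (m + 1 + 1) z * Y (m + 1) z - z * X (m + 1) z * Y (m + 1 + 1) z
      = X (m + 1) z * Y m z - z * X m z * Y (m + 1) z := fun m => by
    rw [add_assoc, one_add_one_eq_two]
    linear_combination Y (m + 1) z * hX.eqn m z hz - X (m + 1) z * hY.eqn m z hz
  induction m using Int.induction_on with
  | zero => simp [jostW]
  | succ i ih => exact (step i).trans ih
  | pred i ih => rw [← ih, ← step, sub_add_cancel]

theorem diffContOnCl_jostW (hX : LeftJost v X) (hY : RightJost v Y) :
    DiffContOnCl ℂ (jostW X Y) oDisk := by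
  have hid : DiffContOnCl ℂ (fun z : ℂ => z) oDisk := differentiable_id.diffContOnCl
  exact ((hX.diff 1).smul (hY.diff 0)).sub ((hid.smul (hX.diff 0)).smul (hY.diff 1))

end

/-- Continuous functions on the circle which agree off a finite set agree. -/
theorem sphere_eq_of_finite {g h : ℂ → ℂ} (hg : ContinuousOn g (Metric.sphere (0 : ℂ) 1))
    (hh : ContinuousOn h (Metric.sphere (0 : ℂ) 1)) {s : Set ℂ} (hs : s.Finite)
    (heq : ∀ z ∈ Metric.sphere (0 : ℂ) 1, z ∉ s → g z = h z) {z : ℂ}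
    (hz : z ∈ Metric.sphere (0 : ℂ) 1) : g z = h z := by
  have hpre : Preperfect (Metric.sphere (0 : ℂ) 1) := by
    refine IsPreconnected.preperfect_of_nontrivial ⟨1, by simp, -1, by simp, ?_⟩
      (isPreconnected_sphere (by rw [Complex.rank_real_complex]; norm_num) 0 1)
    norm_num
  have hacc : (𝓝[≠] z ⊓ 𝓟 (Metric.sphere (0 : ℂ) 1)).NeBot := hpre z hz
  have hle : 𝓝[≠] z ⊓ 𝓟 (Metric.sphere (0 : ℂ) 1) ≤ 𝓝[Metric.sphere (0 : ℂ) 1] z :=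
    inf_le_inf_right _ nhdsWithin_le_nhds
  refine tendsto_nhds_unique_of_eventuallyEq ((hg z hz).mono_left hle) ((hh z hz).mono_left hle) ?_
  have h1 : ∀ᶠ w in 𝓝[≠] z ⊓ 𝓟 (Metric.sphere (0 : ℂ) 1), w ∈ Metric.sphere (0 : ℂ) 1 :=
    mem_inf_of_right (mem_principal_self _)
  have h2 : ∀ᶠ w in 𝓝[≠] z ⊓ 𝓟 (Metric.sphere (0 : ℂ) 1), w ≠ z :=
    mem_inf_of_left self_mem_nhdsWithin
  have h3 : ∀ᶠ w in 𝓝[≠] z ⊓ 𝓟 (Metric.sphere (0 : ℂ) 1), w ∈ (s \ {z})ᶜ :=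
    mem_inf_of_left (mem_nhdsWithin_of_mem_nhds
      ((hs.subset Set.sdiff_subset).isClosed.isOpen_compl.mem_nhds (by simp)))
  filter_upwards [h1, h2, h3] with w hw1 hw2 hw3
  exact heq w hw1 fun hws => hw3 ⟨hws, hw2⟩

/-! ### The uniformising parameter -/

/-- The uniformising parameter `(p + iz) / (p - iz)`. -/
def cay (p : ℝ) (w : ℂ) : ℂ := (p + Complex.I * w) / (p - Complex.I * w)

section Cayley

variable {p : ℝ}

theorem p_sub_ne_zero (hp : 0 < p) {w : ℂ} (hw : 0 ≤ w.im) : (p : ℂ) - Complex.I * w ≠ 0 := by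
  intro h
  have := congrArg Complex.re h
  simp at this
  linarith

theorem one_sub_cay (hp : 0 < p) {w : ℂ} (hw : 0 ≤ w.im) :
    1 - cay p w = -2 * Complex.I * w / (p - Complex.I * w) := by
  have := p_sub_ne_zero hp hw
  rw [cay]
  field_simp
  ring

theorem one_add_cay (hp : 0 < p) {w : ℂ} (hw : 0 ≤ w.im) :
    1 + cay p w = 2 * p / (p - Complex.I * w) := by
  have := p_sub_ne_zero hp hw
  rw [cay]
  field_simp
  ring

theorem normSq_cay_aux (p : ℝ) (w : ℂ) : ‖(p : ℂ) + Complex.I * w‖ ^ 2 + 4 * p * w.im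
    = ‖(p : ℂ) - Complex.I * w‖ ^ 2 := by
  rw [← Complex.normSq_eq_norm_sq, ← Complex.normSq_eq_norm_sq, Complex.normSq_apply,
    Complex.normSq_apply]
  simp
  ring

theorem cay_mem_cDisk (hp : 0 < p) {w : ℂ} (hw : 0 ≤ w.im) : cay p w ∈ cDisk := by
  have h0 := norm_pos_iff.2 (p_sub_ne_zero hp hw)
  rw [mem_cDisk, cay, norm_div, div_le_one h0]
  refine (sq_le_sq₀ (norm_nonneg _) h0.le).1 ?_
  have := normSq_cay_aux p w
  nlinarith [mul_nonneg hp.le hw]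

theorem cay_mem_oDisk (hp : 0 < p) {w : ℂ} (hw : 0 < w.im) : cay p w ∈ oDisk := by
  have h0 := norm_pos_iff.2 (p_sub_ne_zero hp hw.le)
  rw [mem_oDisk, cay, norm_div, div_lt_one h0]
  refine lt_of_pow_lt_pow_left₀ 2 h0.le ?_
  have := normSq_cay_aux p w
  nlinarith [mul_pos hp hw]

theorem cay_neg_ofReal (w : ℝ) : cay p (-(w : ℂ)) = star (cay p w) := by
  simp only [cay, Complex.star_def, map_div₀, map_add, map_sub, map_mul, Complex.conj_ofReal,
    Complex.conj_I]
  ring_nf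

theorem exists_cay_eq (hp : 0 < p) {z : ℂ} (hz : z ∈ Metric.sphere (0 : ℂ) 1) (h1 : z ≠ 1)
    (h2 : z ≠ -1) : ∃ w : ℝ, w ≠ 0 ∧ cay p w = z := by
  have hn : 1 + z ≠ 0 := fun h => h2 (by linear_combination h)
  have hzz : z * star z = 1 := by
    rw [Complex.star_def, Complex.mul_conj, Complex.normSq_eq_norm_sq]
    simp only [mem_sphere_zero_iff_norm] at hz
    simp [hz]
  have hn' : 1 + star z ≠ 0 := fun h => hn (by
    have := congrArg star h
    simpa using this)
  -- The inverse Cayley transform; it is real because conj z = 1/z on the circle.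
  set w : ℂ := Complex.I * p * (1 - z) / (1 + z) with hw
  have hreal : star w = w := by
    rw [hw]
    simp only [Complex.star_def, map_div₀, map_add, map_sub, map_mul, Complex.conj_ofReal,
      Complex.conj_I, map_one] at hn' hzz ⊢
    rw [div_eq_div_iff hn' hn]
    linear_combination (2 * Complex.I * p) * hzz
  obtain ⟨r, hr⟩ := Complex.conj_eq_iff_real.1 hreal
  have hI := Complex.I_mul_I
  have hp' : (p : ℂ) ≠ 0 := by exact_mod_cast hp.ne'
  refine ⟨r, fun h0 => ?_, ?_⟩
  · rw [h0, hw, Complex.ofReal_zero, div_eq_zero_iff] at hr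
    simp only [mul_eq_zero, Complex.I_ne_zero, hp', false_or, hn, or_false] at hr
    exact h1 (by linear_combination -hr)
  · have e1 : Complex.I * w = -(p * (1 - z) / (1 + z)) := by
      rw [hw]
      field_simp
      rw [Complex.I_sq]
    rw [← hr, cay, e1]
    field_simp
    ring

theorem cay_I_mul (p k : ℝ) : cay p (Complex.I * k) = ((p - k) / (p + k) : ℝ) := by
  have e : Complex.I * (Complex.I * k) = -k := by rw [← mul_assoc, Complex.I_mul_I]; ring
  rw [cay, e]
  push_cast
  ring

/-- Division by p - iw, which has no zero for Im w ≥ 0, leads to the disc equation with v = u/(2p).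
The exceptional point w = ip becomes the ordinary point 0 of the disc. -/
theorem isRightJost_iff (hp : 0 < p) {u : ℤ → ℝ} {w : ℂ} (hw : 0 ≤ w.im) {y : ℤ → ℂ} :
    IsRightJost p u w y ↔ (∀ m, y m - (1 + cay p w) * (1 + (u (m + 1) / (2 * p) : ℝ)) * y (m + 1)
      + cay p w * y (m + 2) = 0) ∧ Tendsto y atTop (𝓝 1) := by
  refine and_congr_left fun _ => forall_congr' fun m => ?_
  have h0 := p_sub_ne_zero hp hw
  have hp' : (p : ℂ) ≠ 0 := by exact_mod_cast hp.ne'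
  rw [one_add_cay hp hw, cay]
  push_cast
  have e : y m - 2 * p / (p - Complex.I * w) * (1 + u (m + 1) / (2 * p)) * y (m + 1) +
      (p + Complex.I * w) / (p - Complex.I * w) * y (m + 2)
      = ((p + Complex.I * w) * y (m + 2) - (2 * p + u (m + 1)) * y (m + 1)
        + (p - Complex.I * w) * y m) / (p - Complex.I * w) := by
    field_simp
    ring
  rw [e, div_eq_zero_iff, or_iff_left h0]

theorem isLeftJost_iff (hp : 0 < p) {u : ℤ → ℝ} {w : ℂ} (hw : 0 ≤ w.im) {y : ℤ → ℂ} :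
    IsLeftJost p u w y ↔ (∀ m, y (m + 2) - (1 + cay p w) * (1 + (u (m + 1) / (2 * p) : ℝ))
      * y (m + 1) + cay p w * y m = 0) ∧ Tendsto y atBot (𝓝 1) := by
  refine and_congr_left fun _ => forall_congr' fun m => ?_
  have h0 := p_sub_ne_zero hp hw
  have hp' : (p : ℂ) ≠ 0 := by exact_mod_cast hp.ne'
  rw [one_add_cay hp hw, cay]
  push_cast
  have e : y (m + 2) - 2 * p / (p - Complex.I * w) * (1 + u (m + 1) / (2 * p)) * y (m + 1) +
      (p + Complex.I * w) / (p - Complex.I * w) * y m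
      = ((p - Complex.I * w) * y (m + 2) - (2 * p + u (m + 1)) * y (m + 1)
        + (p + Complex.I * w) * y m) / (p - Complex.I * w) := by
    field_simp
  rw [e, div_eq_zero_iff, or_iff_left h0]

variable {u : ℤ → ℝ} {X Y : ℤ → ℂ → ℂ}

theorem jostRight_eq (hp : 0 < p) (hY : RightJost (fun m => u m / (2 * p)) Y) {w : ℂ}
    (hw : 0 ≤ w.im) (m : ℤ) : jostRight p u w m = (p + Complex.I * w) ^ m * Y m (cay p w) := by
  have hz := cay_mem_cDisk hp hw
  have h := Classical.epsilon_spec (p := IsRightJost p u w)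
    ⟨fun m => Y m (cay p w), (isRightJost_iff hp hw).2 ⟨fun m => hY.eqn m _ hz, hY.tendsto hz⟩⟩
  rw [isRightJost_iff hp hw] at h
  rw [jostRight, hY.unique hz h.1 h.2]

theorem jostLeft_eq (hp : 0 < p) (hX : LeftJost (fun m => u m / (2 * p)) X) {w : ℂ}
    (hw : 0 ≤ w.im) (m : ℤ) : jostLeft p u w m = (p - Complex.I * w) ^ m * X m (cay p w) := by
  have hz := cay_mem_cDisk hp hw
  have h := Classical.epsilon_spec (p := IsLeftJost p u w)
    ⟨fun m => X m (cay p w), (isLeftJost_iff hp hw).2 ⟨fun m => hX.eqn m _ hz, hX.tendsto hz⟩⟩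
  rw [isLeftJost_iff hp hw] at h
  rw [jostLeft, hX.unique hz h.1 h.2]

theorem coeffA_eq (hp : 0 < p) (hX : LeftJost (fun m => u m / (2 * p)) X)
    (hY : RightJost (fun m => u m / (2 * p)) Y) {w : ℂ} (hw : 0 ≤ w.im) (hw0 : w ≠ 0) :
    coeffA p u w = jostW X Y (cay p w) / (1 - cay p w) := by
  have h0 := p_sub_ne_zero hp hw
  have e : (p : ℂ) + Complex.I * w = cay p w * (p - Complex.I * w) := by
    rw [cay, div_mul_cancel₀ _ h0]
  have hI := Complex.I_ne_zero
  rw [coeffA, wronskian, one_sub_cay hp hw]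
  simp only [jostLeft_eq hp hX hw, jostRight_eq hp hY hw, zero_add, zpow_zero, zpow_one, one_mul,
    div_one, jostW]
  rw [e]
  field_simp
  ring

/-- On the unit circle a reflectionless potential relates the two Jost solutions. -/
theorem reflectionless_circle (hp : 0 < p) (hX : LeftJost (fun m => u m / (2 * p)) X)
    (hY : RightJost (fun m => u m / (2 * p)) Y) (hr : IsReflectionless p u) {z : ℂ}
    (hz : z ∈ Metric.sphere (0 : ℂ) 1) (m : ℤ) :
    (1 - z) * Y m z = jostW X Y z * X m (star z) := by
  have hsub : Metric.sphere (0 : ℂ) 1 ⊆ cDisk := Metric.sphere_subset_closedBall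
  have hstar : Set.MapsTo (star : ℂ → ℂ) (Metric.sphere (0 : ℂ) 1) cDisk := fun w hw => by
    rw [mem_cDisk, norm_star, mem_sphere_zero_iff_norm.1 hw]
  -- The points 1 and -1 correspond to w = 0 and w = ∞, where no scattering relation is given;
  -- continuity supplies them.
  refine sphere_eq_of_finite (g := fun z => (1 - z) * Y m z)
    (h := fun z => jostW X Y z * X m (star z)) (s := {1, -1}) ?_ ?_ (by simp) (fun z hz hzs => ?_) hz
  · exact ((continuousOn_const.sub continuousOn_id).mul ((hY.continuousOn m).mono hsub))
  · have hf := (diffContOnCl_jostW hX hY).continuousOn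
    rw [closure_oDisk] at hf
    exact (hf.mono hsub).mul ((hX.continuousOn m).comp continuous_star.continuousOn hstar)
  · simp only [Set.mem_insert_iff, Set.mem_singleton_iff, not_or] at hzs
    obtain ⟨w, hw0, rfl⟩ := exists_cay_eq hp hz hzs.1 hzs.2
    obtain ⟨a, ha⟩ := hr w hw0
    have h1 : ∀ m, Y m (cay p w) = a * X m (star (cay p w)) := by
      intro m
      have h := ha m
      have hpw : ((p : ℂ) + Complex.I * w) ≠ 0 := by
        have := p_sub_ne_zero hp (w := -(w : ℂ)) (by simp)
        rwa [mul_neg, sub_neg_eq_add] at this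
      rw [jostRight_eq hp hY (by simp), jostLeft_eq hp hX (by simp), cay_neg_ofReal, zero_mul,
        add_zero, mul_neg, sub_neg_eq_add, mul_left_comm] at h
      exact mul_left_cancel₀ (zpow_ne_zero _ hpw) h
    set z := cay p w with hzdef
    have hzD := hsub hz
    have hzD' : star z ∈ cDisk := hstar hz
    -- The coefficient is identified by evaluating the constant Wronskian at m → -∞, where both left
    -- solutions tend to 1.
    have h2 : jostW X Y z = a * (1 - z) := by
      have t1 : Tendsto (fun m : ℤ => m + 1) atBot atBot :=
        tendsto_atBot_add_const_right _ _ tendsto_id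
      have l1 := ((hX.tendsto hzD).comp t1).mul (hX.tendsto hzD')
      have l2 := (((hX.tendsto hzD).const_mul z).mul ((hX.tendsto hzD').comp t1))
      have l3 := (l1.sub l2).const_mul a
      rw [one_mul, mul_one, mul_one] at l3
      refine tendsto_nhds_unique (tendsto_const_nhds.congr fun m => ?_) l3
      rw [← jostW_eq hX hY hzD m, h1, h1]
      simp only [Function.comp_apply]
      ring
    rw [h1 m, h2]
    ring

end Cayley

/-! ### The transmission coefficient on the closed disc -/

theorem norm_one_sub_le {z : ℂ} (hz : z ∈ cDisk) {ε : ℝ} (hε : 0 ≤ ε) :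
    ‖1 - z‖ ≤ ‖1 + (ε : ℂ) - z‖ := by
  refine (sq_le_sq₀ (norm_nonneg _) (norm_nonneg _)).1 ?_
  rw [← Complex.normSq_eq_norm_sq, ← Complex.normSq_eq_norm_sq, Complex.normSq_apply,
    Complex.normSq_apply]
  have h1 : z.re ≤ 1 := (Complex.re_le_norm z).trans (mem_cDisk.1 hz)
  simp
  nlinarith

/-- A maximum principle: a bound by `B ‖1 - z‖` propagates from the circle to the disc. -/
theorem norm_le_mul_norm_one_sub {F : ℂ → ℂ} (hF : DiffContOnCl ℂ F oDisk) {B : ℝ}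
    (hB : ∀ z ∈ Metric.sphere (0 : ℂ) 1, ‖F z‖ ≤ B * ‖1 - z‖) {z : ℂ} (hz : z ∈ cDisk) :
    ‖F z‖ ≤ B * ‖1 - z‖ := by
  have hB0 : 0 ≤ B := by
    have := (norm_nonneg _).trans (hB (-1) (by simp))
    norm_num at this
    linarith
  -- Dividing by 1 + ε - z instead of 1 - z keeps the quotient continuous on the closed disc, so the
  -- maximum principle applies before ε → 0.
  have key : ∀ ε : ℝ, 0 < ε → ‖F z‖ ≤ B * ‖1 - z‖ + B * ε := by
    intro ε hε
    have hne : ∀ w ∈ cDisk, 1 + (ε : ℂ) - w ≠ 0 := by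
      intro w hw h
      have h1 : w.re ≤ 1 := (Complex.re_le_norm w).trans (mem_cDisk.1 hw)
      have := congrArg Complex.re h
      simp at this
      linarith
    have hG : DiffContOnCl ℂ (fun w => (1 + (ε : ℂ) - w)⁻¹ • F w) oDisk := by
      refine DiffContOnCl.smul (DiffContOnCl.inv ?_ fun w hw => ?_) hF
      · exact (Differentiable.sub (differentiable_const _) differentiable_id).diffContOnCl
      · rw [closure_oDisk] at hw
        exact hne w hw
    have h1 := Complex.norm_le_of_forall_mem_frontier_norm_le Metric.isBounded_ball hG (C := B)
      (fun w hw => by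
        rw [frontier_oDisk] at hw
        have hwD : w ∈ cDisk := Metric.sphere_subset_closedBall hw
        rw [norm_smul, norm_inv, inv_mul_le_iff₀ (norm_pos_iff.2 (hne w hwD)), mul_comm]
        exact (hB w hw).trans (mul_le_mul_of_nonneg_left (norm_one_sub_le hwD hε.le) hB0))
      (by rw [closure_oDisk]; exact hz)
    rw [norm_smul, norm_inv, inv_mul_le_iff₀ (norm_pos_iff.2 (hne z hz)), mul_comm] at h1
    refine h1.trans ?_
    rw [← mul_add]
    refine mul_le_mul_of_nonneg_left ?_ hB0
    rw [show 1 + (ε : ℂ) - z = 1 - z + ε by ring]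
    refine (norm_add_le _ _).trans ?_
    rw [Complex.norm_real, Real.norm_eq_abs, abs_of_pos hε]
  refine le_of_forall_pos_le_add fun δ hδ => ?_
  rcases hB0.eq_or_lt with h | h
  · have := key 1 one_pos
    rw [← h] at this ⊢
    linarith
  · have := key (δ / B) (by positivity)
    rwa [mul_div_cancel₀ _ h.ne'] at this

/-- Since conj z = 1/z on the circle, the reversed polynomial turns the antiholomorphic P(conj z)
into a holomorphic function, up to a power of z. -/
theorem reverse_eval_sphere (P : Polynomial ℂ) {z : ℂ} (hz : z ∈ Metric.sphere (0 : ℂ) 1) :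
    P.reverse.eval z = z ^ P.natDegree * P.eval (star z) := by
  have hzz : z * star z = 1 := by
    rw [Complex.star_def, Complex.mul_conj, Complex.normSq_eq_norm_sq]
    simp only [mem_sphere_zero_iff_norm] at hz
    simp [hz]
  let _ : Invertible (star z) := ⟨z, hzz, by rw [mul_comm, hzz]⟩
  have h := Polynomial.eval₂_reverse_mul_pow (RingHom.id ℂ) (star z) P
  have e : ⅟(star z) = z := rfl
  rw [e] at h
  rw [Polynomial.eval, Polynomial.eval, ← h, mul_left_comm, ← mul_pow, hzz, one_pow, mul_one]

/-- Division by `1 - z` of a function which on the circle is `1 - z` times a product of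
boundary values. -/
theorem exists_div_one_sub {f y x : ℂ → ℂ} (hf : DiffContOnCl ℂ f oDisk)
    (hy : DiffContOnCl ℂ y oDisk) (hx : ∀ z ∈ cDisk, 1 / 2 ≤ ‖x z‖)
    (happ : ∀ ε > 0, ∃ P : Polynomial ℂ, ∀ z ∈ cDisk, ‖P.eval z * x z - 1‖ ≤ ε)
    (hc : ∀ z ∈ Metric.sphere (0 : ℂ) 1, (1 - z) * y z = f z * x (star z)) :
    ∃ a : ℂ → ℂ, DiffContOnCl ℂ a oDisk ∧ ∀ z ∈ cDisk, (1 - z) * a z = f z := by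
  have hfc : ContinuousOn f cDisk := by
    have := hf.continuousOn
    rwa [closure_oDisk] at this
  have hyc : ContinuousOn y cDisk := by
    have := hy.continuousOn
    rwa [closure_oDisk] at this
  have hx0 : ∀ z ∈ cDisk, x z ≠ 0 := fun z hz h => by
    have := hx z hz
    rw [h, norm_zero] at this
    norm_num at this
  have h1D : (1 : ℂ) ∈ cDisk := by simp
  have h1S : (1 : ℂ) ∈ Metric.sphere (0 : ℂ) 1 := by simp
  have hstar : ∀ z ∈ Metric.sphere (0 : ℂ) 1, star z ∈ cDisk := fun w hw => by
    rw [mem_cDisk, norm_star, mem_sphere_zero_iff_norm.1 hw]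
  have hf1 : f 1 = 0 := by
    have := hc 1 h1S
    rw [sub_self, zero_mul, star_one, eq_comm, mul_eq_zero] at this
    exact this.resolve_right (hx0 1 h1D)
  obtain ⟨M, hM⟩ := (isCompact_closedBall (0 : ℂ) 1).exists_bound_of_continuousOn hyc
  have hM0 : 0 ≤ M := (norm_nonneg _).trans (hM 1 h1D)
  set B := 2 * M with hB
  have hfS : ∀ z ∈ Metric.sphere (0 : ℂ) 1, ‖f z‖ ≤ B * ‖1 - z‖ := by
    intro z hz
    have h1 := congrArg norm (hc z hz)
    rw [norm_mul, norm_mul] at h1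
    have h2 := hx _ (hstar z hz)
    have h3 := hM z (Metric.sphere_subset_closedBall hz)
    have h4 : ‖f z‖ * (1 / 2) ≤ ‖1 - z‖ * M := by
      calc ‖f z‖ * (1 / 2) ≤ ‖f z‖ * ‖x (star z)‖ := by gcongr
        _ = ‖1 - z‖ * ‖y z‖ := h1.symm
        _ ≤ ‖1 - z‖ * M := by gcongr
    rw [hB]
    linarith
  have hfB : ∀ z ∈ cDisk, ‖f z‖ ≤ B * ‖1 - z‖ := fun z hz => norm_le_mul_norm_one_sub hf hfS hz
  have hdne : ∀ z : ℂ, z ≠ 1 → 1 - z ≠ 0 := fun z hz => sub_ne_zero.2 hz.symm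
  -- The value at 1 is the one that the circle relation y(z) = a(z) x(conj z) forces there.
  set a : ℂ → ℂ := Function.update (fun z => f z / (1 - z)) 1 (y 1 / x 1) with ha
  have ha1 : a 1 = y 1 / x 1 := by simp [ha]
  have hane : ∀ z, z ≠ 1 → a z = f z / (1 - z) := fun z hz => by simp [ha, hz]
  have hdiff : DifferentiableOn ℂ a oDisk := by
    have hne : ∀ z ∈ oDisk, z ≠ 1 := fun z hz h => by
      rw [h, mem_oDisk] at hz
      norm_num at hz
    refine (hf.differentiableOn.div (differentiableOn_const 1 |>.sub differentiableOn_id)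
      fun z hz => hdne z (hne z hz)).congr fun z hz => ?_
    rw [hane z (hne z hz)]
    rfl
  -- On the circle zⁿ f(z) is close to (1 - z) R(z) y(z), where P approximates 1/x and R is P
  -- reversed. The error is at most δB|1 - z|, a bound that propagates into the disc. Thus zⁿ a is
  -- within δB of the continuous R y, and a(z) tends to a(1).
  have hcont1 : ContinuousWithinAt a cDisk 1 := by
    rw [Metric.continuousWithinAt_iff']
    intro ε hε
    obtain ⟨P, hP⟩ := happ (ε / (4 * (B + 1))) (by positivity)
    set δ := ε / (4 * (B + 1)) with hδ
    set n := P.natDegree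
    set R : ℂ → ℂ := fun z => P.reverse.eval z with hR
    have hRd : Differentiable ℂ R := P.reverse.differentiable
    have hF : DiffContOnCl ℂ (fun z => (1 - z) • (R z • y z) - z ^ n • f z) oDisk := by
      refine DiffContOnCl.sub (DiffContOnCl.smul ?_ (hRd.diffContOnCl.smul hy))
        (DiffContOnCl.smul ?_ hf)
      · exact (Differentiable.sub (differentiable_const _) differentiable_id).diffContOnCl
      · exact (differentiable_id.pow n).diffContOnCl
    have hFS : ∀ z ∈ Metric.sphere (0 : ℂ) 1,
        ‖(1 - z) • (R z • y z) - z ^ n • f z‖ ≤ δ * B * ‖1 - z‖ := by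
      intro z hz
      have e : (1 - z) • (R z • y z) - z ^ n • f z
          = z ^ n * (f z * (P.eval (star z) * x (star z) - 1)) := by
        simp only [hR, smul_eq_mul]
        rw [reverse_eval_sphere P hz]
        linear_combination z ^ n * P.eval (star z) * hc z hz
      rw [e, norm_mul, norm_pow, mem_sphere_zero_iff_norm.1 hz, one_pow, one_mul, norm_mul,
        mul_assoc, mul_comm]
      exact mul_le_mul (hP _ (hstar z hz)) (hfS z hz) (norm_nonneg _) (by positivity)
    have hFD := fun z (hz : z ∈ cDisk) => norm_le_mul_norm_one_sub hF hFS hz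
    have hlim : Tendsto (fun z => B * ‖1 - z ^ n‖ + ‖R z * y z - R 1 * y 1‖ + 2 * (δ * B))
        (𝓝[cDisk] 1) (𝓝 (B * ‖1 - (1 : ℂ) ^ n‖ + ‖R 1 * y 1 - R 1 * y 1‖ + 2 * (δ * B))) := by
      have h1 : ContinuousOn (fun z => B * ‖1 - z ^ n‖ + ‖R z * y z - R 1 * y 1‖ + 2 * (δ * B))
          cDisk := by
        have := hRd.continuous.continuousOn (s := cDisk)
        fun_prop
      exact h1 1 h1D
    have hlt : B * ‖1 - (1 : ℂ) ^ n‖ + ‖R 1 * y 1 - R 1 * y 1‖ + 2 * (δ * B) < ε := by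
      simp only [one_pow, sub_self, norm_zero, mul_zero, zero_add]
      rw [hδ, div_mul_eq_mul_div, mul_div_assoc', div_lt_iff₀ (by positivity)]
      nlinarith
    filter_upwards [hlim.eventually_lt_const hlt, self_mem_nhdsWithin] with z hz hzD
    rw [dist_eq_norm]
    rcases eq_or_ne z 1 with rfl | hz1
    · simpa using hε
    refine lt_of_le_of_lt ?_ hz
    have hpos : 0 < ‖1 - z‖ := norm_pos_iff.2 (hdne z hz1)
    have haz : f z = (1 - z) * a z := by rw [hane z hz1, mul_div_cancel₀ _ (hdne z hz1)]
    have b1 : ‖a z‖ ≤ B := by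
      have := hfB z hzD
      rw [haz, norm_mul, mul_comm] at this
      exact le_of_mul_le_mul_right this hpos
    have b2 : ‖R z * y z - z ^ n * a z‖ ≤ δ * B := by
      have := hFD z hzD
      rw [haz, show (1 - z) • (R z • y z) - z ^ n • ((1 - z) * a z)
        = (R z * y z - z ^ n * a z) * (1 - z) by simp only [smul_eq_mul]; ring, norm_mul] at this
      exact le_of_mul_le_mul_right this hpos
    have b3 : ‖R 1 * y 1 - a 1‖ ≤ δ * B := by
      have e1 : R 1 = P.eval 1 := by
        simp only [hR]
        rw [reverse_eval_sphere P h1S]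
        simp
      have hx1 := hx0 1 h1D
      have e2 : R 1 * y 1 - a 1 = (P.eval 1 * x 1 - 1) * (y 1 / x 1) := by
        rw [e1, ha1]
        field_simp
      have e3 : ‖y 1 / x 1‖ ≤ B := by
        rw [norm_div, div_le_iff₀ (norm_pos_iff.2 hx1)]
        have := hx 1 h1D
        have := hM 1 h1D
        nlinarith
      rw [e2, norm_mul]
      exact mul_le_mul (hP 1 h1D) e3 (norm_nonneg _) (by positivity)
    calc ‖a z - a 1‖ = ‖a z * (1 - z ^ n) - (R z * y z - z ^ n * a z)
          + (R z * y z - R 1 * y 1) + (R 1 * y 1 - a 1)‖ := by congr 1; ring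
      _ ≤ ‖a z * (1 - z ^ n)‖ + ‖R z * y z - z ^ n * a z‖ + ‖R z * y z - R 1 * y 1‖
          + ‖R 1 * y 1 - a 1‖ := (norm_add_le _ _).trans (add_le_add_left
            ((norm_add_le _ _).trans (add_le_add_left (norm_sub_le _ _) _)) _)
      _ ≤ B * ‖1 - z ^ n‖ + δ * B + ‖R z * y z - R 1 * y 1‖ + δ * B := by
          rw [norm_mul]
          gcongr
      _ = _ := by ring
  refine ⟨a, ⟨hdiff, ?_⟩, fun z hz => ?_⟩
  · rw [closure_oDisk]
    intro z hz
    rcases eq_or_ne z 1 with rfl | hz1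
    · exact hcont1
    · have h1 : ContinuousWithinAt (fun z => f z / (1 - z)) cDisk z :=
        (hfc z hz).div (continuousWithinAt_const.sub continuousWithinAt_id) (hdne z hz1)
      refine h1.congr_of_eventuallyEq ?_ (hane z hz1)
      filter_upwards [mem_nhdsWithin_of_mem_nhds (isOpen_compl_singleton.mem_nhds hz1)] with w hw
      exact hane w hw
  · rcases eq_or_ne z 1 with rfl | hz1
    · rw [hf1, sub_self, zero_mul]
    · rw [hane z hz1, mul_div_cancel₀ _ (hdne z hz1)]

/-- The data of a reflectionless potential: Jost solutions and transmission coefficient, as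
functions of the uniformising parameter. -/
structure Scattering (v : ℤ → ℝ) (X Y : ℤ → ℂ → ℂ) (a : ℂ → ℂ) : Prop where
  left : LeftJost v X
  right : RightJost v Y
  diff : DiffContOnCl ℂ a oDisk
  eq_jostW : ∀ z ∈ cDisk, (1 - z) * a z = jostW X Y z
  circle : ∀ z ∈ Metric.sphere (0 : ℂ) 1, ∀ m, Y m z = a z * X m (star z)

/-- Division by 1 - z is performed at a single site far to the left, where `X` is close to 1 and has
polynomial approximate inverses. The Wronskian does not depend on the site, so one quotient serves
for all `m`. -/
theorem exists_scattering {v : ℤ → ℝ} {X Y : ℤ → ℂ → ℂ} (hX : LeftJost v X) (hY : RightJost v Y)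
    (hc : ∀ z ∈ Metric.sphere (0 : ℂ) 1, ∀ m, (1 - z) * Y m z = jostW X Y z * X m (star z)) :
    ∃ a, Scattering v X Y a := by
  have hev : ∀ᶠ m in atBot, ∀ z ∈ cDisk, 1 / 2 ≤ ‖X m z‖ := by
    filter_upwards [Metric.tendstoUniformlyOn_iff.1 hX.lim (1 / 2) one_half_pos] with m hm z hz
    have h1 := hm z hz
    rw [dist_eq_norm, Pi.one_apply] at h1
    have h2 := norm_sub_norm_le (1 : ℂ) (X m z)
    rw [norm_one] at h2
    linarith
  obtain ⟨m₀, h1, h2⟩ := (hev.and hX.approx).exists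
  obtain ⟨a, ha, haf⟩ := exists_div_one_sub (diffContOnCl_jostW hX hY) (hY.diff m₀) h1 h2
    fun z hz => hc z hz m₀
  refine ⟨a, hX, hY, ha, haf, fun z hz m => ?_⟩
  have hsub : Metric.sphere (0 : ℂ) 1 ⊆ cDisk := Metric.sphere_subset_closedBall
  have hac := ha.continuousOn
  rw [closure_oDisk] at hac
  refine sphere_eq_of_finite (g := Y m) (h := fun z => a z * X m (star z)) (s := {1})
    ((hY.continuousOn m).mono hsub) ((hac.mono hsub).mul ((hX.continuousOn m).comp
      continuous_star.continuousOn fun w hw => ?_)) (Set.finite_singleton _) (fun z hz h1 => ?_) hz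
  · rw [mem_cDisk, norm_star, mem_sphere_zero_iff_norm.1 hw]
  · have h3 := hc z hz m
    rw [← haf z (hsub hz), mul_assoc] at h3
    exact mul_left_cancel₀ (sub_ne_zero.2 (Ne.symm h1)) h3

/-- A zero on the circle would annihilate `Y m` for every `m`, contradicting the limit 1. -/
theorem Scattering.ne_zero {v : ℤ → ℝ} {X Y : ℤ → ℂ → ℂ} {a : ℂ → ℂ} (h : Scattering v X Y a)
    {z : ℂ} (hz : z ∈ Metric.sphere (0 : ℂ) 1) : a z ≠ 0 := by
  intro h0
  have h1 : Tendsto (fun m => Y m z) atTop (𝓝 0) :=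
    tendsto_const_nhds.congr fun m => by rw [h.circle z hz m, h0, zero_mul]
  exact zero_ne_one (tendsto_nhds_unique h1
    (h.right.tendsto (Metric.sphere_subset_closedBall hz)))

/-- The transmission coefficient has finitely many zeros. -/
theorem Scattering.finite_zeros {v : ℤ → ℝ} {X Y : ℤ → ℂ → ℂ} {a : ℂ → ℂ}
    (h : Scattering v X Y a) : {z ∈ oDisk | a z = 0}.Finite := by
  by_contra hinf
  have hac := h.diff.continuousOn
  rw [closure_oDisk] at hac
  obtain ⟨w, hw, hacc⟩ := Set.Infinite.exists_accPt_of_subset_isCompact hinf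
    (isCompact_closedBall (0 : ℂ) 1) fun z hz => Metric.ball_subset_closedBall hz.1
  have hfr := accPt_iff_frequently.1 hacc
  have hw0 : a w = 0 := by
    by_contra hne
    have h1 : ∀ᶠ z in 𝓝[cDisk] w, a z ≠ 0 := (hac w hw).eventually_ne hne
    rw [eventually_nhdsWithin_iff] at h1
    obtain ⟨z, hz1, hz2⟩ := (hfr.and_eventually h1).exists
    exact hz2 (Metric.ball_subset_closedBall hz1.2.1) hz1.2.2
  have hwo : w ∈ oDisk := by
    rw [mem_oDisk]
    refine lt_of_le_of_ne (mem_cDisk.1 hw) fun h1 => ?_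
    exact h.ne_zero (mem_sphere_zero_iff_norm.2 h1) hw0
  have han : AnalyticOnNhd ℂ a oDisk := h.diff.differentiableOn.analyticOnNhd Metric.isOpen_ball
  have hfr' : ∃ᶠ z in 𝓝[≠] w, a z = 0 := by
    rw [frequently_nhdsWithin_iff]
    exact hfr.mono fun z hz => ⟨hz.2.2, hz.1⟩
  have hz := han.eqOn_zero_of_preconnected_of_frequently_eq_zero
    (convex_ball (0 : ℂ) 1).isPreconnected hwo hfr'
  have h1 : a 1 = 0 := by
    have hcl : Set.EqOn a 0 (closure oDisk) :=
      hz.of_subset_closure (by rw [closure_oDisk]; exact hac) continuousOn_const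
        subset_closure subset_rfl
    exact hcl (by rw [closure_oDisk]; simp)
  exact h.ne_zero (by simp) h1

/-! ### Discrete eigenvalues -/

section Eigenvalues

variable {v : ℤ → ℝ} {X Y : ℤ → ℂ → ℂ} {z : ℂ}

theorem oDisk_subset_cDisk : oDisk ⊆ cDisk := Metric.ball_subset_closedBall

theorem eq_zero_of_rec {c : ℤ → ℂ} (hz : z ≠ 0) {δ : ℤ → ℂ}
    (hδ : ∀ m, δ (m + 2) - c m * δ (m + 1) + z * δ m = 0) {m₀ : ℤ} (h0 : δ m₀ = 0)
    (h1 : δ (m₀ + 1) = 0) (m : ℤ) : δ m = 0 := by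
  have key : ∀ i : ℤ, δ (m₀ + i) = 0 ∧ δ (m₀ + i + 1) = 0 := by
    intro i
    induction i using Int.induction_on with
    | zero => simpa using ⟨h0, h1⟩
    | succ i ih =>
      have h := hδ (m₀ + i)
      rw [ih.1, ih.2] at h
      rw [← add_assoc]
      refine ⟨ih.2, ?_⟩
      rw [add_assoc, one_add_one_eq_two]
      simpa using h
    | pred i ih =>
      have h := hδ (m₀ + -i - 1)
      rw [show m₀ + -(i : ℤ) - 1 + 2 = m₀ + -i + 1 by ring, sub_add_cancel, ih.1, ih.2] at h
      rw [show m₀ + (-(i : ℤ) - 1) = m₀ + -i - 1 by ring, sub_add_cancel]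
      refine ⟨?_, ih.1⟩
      simpa [hz] using h
  simpa using (key (m - m₀)).1

theorem exists_proportional (hX : LeftJost v X) (hY : RightJost v Y) (hzD : z ∈ cDisk)
    (hz : z ≠ 0) (hW : jostW X Y z = 0) : ∃ b : ℂ, ∀ m, z ^ m * Y m z = b * X m z := by
  obtain ⟨m₀, hm₀⟩ := ((hX.tendsto hzD).eventually_ne one_ne_zero).exists
  refine ⟨z ^ m₀ * Y m₀ z / X m₀ z, fun m => sub_eq_zero.1 ?_⟩
  set b := z ^ m₀ * Y m₀ z / X m₀ z with hb
  have hb' : b * X m₀ z = z ^ m₀ * Y m₀ z := by rw [hb, div_mul_cancel₀ _ hm₀]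
  refine eq_zero_of_rec (c := fun m => (1 + z) * (1 + v (m + 1))) hz
    (δ := fun m => z ^ m * Y m z - b * X m z) (fun m => ?_) (m₀ := m₀) ?_ ?_ m
  · have e1 : z ^ (m + 1) = z ^ m * z := zpow_add_one₀ hz m
    have e2 : z ^ (m + 2) = z ^ m * z * z := by
      rw [show m + 2 = m + 1 + 1 by ring, zpow_add_one₀ hz, zpow_add_one₀ hz]
    simp only [e1, e2]
    linear_combination z ^ m * z * hY.eqn m z hzD - b * hX.eqn m z hzD
  · rw [hb', sub_self]
  · have h1 := jostW_eq hX hY hzD m₀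
    rw [hW] at h1
    refine mul_left_cancel₀ hm₀ ?_
    rw [zpow_add_one₀ hz]
    linear_combination -z ^ m₀ * h1 - X (m₀ + 1) z * hb'

/-- At z = 0 the recurrences become first order with nonzero factors 1 + v, so a single zero of `X`
or `Y` would propagate out to the end where the limit is 1. -/
theorem jostW_zero_ne_zero (hX : LeftJost v X) (hY : RightJost v Y) (hd : ∀ m, 0 < 1 + v m) :
    jostW X Y 0 ≠ 0 := by
  have h0 : (0 : ℂ) ∈ cDisk := by simp
  have hd' : ∀ m, (1 : ℂ) + v m ≠ 0 := fun m => by exact_mod_cast (hd m).ne'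
  rw [jostW, zero_mul, zero_mul, sub_zero]
  refine mul_ne_zero (fun h => ?_) fun h => ?_
  · have h1 : ∀ n : ℕ, X (1 - n) 0 = 0 := by
      intro n
      induction n with
      | zero => simpa using h
      | succ n ih =>
        have := hX.eqn (-n - 1) 0 h0
        rw [show -(n : ℤ) - 1 + 2 = 1 - n by ring, ih] at this
        simp only [add_zero, one_mul, zero_mul, zero_sub, neg_eq_zero, mul_eq_zero, hd',
          false_or] at this
        rw [show (1 : ℤ) - (n + 1 : ℕ) = -n - 1 + 1 by push_cast; ring]
        exact this
    have t : Tendsto (fun n : ℕ => (1 : ℤ) - n) atTop atBot :=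
      tendsto_atBot.2 fun b => by
        filter_upwards [eventually_ge_atTop (1 - b).toNat] with n hn
        omega
    have h2 := ((hX.tendsto h0).comp t).congr h1
    exact zero_ne_one (tendsto_nhds_unique tendsto_const_nhds h2)
  · have h1 : ∀ n : ℕ, Y n 0 = 0 := by
      intro n
      induction n with
      | zero => simpa using h
      | succ n ih =>
        have := hY.eqn n 0 h0
        rw [ih] at this
        simpa [hd'] using this
    have h2 := ((hY.tendsto h0).comp tendsto_natCast_atTop_atTop).congr h1
    exact zero_ne_one (tendsto_nhds_unique tendsto_const_nhds h2)

theorem tendsto_zpow_atTop_zero' (hz : ‖z‖ < 1) :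
    Tendsto (fun m : ℤ => z ^ m) atTop (𝓝 0) := by
  have h : Tendsto (fun m : ℤ => z ^ m.toNat) atTop (𝓝 0) :=
    (tendsto_pow_atTop_nhds_zero_of_norm_lt_one hz).comp
      (tendsto_atTop_atTop.2 fun b => ⟨b, fun a ha => by omega⟩)
  refine h.congr' ?_
  filter_upwards [eventually_ge_atTop 0] with m hm
  rw [← zpow_natCast, Int.toNat_of_nonneg hm]

theorem tendsto_zpow_neg_atBot_zero (hz : ‖z‖ < 1) :
    Tendsto (fun m : ℤ => z ^ (-m)) atBot (𝓝 0) :=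
  (tendsto_zpow_atTop_zero' hz).comp tendsto_neg_atBot_atTop

theorem eq_zero_of_antitone_of_tendsto {J : ℤ → ℝ} (hJ : Antitone J)
    (h1 : Tendsto J atTop (𝓝 0)) (h2 : Tendsto J atBot (𝓝 0)) (m : ℤ) : J m = 0 :=
  le_antisymm (hJ.ge_of_tendsto h2 m) (hJ.le_of_tendsto h1 m)

/-- Zeros of the Wronskian in the open disc are squares of real numbers. -/
theorem zero_real (hX : LeftJost v X) (hY : RightJost v Y) (hd : ∀ m, 0 < 1 + v m)
    (hzD : z ∈ oDisk) (hW : jostW X Y z = 0) : ∃ r : ℝ, 0 < r ∧ r < 1 ∧ z = r := by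
  have hz : z ≠ 0 := by
    rintro rfl
    exact jostW_zero_ne_zero hX hY hd hW
  have hzC := oDisk_subset_cDisk hzD
  rw [mem_oDisk] at hzD
  obtain ⟨b, hb⟩ := exists_proportional hX hY hzC hz hW
  obtain ⟨s, hs⟩ := IsAlgClosed.exists_pow_nat_eq z two_pos
  have hs0 : s ≠ 0 := by
    rintro rfl
    exact hz (by rw [← hs]; simp)
  have hs1 : ‖s‖ < 1 := by
    rw [← hs, norm_pow] at hzD
    exact (pow_lt_one_iff_of_nonneg (norm_nonneg _) two_ne_zero).1 hzD
  -- With s² = z the recurrence becomes symmetric, and `g` decays at both ends because |s| < 1.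
  set g : ℤ → ℂ := fun m => s ^ m * Y m z with hg
  have hgX : ∀ m, g m = s ^ (-m) * (b * X m z) := by
    intro m
    have e : z ^ m = s ^ (2 * m) := by rw [zpow_mul, zpow_ofNat, hs]
    rw [← hb, e, ← mul_assoc, ← zpow_add₀ hs0]
    simp only [hg]
    congr 2
    ring
  have hgtop : Tendsto g atTop (𝓝 0) := by
    simpa using (tendsto_zpow_atTop_zero' hs1).mul (hY.tendsto hzC)
  have hgbot : Tendsto g atBot (𝓝 0) := by
    have := (tendsto_zpow_neg_atBot_zero hs1).mul ((hX.tendsto hzC).const_mul b)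
    rw [zero_mul] at this
    exact this.congr fun m => (hgX m).symm
  have hrec : ∀ m, g m + g (m + 2) = (s + s⁻¹) * (1 + v (m + 1)) * g (m + 1) := by
    intro m
    have e1 : s ^ (m + 1) = s ^ m * s := zpow_add_one₀ hs0 m
    have e2 : s ^ (m + 2) = s ^ m * s * s := by
      rw [show m + 2 = m + 1 + 1 by ring, zpow_add_one₀ hs0, zpow_add_one₀ hs0]
    have e3 : (s + s⁻¹) * s = 1 + z := by rw [add_mul, inv_mul_cancel₀ hs0, ← hs]; ring
    simp only [hg, e1, e2]
    linear_combination s ^ m * hY.eqn m z hzC + s ^ m * Y (m + 2) z * hs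
      - s ^ m * (1 + v (m + 1)) * Y (m + 1) z * e3
  set e : ℂ := s + s⁻¹ with he
  set J : ℤ → ℝ := fun m => (g m * star (g (m + 1))).im with hJ
  have hJd : ∀ m, J m - J (m + 1) = e.im * ((1 + v (m + 1)) * ‖g (m + 1)‖ ^ 2) := by
    intro m
    have h1 := congrArg (fun w => (w * star (g (m + 1))).im) (hrec m)
    simp only [hJ, Complex.star_def, ← Complex.normSq_eq_norm_sq, Complex.normSq_apply,
      show m + 1 + 1 = m + 2 by ring, Complex.mul_im, Complex.mul_re, Complex.add_im,
      Complex.add_re, Complex.conj_re, Complex.conj_im, Complex.one_re, Complex.one_im,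
      Complex.ofReal_re, Complex.ofReal_im] at h1 ⊢
    linear_combination h1
  have t : ∀ l : Filter ℤ, l = atTop ∨ l = atBot → Tendsto g l (𝓝 0) → Tendsto J l (𝓝 0) := by
    intro l hl h
    have t1 : Tendsto (fun m : ℤ => m + 1) l l := by
      rcases hl with rfl | rfl
      · exact tendsto_atTop_add_const_right _ _ tendsto_id
      · exact tendsto_atBot_add_const_right _ _ tendsto_id
    have h1 := h.mul ((continuous_star.tendsto _).comp (h.comp t1))
    rw [zero_mul] at h1
    have h2 := (Complex.continuous_im.tendsto _).comp h1
    rw [Complex.zero_im] at h2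
    exact h2
  -- Self-adjointness: Im(e) J is monotone and vanishes at both ends, so it is zero and Im(s + 1/s)
  -- = 0; as |s| < 1 this makes `s` real.
  have hanti : Antitone fun m => e.im * J m := antitone_int_of_succ_le fun m => by
    have h1 := hJd m
    have h2 : 0 ≤ e.im * (J m - J (m + 1)) := by
      rw [h1, ← mul_assoc]
      have := (hd (m + 1)).le
      exact mul_nonneg (mul_self_nonneg _) (by positivity)
    linarith
  have hJ0 := eq_zero_of_antitone_of_tendsto hanti
    (by simpa using (t _ (Or.inl rfl) hgtop).const_mul e.im)
    (by simpa using (t _ (Or.inr rfl) hgbot).const_mul e.im)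
  have heim : e.im = 0 := by
    obtain ⟨m, hm⟩ := ((hY.tendsto hzC).eventually_ne one_ne_zero).exists
    have hgm : g m ≠ 0 := mul_ne_zero (zpow_ne_zero _ hs0) hm
    have h1 := hJd (m - 1)
    rw [sub_add_cancel] at h1
    have h2 : e.im * (e.im * ((1 + v m) * ‖g m‖ ^ 2)) = 0 := by
      rw [← h1, mul_sub, hJ0, hJ0, sub_self]
    have h3 : (1 + v m) * ‖g m‖ ^ 2 ≠ 0 :=
      mul_ne_zero (hd m).ne' (pow_ne_zero _ (norm_ne_zero_iff.2 hgm))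
    simpa [h3] using h2
  have hsim : s.im = 0 := by
    rw [he, Complex.add_im, Complex.inv_im] at heim
    have hn : 0 < Complex.normSq s := Complex.normSq_pos.2 hs0
    have hn1 : Complex.normSq s < 1 := by
      rw [Complex.normSq_eq_norm_sq]
      exact pow_lt_one₀ (norm_nonneg _) hs1 two_ne_zero
    field_simp at heim
    have : s.im * (Complex.normSq s - 1) = 0 := by linear_combination heim
    exact (mul_eq_zero.1 this).resolve_right (by linarith)
  have hsr : s = (s.re : ℂ) := Complex.ext rfl (by simp [hsim])
  have hre : s.re ≠ 0 := fun h => hs0 (by rw [hsr, h, Complex.ofReal_zero])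
  refine ⟨s.re ^ 2, by positivity, ?_, ?_⟩
  · rw [← hs, norm_pow, hsr, Complex.norm_real, Real.norm_eq_abs, sq_abs] at hzD
    exact hzD
  · rw [← hs, hsr]
    push_cast
    simp

theorem RightJost.differentiableAt (hY : RightJost v Y) (hz : z ∈ oDisk) (m : ℤ) :
    DifferentiableAt ℂ (Y m) z := (hY.diff m).differentiableAt Metric.isOpen_ball hz

theorem LeftJost.differentiableAt (hX : LeftJost v X) (hz : z ∈ oDisk) (m : ℤ) :
    DifferentiableAt ℂ (X m) z := (hX.diff m).differentiableAt Metric.isOpen_ball hz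

theorem RightJost.tendsto_deriv (hY : RightJost v Y) (hz : z ∈ oDisk) :
    Tendsto (fun m => deriv (Y m) z) atTop (𝓝 0) := by
  have := ((hY.lim.mono oDisk_subset_cDisk).tendstoLocallyUniformlyOn.deriv
    (Eventually.of_forall fun m => (hY.diff m).differentiableOn) Metric.isOpen_ball).tendsto_at hz
  have e : deriv (1 : ℂ → ℂ) z = 0 := deriv_const z (1 : ℂ)
  rwa [e] at this

theorem LeftJost.tendsto_deriv (hX : LeftJost v X) (hz : z ∈ oDisk) :
    Tendsto (fun m => deriv (X m) z) atBot (𝓝 0) := by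
  have := ((hX.lim.mono oDisk_subset_cDisk).tendstoLocallyUniformlyOn.deriv
    (Eventually.of_forall fun m => (hX.diff m).differentiableOn) Metric.isOpen_ball).tendsto_at hz
  have e : deriv (1 : ℂ → ℂ) z = 0 := deriv_const z (1 : ℂ)
  rwa [e] at this

theorem RightJost.deriv_eqn (hY : RightJost v Y) (hz : z ∈ oDisk) (m : ℤ) :
    deriv (Y m) z - (1 + z) * (1 + v (m + 1)) * deriv (Y (m + 1)) z + z * deriv (Y (m + 2)) z
      = (1 + v (m + 1)) * Y (m + 1) z - Y (m + 2) z := by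
  have h0 := (hY.differentiableAt hz m).hasDerivAt
  have h1 := (hY.differentiableAt hz (m + 1)).hasDerivAt
  have h2 := (hY.differentiableAt hz (m + 2)).hasDerivAt
  have h3 := (h0.sub ((((hasDerivAt_id z).const_add 1).mul_const (1 + v (m + 1) : ℂ)).mul h1)).add
    ((hasDerivAt_id z).mul h2)
  have h4 : HasDerivAt (fun _ => (0 : ℂ)) 0 z := hasDerivAt_const _ _
  have h5 := h3.unique (h4.congr_of_eventuallyEq (by
    filter_upwards [Metric.isOpen_ball.mem_nhds hz] with w hw
    exact hY.eqn m w (oDisk_subset_cDisk hw)))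
  simp only [id] at h5
  linear_combination h5

theorem deriv_jostW (hX : LeftJost v X) (hY : RightJost v Y) (hz : z ∈ oDisk) (m : ℤ) :
    deriv (jostW X Y) z = (X (m + 1) z * deriv (Y m) z - z * X m z * deriv (Y (m + 1)) z)
      + (deriv (X (m + 1)) z * Y m z - z * deriv (X m) z * Y (m + 1) z) - X m z * Y (m + 1) z := by
  have h0 := (hY.differentiableAt hz m).hasDerivAt
  have h1 := (hY.differentiableAt hz (m + 1)).hasDerivAt
  have g0 := (hX.differentiableAt hz m).hasDerivAt
  have g1 := (hX.differentiableAt hz (m + 1)).hasDerivAt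
  have h3 := (g1.mul h0).sub (((hasDerivAt_id z).mul g0).mul h1)
  have h4 := h3.congr_of_eventuallyEq (f₁ := jostW X Y) (by
    filter_upwards [Metric.isOpen_ball.mem_nhds hz] with w hw
    exact (jostW_eq hX hY (oDisk_subset_cDisk hw) m).symm)
  rw [h4.deriv]
  simp only [id, Pi.mul_apply]
  ring

/-- Simplicity of the zeros of the Wronskian, and the sign of its derivative. -/
theorem deriv_jostW_sign (hX : LeftJost v X) (hY : RightJost v Y) (hd : ∀ m, 0 < 1 + v m) {r : ℝ}
    (hr0 : 0 < r) (hr1 : r < 1) (hW : jostW X Y r = 0) {b : ℂ}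
    (hb : ∀ m, (r : ℂ) ^ m * Y m r = b * X m r) :
    ∃ τ : ℝ, 0 < τ ∧ deriv (jostW X Y) r = -(b * τ) := by
  have hzD : (r : ℂ) ∈ oDisk := by
    rw [mem_oDisk, Complex.norm_real, Real.norm_eq_abs, abs_of_pos hr0]; exact hr1
  have hzn : ‖(r : ℂ)‖ < 1 := mem_oDisk.1 hzD
  have hzC := oDisk_subset_cDisk hzD
  have hz0 : (r : ℂ) ≠ 0 := by exact_mod_cast hr0.ne'
  have hXr : ∀ m, X m r = ((X m r).re : ℂ) := by
    intro m
    have := hX.conj hzC m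
    rw [Complex.star_def, Complex.conj_ofReal] at this
    exact (Complex.conj_eq_iff_re.1 this.symm).symm
  have hXtop : ∀ m, b * X m r = (r : ℂ) ^ m * Y m r := fun m => (hb m).symm
  have hb0 : b ≠ 0 := by
    rintro rfl
    obtain ⟨m, hm⟩ := ((hY.tendsto hzC).eventually_ne one_ne_zero).exists
    have := hb m
    rw [zero_mul] at this
    exact mul_ne_zero (zpow_ne_zero _ hz0) hm this
  have hYX : ∀ m, Y m r = b * ((r : ℂ) ^ (-m) * X m r) := by
    intro m
    rw [zpow_neg, mul_left_comm, ← hb, inv_mul_cancel_left₀ (zpow_ne_zero _ hz0)]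
  have hWm : ∀ m, X (m + 1) r * Y m r = r * X m r * Y (m + 1) r := fun m => by
    have := jostW_eq hX hY hzC m
    rw [hW] at this
    linear_combination this
  -- The subtracted X_m Y_{m+1} makes the increments of α/b equal to the nonnegative t. At +∞ `X`
  -- decays and α tends to 0; at -∞ `Y` decays and α tends to twice the derivative of the Wronskian,
  -- so that derivative divided by `b` is negative.
  set α : ℤ → ℂ := fun m => 2 * (X (m + 1) r * deriv (Y m) r - r * X m r * deriv (Y (m + 1)) r)
    - X m r * Y (m + 1) r with hα
  set x : ℤ → ℝ := fun m => (X m r).re with hx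
  set t : ℤ → ℝ := fun m => (1 / r - 1) * (1 + v m) * (r ^ (-m) * x m ^ 2) with ht
  have hstep : ∀ m, α (m + 1) - α m = b * t (m + 1) := by
    intro m
    have e1 : α (m + 1) - α m = (1 / r - 1) * (1 + v (m + 1)) * (X (m + 1) r * Y (m + 1) r) := by
      simp only [hα, show m + 1 + 1 = m + 2 by ring]
      have h1 := hX.eqn m r hzC
      have h2 := hY.eqn m r hzC
      have h3 := hY.deriv_eqn hzD m
      have h4 := hWm m
      field_simp
      linear_combination (-2 * r * X (m + 1) r) * h3 + (2 * r * deriv (Y (m + 1)) r) * h1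
        + X (m + 1) r * h2 - h4
    rw [e1, hYX (m + 1), hXr (m + 1)]
    simp only [ht, hx]
    push_cast
    ring
  have ht0 : ∀ m, 0 ≤ t m := by
    intro m
    have h1 : 0 ≤ 1 / r - 1 := by
      rw [sub_nonneg, le_div_iff₀ hr0]; linarith
    have h2 := (hd m).le
    simp only [ht]
    positivity
  have t1 : Tendsto (fun m : ℤ => m + 1) atTop atTop :=
    tendsto_atTop_add_const_right _ _ tendsto_id
  have t2 : Tendsto (fun m : ℤ => m + 1) atBot atBot :=
    tendsto_atBot_add_const_right _ _ tendsto_id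
  have hXlim : Tendsto (fun m => X m r) atTop (𝓝 0) := by
    have := ((tendsto_zpow_atTop_zero' hzn).mul (hY.tendsto hzC)).const_mul b⁻¹
    simp only [zero_mul, mul_zero] at this
    refine this.congr fun m => ?_
    rw [hb, inv_mul_cancel_left₀ hb0]
  have hYlim : Tendsto (fun m => Y m r) atBot (𝓝 0) := by
    have := ((tendsto_zpow_neg_atBot_zero hzn).mul (hX.tendsto hzC)).const_mul b
    simp only [zero_mul, mul_zero] at this
    exact this.congr fun m => (hYX m).symm
  have hαtop : Tendsto α atTop (𝓝 0) := by
    have h1 := ((((hXlim.comp t1).mul (hY.tendsto_deriv hzD)).sub ((hXlim.const_mul (r : ℂ)).mul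
      ((hY.tendsto_deriv hzD).comp t1))).const_mul 2).sub (hXlim.mul ((hY.tendsto hzC).comp t1))
    simpa [Function.comp_def] using h1
  set c := 2 * deriv (jostW X Y) r with hc
  have hαbot : Tendsto α atBot (𝓝 c) := by
    have h1 := (((((hX.tendsto_deriv hzD).comp t2).mul hYlim).sub
      (((hX.tendsto_deriv hzD).const_mul (r : ℂ)).mul
      (hYlim.comp t2))).const_mul 2).sub ((hX.tendsto hzC).mul (hYlim.comp t2))
    have h2 := h1.const_sub c
    simp only [mul_zero, sub_zero, Function.comp_apply] at h2
    refine h2.congr fun m => ?_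
    rw [hc, deriv_jostW hX hY hzD m]
    simp only [hα]
    ring
  have hstep' : ∀ m, α (m + 1) / b = α m / b + (t (m + 1) : ℂ) := by
    intro m
    rw [← sub_eq_iff_eq_add', ← sub_div, hstep, mul_div_cancel_left₀ _ hb0]
  have him : ∀ m, (α (m + 1) / b).im = (α m / b).im := fun m => by rw [hstep']; simp
  have hre : ∀ m, (α (m + 1) / b).re = (α m / b).re + t (m + 1) := fun m => by rw [hstep']; simp
  have himtop : Tendsto (fun m => (α m / b).im) atTop (𝓝 0) := by
    simpa [Function.comp_def] using (Complex.continuous_im.tendsto _).comp (hαtop.div_const b)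
  have hretop : Tendsto (fun m => (α m / b).re) atTop (𝓝 0) := by
    simpa [Function.comp_def] using (Complex.continuous_re.tendsto _).comp (hαtop.div_const b)
  have himbot : Tendsto (fun m => (α m / b).im) atBot (𝓝 (c / b).im) :=
    (Complex.continuous_im.tendsto _).comp (hαbot.div_const b)
  have hrebot : Tendsto (fun m => (α m / b).re) atBot (𝓝 (c / b).re) :=
    (Complex.continuous_re.tendsto _).comp (hαbot.div_const b)
  have hcim : (c / b).im = 0 := by
    have hm : Monotone fun m => (α m / b).im := monotone_int_of_le_succ fun m => (him m).ge
    have ha : Antitone fun m => (α m / b).im := antitone_int_of_succ_le fun m => (him m).le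
    refine le_antisymm ?_ ?_
    · exact (hm.le_of_tendsto himbot 0).trans (hm.ge_of_tendsto himtop 0)
    · exact (ha.le_of_tendsto himtop 0).trans (ha.ge_of_tendsto himbot 0)
  have hcre : (c / b).re < 0 := by
    have hm : Monotone fun m => (α m / b).re := monotone_int_of_le_succ fun m => by
      rw [hre]; linarith [ht0 (m + 1)]
    obtain ⟨m, hm0⟩ := ((hX.tendsto hzC).eventually_ne one_ne_zero).exists
    have hxm : x m ≠ 0 := fun h => hm0 (by
      rw [hXr m]
      simp only [hx] at h
      rw [h, Complex.ofReal_zero])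
    have htm : 0 < t m := by
      have h1 : 0 < 1 / r - 1 := by
        rw [sub_pos, lt_div_iff₀ hr0]; linarith
      have h2 := hd m
      simp only [ht]
      positivity
    have h1 := hm.le_of_tendsto hrebot (m - 1)
    have h2 := hm.ge_of_tendsto hretop m
    have h3 := hre (m - 1)
    rw [sub_add_cancel] at h3
    linarith
  refine ⟨-(c / b).re / 2, by linarith, ?_⟩
  have h1 : c / b = ((c / b).re : ℂ) := Complex.ext rfl (by simpa using hcim)
  have h2 : c = b * ((c / b).re : ℂ) := by rw [← h1, mul_div_cancel₀ _ hb0]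
  push_cast
  rw [hc] at h2
  linear_combination h2 / 2

end Eigenvalues

/-! ### Boundary value problems on the disc -/

theorem norm_le_one_of_sphere {F : ℂ → ℂ} (hF : DiffContOnCl ℂ F oDisk)
    (h : ∀ z ∈ Metric.sphere (0 : ℂ) 1, ‖F z‖ ≤ 1) {z : ℂ} (hz : z ∈ cDisk) : ‖F z‖ ≤ 1 :=
  Complex.norm_le_of_forall_mem_frontier_norm_le Metric.isBounded_ball hF
    (by rw [frontier_oDisk]; exact h) (by rw [closure_oDisk]; exact hz)

/-- A function in the disc algebra with real boundary values is constant. -/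
theorem exists_const_of_real_boundary {F : ℂ → ℂ} (hF : DiffContOnCl ℂ F oDisk)
    (h : ∀ z ∈ Metric.sphere (0 : ℂ) 1, (F z).im = 0) : ∃ c, ∀ z ∈ cDisk, F z = c := by
  -- On the circle |exp(±iF)| = 1, so the maximum principle applied to both signs gives Im F = 0
  -- throughout the disc.
  have hexp : ∀ w : ℂ, DiffContOnCl ℂ (fun z => Complex.exp (w • F z)) oDisk := fun w =>
    Complex.differentiable_exp.comp_diffContOnCl (hF.const_smul w)
  have hI : ∀ z ∈ cDisk, (F z).im = 0 := by
    intro z hz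
    have h1 := norm_le_one_of_sphere (hexp Complex.I) (fun w hw => by
      rw [Complex.norm_exp]; simp [h w hw]) hz
    have h2 := norm_le_one_of_sphere (hexp (-Complex.I)) (fun w hw => by
      rw [Complex.norm_exp]; simp [h w hw]) hz
    rw [Complex.norm_exp, Real.exp_le_one_iff] at h1 h2
    simp at h1 h2
    linarith
  obtain ⟨c, hc⟩ := AnalyticOnNhd.eq_const_of_im_eq_const (c₀ := 0)
    (hF.differentiableOn.analyticOnNhd Metric.isOpen_ball)
    (fun z hz => hI z (Metric.ball_subset_closedBall hz)) Metric.isOpen_ball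
    ((convex_ball (0 : ℂ) 1).isConnected ⟨0, by simp⟩)
  refine ⟨c, fun z hz => ?_⟩
  have : Set.EqOn F (fun _ => c) (closure oDisk) :=
    Set.EqOn.of_subset_closure (s := oDisk) hc hF.continuousOn continuousOn_const
      subset_closure subset_rfl
  exact this (by rw [closure_oDisk]; exact hz)

theorem diffContOnCl_dslope {f : ℂ → ℂ} (hf : DiffContOnCl ℂ f oDisk) {z : ℂ} (hz : z ∈ oDisk) :
    DiffContOnCl ℂ (dslope f z) oDisk := by
  have hn := Metric.isOpen_ball.mem_nhds hz
  refine ⟨(Complex.differentiableOn_dslope hn).2 hf.differentiableOn, ?_⟩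
  exact (continuousOn_dslope (mem_of_superset hn subset_closure)).2
    ⟨hf.continuousOn, hf.differentiableAt Metric.isOpen_ball hz⟩

/-- Each zero is divided out by a difference quotient, which remains continuous up to the circle. -/
theorem exists_factor {f : ℂ → ℂ} (hf : DiffContOnCl ℂ f oDisk) (Z : Finset ℂ)
    (hZ : ∀ z ∈ Z, z ∈ oDisk ∧ f z = 0) :
    ∃ g : ℂ → ℂ, DiffContOnCl ℂ g oDisk ∧ ∀ w, f w = (∏ z ∈ Z, (w - z)) * g w := by
  classical
  induction Z using Finset.induction_on with
  | empty => exact ⟨f, hf, fun w => by simp⟩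
  | insert z Z hzZ ih =>
    obtain ⟨g, hg, hfg⟩ := ih fun w hw => hZ w (Finset.mem_insert_of_mem hw)
    obtain ⟨hzD, hz0⟩ := hZ z (Finset.mem_insert_self z Z)
    have hgz : g z = 0 := by
      rw [hfg] at hz0
      refine (mul_eq_zero.1 hz0).resolve_left (Finset.prod_ne_zero_iff.2 fun w hw => ?_)
      exact sub_ne_zero.2 fun h => hzZ (h ▸ hw)
    refine ⟨dslope g z, diffContOnCl_dslope hg hzD, fun w => ?_⟩
    have h1 := sub_smul_dslope g z w
    rw [hgz, sub_zero, smul_eq_mul] at h1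
    rw [hfg, Finset.prod_insert hzZ, ← h1]
    ring

/-- Division by a function with finitely many simple zeros. -/
theorem exists_quotient {a f : ℂ → ℂ} (ha : DiffContOnCl ℂ a oDisk) (hf : DiffContOnCl ℂ f oDisk)
    (Z : Finset ℂ) (hZ : ∀ z ∈ Z, z ∈ oDisk ∧ a z = 0 ∧ deriv a z ≠ 0 ∧ f z = 0)
    (ha0 : ∀ z ∈ cDisk, a z = 0 → z ∈ Z) :
    ∃ h : ℂ → ℂ, DiffContOnCl ℂ h oDisk ∧ ∀ z ∈ cDisk, f z = a z * h z := by
  obtain ⟨g, hg, hag⟩ := exists_factor ha Z fun z hz => ⟨(hZ z hz).1, (hZ z hz).2.1⟩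
  obtain ⟨e, he, hfe⟩ := exists_factor hf Z fun z hz => ⟨(hZ z hz).1, (hZ z hz).2.2.2⟩
  have hg0 : ∀ z ∈ cDisk, g z ≠ 0 := by
    intro z hz h0
    have hzZ := ha0 z hz (by rw [hag, h0, mul_zero])
    obtain ⟨hzD, -, hd, -⟩ := hZ z hzZ
    apply hd
    have h1 : HasDerivAt (fun w => ∏ z ∈ Z, (w - z)) (deriv (fun w => ∏ z ∈ Z, (w - z)) z) z :=
      DifferentiableAt.hasDerivAt (by fun_prop)
    have h2 := h1.mul (hg.differentiableAt Metric.isOpen_ball hzD).hasDerivAt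
    have h3 : a = (fun w => ∏ z ∈ Z, (w - z)) * g := funext hag
    rw [h3, h2.deriv, h0, Finset.prod_eq_zero hzZ (sub_self z)]
    simp
  refine ⟨fun z => (g z)⁻¹ • e z, (hg.inv fun z hz => hg0 z (by rwa [closure_oDisk] at hz)).smul he,
    fun z hz => ?_⟩
  rw [hfe, hag]
  simp only [smul_eq_mul]
  rw [mul_assoc, mul_inv_cancel_left₀ (hg0 z hz)]

theorem diffContOnCl_sum {ι : Type*} (s : Finset ι) {f : ι → ℂ → ℂ}
    (hf : ∀ i ∈ s, DiffContOnCl ℂ (f i) oDisk) :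
    DiffContOnCl ℂ (fun z => ∑ i ∈ s, f i z) oDisk :=
  ⟨DifferentiableOn.fun_sum fun i hi => (hf i hi).differentiableOn,
    continuousOn_finsetSum _ fun i hi => (hf i hi).continuousOn⟩

section

variable {v : ℤ → ℝ} {X Y : ℤ → ℂ → ℂ} {a : ℂ → ℂ}

/-- At z = -1 the middle term drops out and X has period two in `m`. This value fixes the free
constant in the rational formula for `X`. -/
theorem LeftJost.eval_neg_one (hX : LeftJost v X) (m : ℤ) : X m (-1) = 1 := by
  have h1 : (-1 : ℂ) ∈ cDisk := by simp
  have h2 : ∀ m, X (m + 2) (-1) = X m (-1) := fun m => by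
    have := hX.eqn m _ h1
    linear_combination this
  have h3 : ∀ n : ℕ, X (m - 2 * n) (-1) = X m (-1) := by
    intro n
    induction n with
    | zero => simp
    | succ n ih =>
      rw [← ih, ← h2 (m - 2 * (n + 1 : ℕ))]
      push_cast
      congr 1
      ring
  have t : Tendsto (fun n : ℕ => m - 2 * (n : ℤ)) atTop atBot :=
    tendsto_atBot.2 fun b => by
      filter_upwards [eventually_ge_atTop (m - b).toNat] with n hn
      omega
  exact tendsto_nhds_unique (tendsto_const_nhds.congr fun n => (h3 n).symm)
    ((hX.tendsto h1).comp t)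

theorem one_sub_mul_ne_zero {l : ℝ} (h0 : 0 < l) (h1 : l < 1) {z : ℂ} (hz : z ∈ cDisk) :
    1 - (l : ℂ) * z ≠ 0 := by
  intro h
  have h2 : ‖(l : ℂ) * z‖ = 1 := by rw [← sub_eq_zero.1 h, norm_one]
  rw [norm_mul, Complex.norm_real, Real.norm_eq_abs, abs_of_pos h0] at h2
  have := mem_cDisk.1 hz
  nlinarith [norm_nonneg z]

/-- The left Jost solution of a reflectionless potential is a rational function. -/
theorem Scattering.left_formula (S : Scattering v X Y a) {N : ℕ} {l : Fin N → ℝ}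
    (hl0 : ∀ j, 0 < l j) (hl1 : ∀ j, l j < 1)
    (hz : ∀ z ∈ oDisk, a z = 0 ↔ ∃ j, z = l j) (hder : ∀ j, deriv a (l j) ≠ 0) (m : ℤ)
    {R : Fin N → ℝ} (hR : ∀ j, Y m (l j) = deriv a (l j) * R j)
    (hinj : Function.Injective l) {z : ℂ} (hzD : z ∈ cDisk) :
    X m z = 1 + (1 + z) * ∑ j, R j / ((1 - l j * z) * (1 + l j)) := by
  classical
  have hlD : ∀ j, (l j : ℂ) ∈ oDisk := fun j => by
    rw [mem_oDisk, Complex.norm_real, Real.norm_eq_abs, abs_of_pos (hl0 j)]; exact hl1 j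
  have hal : ∀ j, a (l j) = 0 := fun j => (hz _ (hlD j)).2 ⟨j, rfl⟩
  -- Since `dslope a (l j)` divided by `a` is 1/(w - l_j), f/a is Y_m/a with its simple poles
  -- removed.
  set f : ℂ → ℂ := fun w => Y m w - ∑ j, (R j : ℂ) • dslope a (l j) w with hf
  have hfd : DiffContOnCl ℂ f oDisk := (S.right.diff m).sub
    (diffContOnCl_sum _ fun j _ => by
      exact (diffContOnCl_dslope S.diff (hlD j)).const_smul (R j : ℂ))
  have hfl : ∀ i, f (l i) = 0 := by
    intro i
    simp only [hf]
    rw [Finset.sum_eq_single i]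
    · rw [dslope_same, smul_eq_mul, hR, mul_comm, sub_self]
    · intro j _ hji
      have hne : (l i : ℂ) ≠ l j := fun h => hji (hinj (Complex.ofReal_injective h)).symm
      rw [dslope_of_ne _ hne, slope_def_field, hal, hal]
      simp
    · simp
  obtain ⟨h₁, hh₁, hfh⟩ := exists_quotient S.diff hfd (Finset.univ.image fun j => (l j : ℂ))
    (fun z hz => by
      obtain ⟨j, -, rfl⟩ := Finset.mem_image.1 hz
      exact ⟨hlD j, hal j, hder j, hfl j⟩)
    (fun z hzC h0 => by
      rcases (mem_cDisk.1 hzC).lt_or_eq with h | h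
      · obtain ⟨j, rfl⟩ := (hz z (mem_oDisk.2 h)).1 h0
        simp
      · exact absurd h0 (S.ne_zero (mem_sphere_zero_iff_norm.2 h)))
  -- The subtracted terms reflect these poles in the circle: for |w| = 1, 1/(w - l) is the conjugate
  -- of w/(1 - l w).
  set h₂ : ℂ → ℂ := fun w => X m w - ∑ j, (1 - (l j : ℂ) * w)⁻¹ • ((R j : ℂ) • w) with hh₂
  have hh₂d : DiffContOnCl ℂ h₂ oDisk := by
    refine (S.left.diff m).sub (diffContOnCl_sum _ fun j _ => ?_)
    have h1 : DiffContOnCl ℂ (fun w : ℂ => (R j : ℂ) • w) oDisk :=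
      Differentiable.diffContOnCl (by fun_prop)
    have h2 : DiffContOnCl ℂ (fun w : ℂ => 1 - (l j : ℂ) * w) oDisk :=
      Differentiable.diffContOnCl (by fun_prop)
    exact (h2.inv fun w hw => one_sub_mul_ne_zero (hl0 j) (hl1 j)
      (by rwa [closure_oDisk] at hw)).smul h1
  have hbd : ∀ w ∈ Metric.sphere (0 : ℂ) 1, h₁ w = star (h₂ w) := by
    intro w hw
    have hwD : w ∈ cDisk := Metric.sphere_subset_closedBall hw
    have hww : w * star w = 1 := by
      rw [Complex.star_def, Complex.mul_conj, Complex.normSq_eq_norm_sq]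
      simp only [mem_sphere_zero_iff_norm] at hw
      simp [hw]
    have hwD' : star w ∈ cDisk := by rw [mem_cDisk, norm_star]; exact mem_cDisk.1 hwD
    have haw := S.ne_zero hw
    have e1 : ∀ j, dslope a (l j) w = a w * (star w / (1 - l j * star w)) := by
      intro j
      have hne : w ≠ l j := by
        rintro rfl
        exact haw (hal j)
      rw [dslope_of_ne _ hne, slope_def_field, hal, sub_zero, div_eq_mul_inv]
      congr 1
      rw [inv_eq_iff_eq_inv, inv_div, eq_div_iff (fun h => by rw [h] at hww; simp at hww)]
      linear_combination hww
    have h3 := hfh w hwD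
    simp only [hf, e1, smul_eq_mul] at h3
    rw [S.circle w hw m] at h3
    have h4 : a w * h₁ w = a w * (X m (star w)
        - ∑ j, (R j : ℂ) * (star w / (1 - l j * star w))) := by
      rw [← h3, mul_sub, Finset.mul_sum]
      congr 1
      exact Finset.sum_congr rfl fun j _ => by ring
    rw [mul_left_cancel₀ haw h4, S.left.conj hwD]
    simp only [hh₂, smul_eq_mul, Complex.star_def, map_sub, map_sum, map_mul, map_inv₀, map_one,
      Complex.conj_ofReal]
    congr 1
    exact Finset.sum_congr rfl fun j _ => by ring
  -- As h₁ is conjugate to h₂ on the circle, h₁ + h₂ and i(h₁ - h₂) have real boundary values, so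
  -- both are constant, and with them h₂.
  obtain ⟨c₁, hc₁⟩ := exists_const_of_real_boundary (hh₁.add hh₂d) fun w hw => by
    simp [hbd w hw]
  obtain ⟨c₂, hc₂⟩ := exists_const_of_real_boundary ((hh₁.sub hh₂d).const_smul Complex.I)
    fun w hw => by simp [hbd w hw]
  have hconst : ∀ w ∈ cDisk, h₂ w = (c₁ + Complex.I * c₂) / 2 := by
    intro w hw
    have e1 := hc₁ w hw
    have e2 := hc₂ w hw
    simp only [Pi.add_apply, Pi.sub_apply, Pi.smul_apply, smul_eq_mul] at e1 e2
    linear_combination e1 / 2 + Complex.I * e2 / 2 - (h₁ w - h₂ w) / 2 * Complex.I_mul_I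
  have hm1 : (-1 : ℂ) ∈ cDisk := by simp
  have h5 := (hconst z hzD).trans (hconst _ hm1).symm
  simp only [hh₂, S.left.eval_neg_one, smul_eq_mul] at h5
  rw [sub_eq_iff_eq_add.1 h5, sub_add, ← Finset.sum_sub_distrib, sub_eq_add_neg,
    ← Finset.sum_neg_distrib, Finset.mul_sum]
  congr 1
  refine Finset.sum_congr rfl fun j _ => ?_
  have h6 := one_sub_mul_ne_zero (hl0 j) (hl1 j) hzD
  have h7 := one_sub_mul_ne_zero (hl0 j) (hl1 j) hm1
  have h8 : 1 + (l j : ℂ) ≠ 0 := by simpa using h7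
  have h9 : 1 - (l j : ℂ) * -1 = 1 + l j := by ring
  rw [h9]
  field_simp
  ring

end

/-! ### Bound states and the reconstruction of the potential -/

/-- The zeros `l j` of the transmission coefficient `a`, with the proportionality factors `b j`
and the (positive) weights `γ j = -b j / a' (l j)`. -/
structure BoundStates (X Y : ℤ → ℂ → ℂ) (a : ℂ → ℂ) {N : ℕ} (l : Fin N → ℝ) (b : Fin N → ℂ)
    (γ : Fin N → ℝ) : Prop where
  inj : Function.Injective l
  pos : ∀ j, 0 < l j
  lt_one : ∀ j, l j < 1
  zero_iff : ∀ z ∈ oDisk, a z = 0 ↔ ∃ j, z = l j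
  prop : ∀ j m, (l j : ℂ) ^ m * Y m (l j) = b j * X m (l j)
  weight_pos : ∀ j, 0 < γ j
  deriv_ne : ∀ j, deriv a (l j) ≠ 0
  eq_deriv : ∀ j, b j = -(γ j * deriv a (l j))

section

variable {v : ℤ → ℝ} {X Y : ℤ → ℂ → ℂ} {a : ℂ → ℂ}

theorem ofReal_mem_oDisk {r : ℝ} (h0 : 0 < r) (h1 : r < 1) : (r : ℂ) ∈ oDisk := by
  rwa [mem_oDisk, Complex.norm_real, Real.norm_eq_abs, abs_of_pos h0]

theorem LeftJost.ofReal_re (hX : LeftJost v X) {r : ℝ} (hr : (r : ℂ) ∈ cDisk) (m : ℤ) :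
    ((X m r).re : ℂ) = X m r := by
  refine Complex.conj_eq_iff_re.1 ?_
  have := hX.conj hr m
  rw [Complex.star_def, Complex.conj_ofReal] at this
  exact this.symm

/-- At a zero of `a` the derivative of (1 - z) a is (1 - r) a', so the sign of the Wronskian
derivative makes γ = (1 - r)/τ positive. If a' vanished then `b`, and with it every Y_m, would
vanish. -/
theorem Scattering.exists_weight (S : Scattering v X Y a) (hd : ∀ m, 0 < 1 + v m) {r : ℝ}
    (h0 : 0 < r) (h1 : r < 1) (ha : a r = 0) :
    ∃ (b : ℂ) (γ : ℝ), (∀ m, (r : ℂ) ^ m * Y m r = b * X m r) ∧ 0 < γ ∧ deriv a r ≠ 0 ∧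
      b = -(γ * deriv a r) := by
  have hD := ofReal_mem_oDisk h0 h1
  have hC := oDisk_subset_cDisk hD
  have hr0 : (r : ℂ) ≠ 0 := by exact_mod_cast h0.ne'
  have hW : jostW X Y r = 0 := by rw [← S.eq_jostW _ hC, ha, mul_zero]
  obtain ⟨b, hb⟩ := exists_proportional S.left S.right hC hr0 hW
  obtain ⟨τ, hτ, hder⟩ := deriv_jostW_sign S.left S.right hd h0 h1 hW hb
  have hloc : jostW X Y =ᶠ[𝓝 (r : ℂ)] fun z => (1 - z) * a z := by
    filter_upwards [Metric.isOpen_ball.mem_nhds hD] with z hz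
    exact (S.eq_jostW z (oDisk_subset_cDisk hz)).symm
  have h2 : HasDerivAt (fun z => (1 - z) * a z) (-1 * a r + (1 - r) * deriv a r) (r : ℂ) :=
    ((hasDerivAt_id' (r : ℂ)).const_sub 1).mul
      (S.diff.differentiableAt Metric.isOpen_ball hD).hasDerivAt
  rw [hloc.deriv_eq, h2.deriv, ha, mul_zero, zero_add] at hder
  have hτ' : (τ : ℂ) ≠ 0 := by exact_mod_cast hτ.ne'
  have hb' : b = -(((1 - r) / τ : ℝ) * deriv a r) := by
    push_cast
    field_simp
    linear_combination hder
  refine ⟨b, (1 - r) / τ, hb, div_pos (by linarith) hτ, fun h => ?_, hb'⟩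
  rw [h, mul_zero, neg_zero] at hb'
  have hY0 : ∀ m, Y m r = 0 := fun m => by
    have := hb m
    rw [hb', zero_mul] at this
    exact (mul_eq_zero.1 this).resolve_left (zpow_ne_zero _ hr0)
  exact zero_ne_one (tendsto_nhds_unique
    (tendsto_const_nhds.congr fun m => (hY0 m).symm) (S.right.tendsto hC))

theorem Scattering.exists_boundStates (S : Scattering v X Y a) (hd : ∀ m, 0 < 1 + v m) :
    ∃ (N : ℕ) (l : Fin N → ℝ) (b : Fin N → ℂ) (γ : Fin N → ℝ), BoundStates X Y a l b γ := by
  have hfin : {r : ℝ | (r : ℂ) ∈ oDisk ∧ a r = 0}.Finite :=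
    S.finite_zeros.preimage Complex.ofReal_injective.injOn
  have hreal : ∀ z ∈ oDisk, a z = 0 → ∃ r : ℝ, 0 < r ∧ r < 1 ∧ z = r := fun z hz h =>
    zero_real S.left S.right hd hz (by rw [← S.eq_jostW z (oDisk_subset_cDisk hz), h, mul_zero])
  obtain ⟨N, l, hl, hrange⟩ := hfin.fin_param
  have hmem : ∀ j, (l j : ℂ) ∈ oDisk ∧ a (l j) = 0 := fun j => by
    have : l j ∈ Set.range l := ⟨j, rfl⟩
    rwa [hrange] at this
  have h01 : ∀ j, 0 < l j ∧ l j < 1 := fun j => by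
    obtain ⟨r, h0, h1, h⟩ := hreal _ (hmem j).1 (hmem j).2
    rw [Complex.ofReal_injective h]
    exact ⟨h0, h1⟩
  choose b γ h using fun j => S.exists_weight hd (h01 j).1 (h01 j).2 (hmem j).2
  refine ⟨N, l, b, γ, hl, fun j => (h01 j).1, fun j => (h01 j).2, fun z hz => ⟨fun h0 => ?_, ?_⟩,
    fun j => (h j).1, fun j => (h j).2.1, fun j => (h j).2.2.1, fun j => (h j).2.2.2⟩
  · obtain ⟨r, -, -, rfl⟩ := hreal z hz h0
    have : r ∈ Set.range l := by rw [hrange]; exact ⟨hz, h0⟩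
    obtain ⟨j, rfl⟩ := this
    exact ⟨j, rfl⟩
  · rintro ⟨j, rfl⟩
    exact (hmem j).2

end

/-! ### From zeros in the disc to spectral parameters and soliton data. -/

/-- The spectral parameter `k` with `(p - k) / (p + k) = l`. -/
def spectralK (p l : ℝ) : ℝ := p * (1 - l) / (1 + l)

section

variable {p l : ℝ}

theorem spectralK_pos (hp : 0 < p) (h0 : 0 < l) (h1 : l < 1) : 0 < spectralK p l :=
  div_pos (mul_pos hp (by linarith)) (by linarith)

theorem spectralK_lt (hp : 0 < p) (h0 : 0 < l) : spectralK p l < p := by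
  rw [spectralK, div_lt_iff₀ (by linarith)]
  nlinarith

theorem add_spectralK (h0 : 0 < l) : p + spectralK p l = 2 * p / (1 + l) := by
  have : 1 + l ≠ 0 := by positivity
  rw [spectralK]
  field_simp
  ring

theorem sub_spectralK (h0 : 0 < l) : p - spectralK p l = 2 * p * l / (1 + l) := by
  have : 1 + l ≠ 0 := by positivity
  rw [spectralK]
  field_simp
  ring

theorem spectralK_add {l' : ℝ} (h0 : 0 < l) (h0' : 0 < l') :
    spectralK p l + spectralK p l' = 2 * p * (1 - l * l') / ((1 + l) * (1 + l')) := by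
  have : 1 + l ≠ 0 := by positivity
  have : 1 + l' ≠ 0 := by positivity
  rw [spectralK, spectralK]
  field_simp
  ring

theorem rho_spectralK (hp : 0 < p) (h0 : 0 < l) : rho p (spectralK p l) = l⁻¹ := by
  have : 1 + l ≠ 0 := by positivity
  rw [rho, add_spectralK h0, sub_spectralK h0]
  field_simp

theorem cay_spectralK (hp : 0 < p) (h0 : 0 < l) : cay p (Complex.I * spectralK p l) = l := by
  have : 1 + l ≠ 0 := by positivity
  rw [cay_I_mul, add_spectralK h0, sub_spectralK h0]
  congr 1
  field_simp

theorem cay_eq_iff (hp : 0 < p) (h0 : 0 < l) {w : ℂ} (hw : 0 ≤ w.im) :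
    cay p w = l ↔ w = Complex.I * spectralK p l := by
  refine ⟨fun h => ?_, by rintro rfl; exact cay_spectralK hp h0⟩
  have h1 : (1 : ℂ) + l ≠ 0 := by exact_mod_cast (show (1 : ℝ) + l ≠ 0 by positivity)
  rw [cay, div_eq_iff (p_sub_ne_zero hp hw)] at h
  rw [spectralK]
  push_cast
  field_simp
  linear_combination (-Complex.I) * h + (1 + l) * w * Complex.I_mul_I

theorem hasDerivAt_cay (hp : 0 < p) {w : ℂ} (hw : 0 ≤ w.im) :
    HasDerivAt (cay p) (2 * p * Complex.I / (p - Complex.I * w) ^ 2) w := by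
  have h0 := p_sub_ne_zero hp hw
  have h1 : HasDerivAt (fun w : ℂ => (p : ℂ) + Complex.I * w) (Complex.I * 1) w :=
    ((hasDerivAt_id' w).const_mul Complex.I).const_add _
  have h2 : HasDerivAt (fun w : ℂ => (p : ℂ) - Complex.I * w) (-(Complex.I * 1)) w :=
    ((hasDerivAt_id' w).const_mul Complex.I).const_sub _
  refine (h1.div h2 h0).congr_deriv ?_
  congr 1
  ring

theorem spectralK_injective (hp : 0 < p) {N : ℕ} {l : Fin N → ℝ} (h0 : ∀ j, 0 < l j)
    (hl : Function.Injective l) : Function.Injective fun j => spectralK p (l j) := by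
  intro i j h
  refine hl (Complex.ofReal_injective ?_)
  rw [← cay_spectralK hp (h0 i), ← cay_spectralK hp (h0 j)]
  simp only at h
  rw [h]

end

section

variable {p : ℝ} {u : ℤ → ℝ} {X Y : ℤ → ℂ → ℂ} {a : ℂ → ℂ} {N : ℕ} {l : Fin N → ℝ}
  {b : Fin N → ℂ} {γ : Fin N → ℝ}

theorem Scattering.coeffA_eq (hp : 0 < p) (S : Scattering (fun m => u m / (2 * p)) X Y a) {w : ℂ}
    (hw : 0 < w.im) : coeffA p u w = a (cay p w) := by
  have hw0 : w ≠ 0 := by rintro rfl; simp at hw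
  have h1 : 1 - cay p w ≠ 0 := by
    rw [one_sub_cay hp hw.le]
    exact div_ne_zero (mul_ne_zero (by simp) hw0) (p_sub_ne_zero hp hw.le)
  rw [LatticeKdV.coeffA_eq hp S.left S.right hw.le hw0, ← S.eq_jostW _ (cay_mem_cDisk hp hw.le),
    mul_div_cancel_left₀ _ h1]

theorem BoundStates.isDiscreteEigenvalue_iff (hp : 0 < p)
    (S : Scattering (fun m => u m / (2 * p)) X Y a) (B : BoundStates X Y a l b γ) (z : ℂ) :
    IsDiscreteEigenvalue p u z ↔ ∃ j, z = Complex.I * spectralK p (l j) := by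
  constructor
  · rintro ⟨hz, h⟩
    rw [S.coeffA_eq hp hz, B.zero_iff _ (cay_mem_oDisk hp hz)] at h
    obtain ⟨j, hj⟩ := h
    exact ⟨j, (cay_eq_iff hp (B.pos j) hz.le).1 hj⟩
  · rintro ⟨j, rfl⟩
    have hz : 0 < (Complex.I * spectralK p (l j)).im := by
      simpa using spectralK_pos hp (B.pos j) (B.lt_one j)
    refine ⟨hz, ?_⟩
    rw [S.coeffA_eq hp hz, cay_spectralK hp (B.pos j)]
    exact (B.zero_iff _ (ofReal_mem_oDisk (B.pos j) (B.lt_one j))).2 ⟨j, rfl⟩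

/-- The proportionality factor is `b j` in both parameters. The derivative of `a` changes by dζ/dz =
i(1 + l)²/(2p), which explains the form of the constant. -/
theorem BoundStates.isNormingConstant (hp : 0 < p)
    (S : Scattering (fun m => u m / (2 * p)) X Y a) (B : BoundStates X Y a l b γ) (j : Fin N) :
    IsNormingConstant p u (Complex.I * spectralK p (l j))
      (Complex.I * (γ j * (2 * p) / (1 + l j) ^ 2 : ℝ)) := by
  have h0 := B.pos j
  have hz : 0 < (Complex.I * spectralK p (l j)).im := by
    simpa using spectralK_pos hp (B.pos j) (B.lt_one j)
  have hl : (l j : ℂ) ≠ 0 := by exact_mod_cast h0.ne'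
  have hl1 : (1 : ℂ) + l j ≠ 0 := by exact_mod_cast (show (1 : ℝ) + l j ≠ 0 by positivity)
  have hp' : (p : ℂ) ≠ 0 := by exact_mod_cast hp.ne'
  have hII : Complex.I * (Complex.I * spectralK p (l j)) = -spectralK p (l j) := by
    rw [← mul_assoc, Complex.I_mul_I]; ring
  have e1 : (p : ℂ) - Complex.I * (Complex.I * spectralK p (l j)) = 2 * p / (1 + l j) := by
    rw [hII, sub_neg_eq_add]
    exact_mod_cast congrArg Complex.ofReal (add_spectralK (p := p) h0)
  have e2 : (p : ℂ) + Complex.I * (Complex.I * spectralK p (l j)) = 2 * p / (1 + l j) * l j := by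
    rw [hII, ← sub_eq_add_neg]
    have := congrArg Complex.ofReal (sub_spectralK (p := p) h0)
    push_cast at this
    rw [this]
    ring
  have hder : deriv (coeffA p u) (Complex.I * spectralK p (l j))
      = deriv a (l j) * (Complex.I * (1 + l j) ^ 2 / (2 * p)) := by
    have hloc : coeffA p u =ᶠ[𝓝 (Complex.I * spectralK p (l j))] fun w => a (cay p w) := by
      filter_upwards [(isOpen_lt continuous_const Complex.continuous_im).mem_nhds hz] with w hw
      exact S.coeffA_eq hp hw
    have ha : HasDerivAt a (deriv a (l j)) (cay p (Complex.I * spectralK p (l j))) := by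
      rw [cay_spectralK hp h0]
      exact (S.diff.differentiableAt Metric.isOpen_ball
        (ofReal_mem_oDisk h0 (B.lt_one j))).hasDerivAt
    have hcomp := (ha.comp _ (hasDerivAt_cay hp hz.le)).deriv
    rw [Function.comp_def] at hcomp
    rw [hloc.deriv_eq, hcomp, e1]
    congr 1
    field_simp
  refine ⟨b j, fun m => ?_, ?_, ?_⟩
  · rw [jostRight_eq hp S.right hz.le, jostLeft_eq hp S.left hz.le, cay_spectralK hp h0, e1, e2,
      mul_zpow, mul_assoc, B.prop]
    ring
  · rw [hder]
    exact mul_ne_zero (B.deriv_ne j) (div_ne_zero (mul_ne_zero Complex.I_ne_zero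
      (pow_ne_zero _ hl1)) (mul_ne_zero two_ne_zero hp'))
  · have := B.deriv_ne j
    rw [hder, B.eq_deriv]
    push_cast
    field_simp
    rw [Complex.I_sq]
    ring

/-- The sum through which bound states enter the left Jost solution. -/
def boundSum (X : ℤ → ℂ → ℂ) (l γ : Fin N → ℝ) (m : ℤ) (z : ℂ) : ℂ :=
  ∑ j, ((-(γ j * (l j)⁻¹ ^ m * (X m (l j)).re) : ℝ) : ℂ) / ((1 - l j * z) * (1 + l j))

/-- The residue of Y_m/a at l_j is rewritten through `X` itself by proportionality, so evaluation at
the points l_i gives a closed linear system. -/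
theorem BoundStates.left_formula {v : ℤ → ℝ} (S : Scattering v X Y a)
    (B : BoundStates X Y a l b γ) (m : ℤ) {z : ℂ} (hz : z ∈ cDisk) :
    X m z = 1 + (1 + z) * boundSum X l γ m z := by
  refine S.left_formula B.pos B.lt_one B.zero_iff B.deriv_ne m (fun j => ?_) B.inj hz
  have hl : (l j : ℂ) ≠ 0 := by exact_mod_cast (B.pos j).ne'
  have hp := B.prop j m
  push_cast
  rw [S.left.ofReal_re (oDisk_subset_cDisk (ofReal_mem_oDisk (B.pos j) (B.lt_one j))),
    inv_zpow, eq_comm, ← mul_right_inj' (zpow_ne_zero m hl), hp, B.eq_deriv]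
  field_simp

/-- Inserting X = 1 + (1 + z)σ in the recurrence leaves an overall factor 1 + z. It is cancelled on
the circle away from -1, and continuity gives the value at -1. -/
theorem BoundStates.potential_eq {v : ℤ → ℝ} (S : Scattering v X Y a)
    (B : BoundStates X Y a l b γ) (m : ℤ) :
    (v (m + 1) : ℂ) = boundSum X l γ (m + 2) (-1) - boundSum X l γ m (-1) := by
  have hsub : Metric.sphere (0 : ℂ) 1 ⊆ cDisk := Metric.sphere_subset_closedBall
  have hc : ∀ m, ContinuousOn (boundSum X l γ m) (Metric.sphere (0 : ℂ) 1) := fun m =>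
    continuousOn_finsetSum _ fun j _ => ContinuousOn.div continuousOn_const (by fun_prop)
      fun z hz => mul_ne_zero (one_sub_mul_ne_zero (B.pos j) (B.lt_one j) (hsub hz))
        (by exact_mod_cast (show (1 : ℝ) + l j ≠ 0 by have := B.pos j; positivity))
  have h := sphere_eq_of_finite (z := -1)
    (g := fun z => 1 + boundSum X l γ (m + 2) z
      - (1 + v (m + 1)) * (1 + (1 + z) * boundSum X l γ (m + 1) z) + z * boundSum X l γ m z)
    (h := fun _ => 0)
    (((continuousOn_const.add (hc _)).sub (continuousOn_const.mul (continuousOn_const.add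
      ((continuousOn_const.add continuousOn_id).mul (hc _))))).add (continuousOn_id.mul (hc _)))
    continuousOn_const (Set.finite_singleton (-1)) (fun z hz hz1 => ?_) (by simp)
  · simp only [add_neg_cancel, zero_mul, add_zero, mul_one] at h
    linear_combination -h
  · have h1 : 1 + z ≠ 0 := fun h => hz1 (by rw [Set.mem_singleton_iff]; linear_combination h)
    have h2 := S.left.eqn m z (hsub hz)
    simp only [B.left_formula S _ (hsub hz)] at h2
    refine (mul_eq_zero.1 ?_).resolve_left h1
    linear_combination h2

theorem BoundStates.boundSum_neg_one {q : ℝ} (hp : 0 < p) {v : ℤ → ℝ}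
    (S : Scattering v X Y a) (B : BoundStates X Y a l b γ)
    (hq : ∀ j, spectralK p (l j) < q) (m : ℤ) :
    boundSum X l γ m (-1) = -((solitonSum p q (fun j => spectralK p (l j))
      (fun j => γ j * (2 * p) / (1 + l j) ^ 2) (fun _ => 1) m 0 / (2 * p) : ℝ) : ℂ) := by
  set k := fun j => spectralK p (l j) with hk
  set c := fun j => γ j * (2 * p) / (1 + l j) ^ 2 with hcdef
  have hk0 : ∀ j, 0 < k j := fun j => spectralK_pos hp (B.pos j) (B.lt_one j)
  have hkp : ∀ j, k j < p := fun j => spectralK_lt hp (B.pos j)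
  have hinj : Function.Injective k := spectralK_injective hp B.pos B.inj
  have hl1 : ∀ j, 1 + l j ≠ 0 := fun j => by have := B.pos j; positivity
  have hc : ∀ j, 0 < c j := fun j => by have := B.pos j; have := B.weight_pos j; positivity
  have hw : ∀ j, weight p q k c (fun _ => 1) m 0 j = c j * (l j)⁻¹ ^ m := fun j => by
    rw [weight, rVec, rho_spectralK hp (B.pos j), zpow_zero, one_mul, mul_one]
  have hW := LatticeKdV.weight_pos hk0 hkp hq hc (fun _ => one_pos) m 0
  -- The values of `X` at the zeros, multiplied by the weights, solve the system of `gramSol`; this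
  -- is the rational formula evaluated at l_i, with k_i + k_j expressed through l_i and l_j.
  have hy : gram k (weight p q k c (fun _ => 1) m 0) *ᵥ
      (fun j => weight p q k c (fun _ => 1) m 0 j * (X m (l j)).re) = 1 := by
    funext i
    rw [gram_mulVec, mul_div_cancel_left₀ _ (hW i).ne', Pi.one_apply]
    have hiD := oDisk_subset_cDisk (ofReal_mem_oDisk (B.pos i) (B.lt_one i))
    have hf := B.left_formula S m hiD
    rw [boundSum, ← S.left.ofReal_re hiD] at hf
    have hf' : (X m (l i)).re = 1 + (1 + l i) * ∑ j,
        -(γ j * (l j)⁻¹ ^ m * (X m (l j)).re) / ((1 - l j * l i) * (1 + l j)) := by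
      exact_mod_cast hf
    rw [hf', Finset.mul_sum, add_left_comm, ← Finset.sum_add_distrib, Finset.sum_eq_zero, add_zero]
    intro j _
    have h1 : 1 - l i * l j ≠ 0 := by
      have := mul_lt_one_of_nonneg_of_lt_one_left (B.pos i).le (B.lt_one i) (B.lt_one j).le
      linarith
    have h2 := hl1 i
    have h3 := hl1 j
    rw [hw, hk]
    simp only [hcdef]
    rw [spectralK_add (B.pos i) (B.pos j), mul_comm (l j) (l i)]
    field_simp
    ring
  rw [solitonSum_eq hk0 hinj hkp hq hc (fun _ => one_pos),
    ← eq_gramSol hk0 hinj hW hy, boundSum, Finset.sum_div, ← Complex.ofReal_neg,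
    ← Finset.sum_neg_distrib]
  push_cast
  refine Finset.sum_congr rfl fun j _ => ?_
  have h3 : (1 : ℂ) + l j ≠ 0 := by exact_mod_cast hl1 j
  have hp' : (p : ℂ) ≠ 0 := by exact_mod_cast hp.ne'
  rw [hw]
  simp only [hcdef]
  push_cast
  have h4 : (1 : ℂ) - l j * -1 = 1 + l j := by ring
  rw [h4]
  field_simp

end

/-! ### The soliton formula on row zero and the assembly of the theorem. -/

theorem eq_of_two_periodic_of_tendsto {f : ℤ → ℝ} (hf : ∀ m, f (m + 2) = f m) {C : ℝ}
    (h : Tendsto f atBot (𝓝 C)) (m : ℤ) : f m = C := by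
  have h3 : ∀ n : ℕ, f (m - 2 * n) = f m := by
    intro n
    induction n with
    | zero => simp
    | succ n ih =>
      rw [← ih, ← hf (m - 2 * (n + 1 : ℕ))]
      push_cast
      congr 1
      ring
  have t : Tendsto (fun n : ℕ => m - 2 * (n : ℤ)) atTop atBot :=
    tendsto_atBot.2 fun b => by
      filter_upwards [eventually_ge_atTop (m - b).toNat] with n hn
      omega
  exact tendsto_nhds_unique (tendsto_const_nhds.congr fun n => (h3 n).symm) (h.comp t)

/-- The potential is a difference over two sites, so it determines x - pm + soliton sum only up to a
sequence of period two. The limit at -∞ makes this sequence constant. -/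
theorem BoundStates.row_eq {p q : ℝ} {x : ℤ → ℤ → ℝ} {X Y : ℤ → ℂ → ℂ} {a : ℂ → ℂ} {N : ℕ}
    {l : Fin N → ℝ} {b : Fin N → ℂ} {γ : Fin N → ℝ} (hp : 0 < p)
    (S : Scattering (fun m => potential p x m 0 / (2 * p)) X Y a) (B : BoundStates X Y a l b γ)
    (hq : ∀ j, spectralK p (l j) < q) {C : ℝ}
    (hC : Tendsto (fun m : ℤ => x m 0 - p * m) atBot (𝓝 C)) (m : ℤ) :
    x m 0 = p * m + C - solitonSum p q (fun j => spectralK p (l j))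
      (fun j => γ j * (2 * p) / (1 + l j) ^ 2) (fun _ => 1) m 0 := by
  set s := fun m => solitonSum p q (fun j => spectralK p (l j))
      (fun j => γ j * (2 * p) / (1 + l j) ^ 2) (fun _ => 1) m 0 with hs
  have hper : ∀ m : ℤ, x (m + 2) 0 - p * (m + 2 : ℤ) + s (m + 2) = x m 0 - p * m + s m := by
    intro m
    have h := B.potential_eq S m
    rw [B.boundSum_neg_one hp S hq, B.boundSum_neg_one hp S hq] at h
    have h' : potential p x (m + 1) 0 / (2 * p) = -(s (m + 2) / (2 * p)) - -(s m / (2 * p)) := by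
      exact_mod_cast h
    rw [potential, add_assoc, add_sub_cancel_right] at h'
    norm_num at h'
    field_simp at h'
    push_cast
    linear_combination h'
  have hlim : Tendsto (fun m : ℤ => x m 0 - p * m + s m) atBot (𝓝 C) := by
    have := hC.add (tendsto_solitonSum_atBot (p := p) (q := q) (k := fun j => spectralK p (l j))
      (c := fun j => γ j * (2 * p) / (1 + l j) ^ 2) (ρ₀ := fun _ => 1)
      (fun j => spectralK_pos hp (B.pos j) (B.lt_one j)) (fun j => spectralK_lt hp (B.pos j)) 0)
    rwa [add_zero] at this
  have := eq_of_two_periodic_of_tendsto hper hlim m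
  simp only [hs] at this
  linear_combination this

end LatticeKdV

end

theorem mainTheorem1 (p q : ℝ) (hp : 0 < p) (hq : 0 < q) (x : ℤ → ℤ → ℝ)
    (hx : LatticeKdV.IsSolution p q x)
    (hasymp : LatticeKdV.HasLinearAsymptotics p q x)
    (hsum : Summable fun m : ℤ => (1 + |(m : ℝ)|) * |LatticeKdV.potential p x m 0|)
    (hpos : ∀ m : ℤ, 0 < 2 * p + LatticeKdV.potential p x m 0)
    (hrefl : LatticeKdV.IsReflectionless p (fun m => LatticeKdV.potential p x m 0))
    (heig : ∀ k : ℝ, LatticeKdV.IsDiscreteEigenvalue p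
      (fun m => LatticeKdV.potential p x m 0) (Complex.I * k) → k < q) :
    ∃ (N : ℕ) (k c ρ₀ : Fin N → ℝ) (C : ℝ),
      Function.Injective k ∧
      (∀ j, 0 < k j ∧ k j < p ∧ k j < q ∧ 0 < c j ∧ 0 < ρ₀ j) ∧
      (∀ z : ℂ, LatticeKdV.IsDiscreteEigenvalue p
        (fun m => LatticeKdV.potential p x m 0) z ↔ ∃ j, z = Complex.I * k j) ∧
      (∀ j, LatticeKdV.IsNormingConstant p (fun m => LatticeKdV.potential p x m 0)
        (Complex.I * k j) (Complex.I * (c j * ρ₀ j))) ∧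
      (∀ m n : ℤ, 0 < (LatticeKdV.cauchyM p q k c ρ₀ m n).det ∧
        0 < (1 + LatticeKdV.cauchyM p q k c ρ₀ m n).det) ∧
      (∀ m n : ℤ, x m n = p * m + q * n + C -
        c ⬝ᵥ ((1 + LatticeKdV.cauchyM p q k c ρ₀ m n)⁻¹ *ᵥ
          LatticeKdV.rVec p q k ρ₀ m n)) ∧
      (∀ n : ℤ, LatticeKdV.GelfandLevitan (LatticeKdV.kernelK p q k c ρ₀ n)
        (LatticeKdV.kernelB p q k c ρ₀ n)) ∧
      (∀ m n : ℤ, 1 + LatticeKdV.kernelK p q k c ρ₀ n m m ≠ 0 ∧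
        LatticeKdV.potential p x m n =
          2 * p * ((1 + LatticeKdV.kernelK p q k c ρ₀ n (m + 1) (m + 1)) /
            (1 + LatticeKdV.kernelK p q k c ρ₀ n m m) - 1)) := by
  open LatticeKdV in
  have hv : FirstMoment fun m => potential p x m 0 / (2 * p) := by
    refine (hsum.div_const (2 * p)).congr fun m => ?_
    rw [abs_div, abs_of_pos (show 0 < 2 * p by positivity), mul_div_assoc]
  have hd : ∀ m : ℤ, 0 < 1 + potential p x m 0 / (2 * p) := fun m => by
    have h2 : 0 < 2 * p := by positivity
    have := div_pos (hpos m) h2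
    rwa [add_div, div_self h2.ne'] at this
  obtain ⟨X, hX⟩ := exists_leftJost hv
  obtain ⟨Y, hY⟩ := exists_rightJost hv
  obtain ⟨a, S⟩ := exists_scattering hX hY fun z hz m =>
    reflectionless_circle (u := fun m => potential p x m 0) hp hX hY hrefl hz m
  obtain ⟨N, l, b, γ, B⟩ := S.exists_boundStates hd
  have hev := B.isDiscreteEigenvalue_iff (u := fun m => potential p x m 0) hp S
  have hkq : ∀ j, spectralK p (l j) < q := fun j => heig _ ((hev _).2 ⟨j, rfl⟩)
  -- The constant of the formula is the one at -∞, because the soliton sum vanishes there.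
  obtain ⟨C, C', hC⟩ := id hasymp
  have hrow := B.row_eq hp S hkq (C := C) (by simpa using (hC 0).1)
  set k := fun j => spectralK p (l j) with hk
  set c := fun j => γ j * (2 * p) / (1 + l j) ^ 2 with hcdef
  have hk0 : ∀ j, 0 < k j := fun j => spectralK_pos hp (B.pos j) (B.lt_one j)
  have hkp : ∀ j, k j < p := fun j => spectralK_lt hp (B.pos j)
  have hinj : Function.Injective k := spectralK_injective hp B.pos B.inj
  have hc : ∀ j, 0 < c j := fun j => by have := B.pos j; have := B.weight_pos j; positivity
  -- The norming constants determine only the products c_j ρ⁰_j, so ρ⁰ is normalised to 1.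
  have hρ : ∀ _ : Fin N, (0 : ℝ) < 1 := fun _ => one_pos
  have hsol := eq_soliton_of_row hp hq hk0 hinj hkp hkq hc hρ hx hasymp hrow
  refine ⟨N, k, c, fun _ => 1, C, hinj, fun j => ⟨hk0 j, hkp j, hkq j, hc j, one_pos⟩, hev,
    fun j => ?_, fun m n => ⟨det_cauchyM_pos hk0 hinj hkp hkq hc hρ m n,
      det_one_add_cauchyM_pos hk0 hinj hkp hkq hc hρ m n⟩, hsol,
    gelfandLevitan hp hk0 hinj hkp hkq hc hρ, fun m n => ?_⟩
  · have := B.isNormingConstant (u := fun m => potential p x m 0) hp S j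
    rwa [Complex.ofReal_one, mul_one]
  · have h0 := one_add_kernelK_diag_pos hk0 hinj hkp hkq hc hρ n m
    refine ⟨h0.ne', ?_⟩
    have h1 := potential_soliton hk0 hinj hkp hkq hc hρ (fun m => hsol m n) m
    rw [mul_sub, mul_one, ← mul_div_assoc, ← h1, mul_div_cancel_right₀ _ h0.ne']
    ring
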